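/- Definitions. An oriented plane in $\mathbb{R}^3$ is a pair $(v,d)$, $|v|=1$, standing for $\{x : v\cdot x=d\}$; it is identified with a point of the Blaschke cylinder $\mathcal{B}=\{(v,d):|v|=1\}\subset\mathbb{R}^4$. Four oriented planes meet in a conical point if they have exactly one common point and this point is the vertex of a circular cone in oriented contact with all four planes (each plane touches the cone along a generator and the orientations agree). They are in contact with a possibly degenerate cone if the four points of $\mathcal{B}$ are coplanar. A conical octahedron consists of eight distinct oriented planes $a_k,b_k$ ($k=1,\dots,4$; $a_k,b_k$ opposite faces) such that the four planes chosen one from each pair, two of them $a$'s and two $b$'s, always meet in a conical point (the six vertices) and the three vertices on each face are not collinear. An octahedral grid of oriented planes is a family $P_k(n)$, $k=1,\dots,4$, $n\in\mathbb{Z}$; its vertices correspond to the quadruples $(P_k(n_k))_k$ with $\sum n_k=2$, and its octahedra to the $x\in\mathbb{Z}^4$ with $\sum x_k=0$, with faces $a_k=P_k(x_k)$, $b_k=P_k(x_k+1)$. The grid is a conical octahedral grid if all its octahedra are conical octahedra, and a generalised conical grid if every vertex quadruple is in contact with a possibly degenerate cone. Its part of size $N$ consists of the planes with indices in $[-N,N+1]$.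 Two octahedra $O=(a_k,b_k)$, $O'=(a'_k,b'_k)$ are in oriented contact along the edge in which the faces $b_i$ and $a_l$ of $O$ meet ($i\neq l$) if the six pairs of corresponding face planes incident with the vertices of this edge coincide: $a'_i=b_i$, $b'_l=a_l$ and $a'_k=a_k$, $b'_k=b_k$ for $k\ne i,l$. A grid contains the pair if $O$ and $O'$ are its octahedra at $x=0$ and $x=e_i-e_l$. Theorem. Let $O,O'$ be two conical octahedra which are in oriented contact along an edge. (1) There exists a generalised conical grid (defined for all indices in $\mathbb{Z}$) containing $O$ and $O'$. (2) It is uniquely determined as far as the octahedra do not degenerate: for every $N\ge 0$, if $P$ and $Q$ are grids containing $O$ and $O'$, all octahedra of the part of size $N$ of $P$ are conical octahedra, and the part of size $N$ of $Q$ satisfies the condition of a generalised conical grid, then $P$ and $Q$ have the same planes in this part. (3) If no degeneration occurs, that is, if for every $N$ and every $P$ containing $O$ and $O'$ whose part of size $N$ satisfies the condition of a generalised conical grid, all octahedra of this part are conical octahedra, then there exists exactly one conical octahedral grid containing $O$ and $O'$. (4) In any case there is at most one conical octahedral grid containing $O$ and $O'$. -/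

import Mathlib

/-- Euclidean three-space. -/
abbrev E3 : Type := EuclideanSpace ℝ (Fin 3)

/-- An oriented plane `{x | ⟪normal, x⟫ = offset}` with unit normal `normal`; reversing the
orientation replaces `(normal, offset)` by `(-normal, -offset)`. -/
@[ext] structure OrientedPlane where
  normal : E3
  offset : ℝ
  norm_normal : ‖normal‖ = 1

namespace OrientedPlane

/-- The underlying set of points. -/
def carrier (π : OrientedPlane) : Set E3 := {x | inner ℝ π.normal x = π.offset}

/-- The point `(v, d)` of the Blaschke cylinder `{(v, d) : ‖v‖ = 1}` in four-space. -/
def blaschke (π : OrientedPlane) : E3 × ℝ := (π.normal, π.offset)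

end OrientedPlane

/-- A circular cone: `axis` is a unit vector pointing into one of the two nappes, `angle` is the
angle between the axis and the generators. -/
structure CircularCone where
  vertex : E3
  axis : E3
  angle : ℝ
  norm_axis : ‖axis‖ = 1
  angle_pos : 0 < angle
  angle_lt : angle < Real.pi / 2

namespace CircularCone

/-- The nappe into which the axis points. -/
def nappe (C : CircularCone) : Set E3 :=
  {x | inner ℝ C.axis (x - C.vertex) = Real.cos C.angle * ‖x - C.vertex‖}

end CircularCone

/-- Oriented contact of a plane with a cone: the plane touches the nappe along a generator, and its
normal points to the side on which the nappe lies. The cone is oriented by the choice of its axis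
vector: its tangent planes are cooriented towards the nappe selected by the axis, hence away from
the other nappe; replacing the axis vector by its negative reverses the orientation. -/
def InOrientedContact (π : OrientedPlane) (C : CircularCone) : Prop :=
  (∀ x ∈ C.nappe, π.offset ≤ inner ℝ π.normal x) ∧
    ∃ x ∈ C.nappe, x ≠ C.vertex ∧ x ∈ π.carrier

/-- Four oriented planes meet in exactly one point, and this point is conical: it is the vertex of
a circular cone which is in oriented contact with the four planes. -/
def MeetInConicalPoint (π : Fin 4 → OrientedPlane) : Prop :=
  ∃ C : CircularCone, (⋂ k, (π k).carrier) = {C.vertex} ∧ ∀ k, InOrientedContact (π k) C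

/-- Four oriented planes are in oriented contact with a common, possibly degenerate, circular cone:
they belong to a planar section of the Blaschke cylinder. -/
def InContactWithGeneralizedCone (π : Fin 4 → OrientedPlane) : Prop :=
  Coplanar ℝ (Set.range fun k => (π k).blaschke)

/-- The eight face planes of a combinatorial octahedron. `O k false` and `O k true` are opposite
faces. Two faces that share an edge have different Boolean labels, and two different faces with the
same label share exactly a vertex. -/
abbrev FacePlanes : Type := Fin 4 → Bool → OrientedPlane

/-- The vertices of the octahedron correspond to the choices of one face out of each of the four
pairs of opposite faces, two of them with label `true` and two with label `false`. -/
def IsVertexLabel (s : Fin 4 → Bool) : Prop :=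
  (Finset.univ.filter fun k => s k = true).card = 2

/-- The eight oriented planes generate an oriented octahedron: they are distinct, the four face
planes incident with each of the six vertices meet in exactly one point, and the three vertices of
each face form a proper triangle. -/
def IsOctahedron (O : FacePlanes) : Prop :=
  (Function.Injective fun f : Fin 4 × Bool => O f.1 f.2) ∧
    ∃ V : (Fin 4 → Bool) → E3,
      (∀ s, IsVertexLabel s → (⋂ k, (O k (s k)).carrier) = {V s}) ∧
      ∀ (k : Fin 4) (ε : Bool),
        AffineIndependent ℝ fun s : {s : Fin 4 → Bool // IsVertexLabel s ∧ s k = ε} => V s.1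

/-- A conical octahedron: an oriented octahedron all of whose vertices are conical. -/
def IsConicalOctahedron (O : FacePlanes) : Prop :=
  IsOctahedron O ∧ ∀ s, IsVertexLabel s → MeetInConicalPoint fun k => O k (s k)

/-- For `i ≠ l`, the faces `O i true` and `O l false` share an edge of `O`. The faces of `O` which
are incident with an end point of this edge are these two faces and the four faces `O k ε` with
`k ≠ i, l`. The octahedron `O'` on the other side of the edge lies in the opposite dihedral angle
of the two planes through the edge; there these planes carry the labels `(i, false)` and
`(l, true)`. The octahedra are in oriented contact along the edge if the six pairs of corresponding
oriented face planes coincide. -/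
def InOrientedContactAlongEdge (O O' : FacePlanes) (i l : Fin 4) : Prop :=
  i ≠ l ∧ O' i false = O i true ∧ O' l true = O l false ∧
    ∀ k, k ≠ i → k ≠ l → ∀ ε, O' k ε = O k ε

/-- Four sequences of oriented planes. In an octahedral grid (combinatorially, an `A₃`-lattice) the
vertices are the points in which the planes `P k (n k)` with `∑ k, n k = 2` meet. -/
abbrev PlaneFamily : Type := Fin 4 → ℤ → OrientedPlane

/-- The eight planes `P k (x k)`, `P k (x k + 1)`. If `∑ k, x k = 0`, these are the face planes of
an octahedron of the grid. -/
def cell (P : PlaneFamily) (x : Fin 4 → ℤ) : FacePlanes :=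
  fun k ε => P k (x k + if ε then 1 else 0)

/-- A conical octahedral grid: all octahedra of the octahedral grid are conical octahedra. -/
def IsConicalOctahedralGrid (P : PlaneFamily) : Prop :=
  ∀ x : Fin 4 → ℤ, ∑ k, x k = 0 → IsConicalOctahedron (cell P x)

/-- The same condition for the finite part of the grid which consists of the planes with indices
between `-N` and `N + 1`. -/
def IsConicalOctahedralGridUpTo (N : ℕ) (P : PlaneFamily) : Prop :=
  ∀ x : Fin 4 → ℤ, (∀ k, -(N : ℤ) ≤ x k ∧ x k ≤ N) → ∑ k, x k = 0 →
    IsConicalOctahedron (cell P x)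

/-- A possibly degenerate conical octahedral grid: any four planes associated with a vertex of the
grid are in oriented contact with a common, possibly degenerate, circular cone. -/
def IsGeneralizedConicalGrid (P : PlaneFamily) : Prop :=
  ∀ n : Fin 4 → ℤ, ∑ k, n k = 2 → InContactWithGeneralizedCone fun k => P k (n k)

/-- The same condition for the finite part of the grid which consists of the planes with indices
between `-N` and `N + 1`. -/
def IsGeneralizedConicalGridUpTo (N : ℕ) (P : PlaneFamily) : Prop :=
  ∀ n : Fin 4 → ℤ, (∀ k, -(N : ℤ) ≤ n k ∧ n k ≤ N + 1) → ∑ k, n k = 2 →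
    InContactWithGeneralizedCone fun k => P k (n k)

/-- The two given octahedra are cells of the grid which are neighbours along the edge given by
`i` and `l`. -/
def ContainsPair (P : PlaneFamily) (O O' : FacePlanes) (i l : Fin 4) : Prop :=
  cell P 0 = O ∧ cell P (Pi.single i 1 - Pi.single l 1) = O'

/-!
The oriented plane `(v, d)` is represented by its homogeneous coordinate vector `(v, d, 1)`, which
is a zero of the quadratic form `‖v‖² - w²`. The planes which touch a cone form a planar section of
the Blaschke cylinder, so the four planes of a conical vertex are coplanar points of this quadric,
no three of them collinear: their vectors form a circuit (`IsCircuit`). The faces of a conical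
octahedron thus correspond to the vertices of a cube with planar faces (`IsCube`), and a face is
determined by the other seven, since the planes of the three circuits through it have only this
point in common (`IsConicalOctahedron.eq_of_inContact`). Uniqueness follows by induction on the
size of the grid (`eq_of_containsPair`).

For the existence, the ten planes of the two octahedra are considered as points of a
three-dimensional projective space. A quadric through the vertices of a cube is determined by its
tangent plane in one vertex, and a quadric through seven vertices contains the eighth
(`IsCube.exists_quadric`, `IsCube.eighth_point`). A dimension count yields a second quadric through
all ten points, so the points lie on a curve of degree four, the intersection of two quadrics, and
they are smooth points of this curve (`exists_pencil`). As for plane cubics, the smooth points can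
be parametrised by an abelian group such that four points are coplanar if the sum of their
parameters has a certain value `κ`, and conversely if they form a circuit. Then the grid is formed
by arithmetic progressions in the group, whose difference is determined by the two octahedra
(`hasGrid_of_group`). The smooth points of the curve are in particular non-singular points of the
quadric, and therefore they are oriented planes (`exists_orientedPlane`).

It remains to find the group. If the curve contains no line, a projective normal form based on a
real smooth point (`CubePair.exists_coordinates`) shows that the curve is a Weierstrass cubic
embedded by the functions `1, X, Y, Y / X` or `1, X, Y, X²`, which may be singular, or consists of
two conics. In the first two cases the group is that of the Weierstrass curve, and planar sections
are computed by the class group of the coordinate ring (`exists_dotProduct_pointVectorOrigin`,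
`exists_dotProduct_pointVector`). For two conics it consists of the units of a quadratic algebra
modulo scalars (`CubePair.hasGrid_of_conics`).

If the curve contains a line, this line passes through the vertex of a cone, as the Blaschke
cylinder contains no other lines. Each circuit has exactly one point on the line, and the points on
the line are those of one of the four sequences (`CubePair.exists_mem_line_iff`). Coplanarity with
three points of the cone becomes an equation between the parameter on the line and a divided
difference (`IsCircuit.dividedDifference`), and the remaining curve, which is a twisted cubic, a
conic with a line or three lines, is parametrised by the additive or the multiplicative group of
the real numbers (`CubePair.hasGrid_of_cone`).
-/

open Submodule QuadraticMap

/-! ### Circuits and cubes -/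

section Circuits

variable {V W : Type*} [AddCommGroup V] [Module ℝ V] [AddCommGroup W] [Module ℝ W]

/-- Four vectors form a circuit if they are linearly dependent, but any three of them are
linearly independent. For homogeneous coordinate vectors: four coplanar points, no three of which
are collinear. -/
structure IsCircuit (x : Fin 4 → V) : Prop where
  exists_rel : ∃ c : Fin 4 → ℝ, c ≠ 0 ∧ ∑ k, c k • x k = 0
  eq_zero : ∀ c : Fin 4 → ℝ, ∑ k, c k • x k = 0 → ∀ k, c k = 0 → c = 0

theorem IsCircuit.exists_rel_ne {x : Fin 4 → V} (h : IsCircuit x) :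
    ∃ c : Fin 4 → ℝ, (∀ k, c k ≠ 0) ∧ ∑ k, c k • x k = 0 := by
  obtain ⟨c, hc, hs⟩ := h.exists_rel
  exact ⟨c, fun k hk => hc (h.eq_zero c hs k hk), hs⟩

theorem IsCircuit.not_mem_span_singleton {x : Fin 4 → V} (h : IsCircuit x) {k j : Fin 4}
    (hkj : k ≠ j) : x k ∉ span ℝ {x j} := by
  intro hk
  obtain ⟨r, hr⟩ := mem_span_singleton.1 hk
  have hm : ∃ m : Fin 4, m ≠ k ∧ m ≠ j := by clear hkj hk hr; revert k j; decide
  obtain ⟨m, hmk, hmj⟩ := hm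
  have := h.eq_zero (Pi.single k 1 - Pi.single j r)
    (by simp [Pi.single_apply, sub_smul, Finset.sum_sub_distrib, hr]) m (by simp [hmk, hmj])
  simpa [hkj] using congrFun this k

/-- Any vector of the span of a circuit is a combination of three of its vectors. -/
theorem IsCircuit.exists_of_mem_span {x : Fin 4 → V} (h : IsCircuit x) {y : V}
    (hy : y ∈ span ℝ (Set.range x)) (k : Fin 4) :
    ∃ c : Fin 4 → ℝ, c k = 0 ∧ ∑ j, c j • x j = y := by
  obtain ⟨d, hd, hs⟩ := h.exists_rel_ne
  obtain ⟨c, hc⟩ := (mem_span_range_iff_exists_fun ℝ).1 hy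
  refine ⟨fun j => c j - c k / d k * d j, ?_, ?_⟩
  · field_simp [hd k]; ring
  · simp only [sub_smul, mul_smul, Finset.sum_sub_distrib, hc, ← Finset.smul_sum, hs]
    simp

/-- A vector which is dependent of three vectors of a circuit lies in the span of the circuit. -/
theorem IsCircuit.mem_span_of_update {x : Fin 4 → V} (h : IsCircuit x) {y : V} {k : Fin 4}
    (hy : ¬ LinearIndependent ℝ (Function.update x k y)) : y ∈ span ℝ (Set.range x) := by
  rw [Fintype.not_linearIndependent_iff] at hy
  obtain ⟨g, hg, j, hj⟩ := hy
  have hsplit : ∀ z : V, ∑ i, g i • Function.update x k z i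
      = g k • z + ∑ i ∈ Finset.univ.erase k, g i • x i := by
    intro z
    rw [← Finset.add_sum_erase _ _ (Finset.mem_univ k)]
    congr 1
    · simp
    · refine Finset.sum_congr rfl fun i hi => ?_
      rw [Function.update_of_ne (Finset.ne_of_mem_erase hi)]
  by_cases hk : g k = 0
  · have h0 : ∑ i, g i • x i = 0 := by
      have h1 := hsplit (x k)
      rw [Function.update_eq_self] at h1
      rw [hsplit y] at hg
      rw [h1, ← hg, hk, zero_smul, zero_smul]
    exact absurd (congrFun (h.eq_zero g h0 k hk) j) hj
  · have h1 : y = -(g k)⁻¹ • ∑ i ∈ Finset.univ.erase k, g i • x i := by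
      rw [hsplit y] at hg
      rw [neg_smul, ← smul_neg, ← eq_neg_of_add_eq_zero_left hg, smul_smul, inv_mul_cancel₀ hk,
        one_smul]
    rw [h1]
    exact smul_mem _ _ (sum_mem fun i _ => smul_mem _ _ (subset_span ⟨i, rfl⟩))

theorem IsCircuit.not_linearIndependent {x : Fin 4 → V} (h : IsCircuit x) :
    ¬ LinearIndependent ℝ x := by
  obtain ⟨c, hc, hs⟩ := h.exists_rel_ne
  exact Fintype.not_linearIndependent_iff.2 ⟨c, hs, 0, hc 0⟩

theorem IsCircuit.of_map {x : Fin 4 → V} (f : V →ₗ[ℝ] W) (hf : Function.Injective f)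
    (h : IsCircuit fun k => f (x k)) : IsCircuit x := by
  have key : ∀ c : Fin 4 → ℝ, ∑ k, c k • f (x k) = 0 ↔ ∑ k, c k • x k = 0 := by
    intro c
    rw [← map_eq_zero_iff f hf]
    simp
  exact ⟨by simpa only [key] using h.exists_rel, fun c hc => h.eq_zero c ((key c).2 hc)⟩

/-- The algebraic content of a non-degenerate octahedron: each vertex corresponds to a circuit of
four face vectors, and the spans of the three circuits which belong to the vertices of a face have
only the line of the face vector in common. Combinatorially the face vectors are the vertices of a
cube, and the circuits are its faces. -/
structure IsCube (X : Fin 4 → Bool → V) : Prop where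
  circuit : ∀ s, IsVertexLabel s → IsCircuit fun k => X k (s k)
  face : ∀ k ε y, (∀ s, IsVertexLabel s → s k = ε → y ∈ span ℝ (Set.range fun k => X k (s k))) →
    y ∈ span ℝ {X k ε}

theorem IsCube.of_map {X : Fin 4 → Bool → V} (f : V →ₗ[ℝ] W) (hf : Function.Injective f)
    (h : IsCube fun k ε => f (X k ε)) : IsCube X := by
  refine ⟨fun s hs => (h.circuit s hs).of_map f hf, fun k ε y hy => ?_⟩
  have h1 := h.face k ε (f y) fun s hs hk => by
    have h2 := mem_map_of_mem (f := f) (hy s hs hk)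
    rwa [map_span, ← Set.range_comp] at h2
  rw [← Set.image_singleton, ← map_span] at h1
  obtain ⟨z, hz, hzy⟩ := h1
  rwa [← hf hzy]

end Circuits

/-! ### Homogeneous coordinates of oriented planes -/

section Lift

/-- Homogeneous coordinates of the point of the Blaschke cylinder. -/
def OrientedPlane.lift (π : OrientedPlane) : E3 × ℝ × ℝ := (π.normal, π.offset, 1)

theorem OrientedPlane.lift_injective : Function.Injective OrientedPlane.lift := by
  intro π ρ h
  simp only [OrientedPlane.lift, Prod.mk.injEq] at h
  exact OrientedPlane.ext h.1 h.2.1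

theorem OrientedPlane.eq_of_lift_mem_span {π ρ : OrientedPlane}
    (h : π.lift ∈ span ℝ {ρ.lift}) : π = ρ := by
  obtain ⟨r, hr⟩ := mem_span_singleton.1 h
  have : r = 1 := by simpa [OrientedPlane.lift] using congrArg (fun x => x.2.2) hr
  rw [this, one_smul] at hr
  exact (OrientedPlane.lift_injective hr).symm

/-- Points are coplanar if and only if their homogeneous coordinate vectors are linearly dependent.
-/
theorem inContactWithGeneralizedCone_iff (π : Fin 4 → OrientedPlane) :
    InContactWithGeneralizedCone π ↔ ¬ LinearIndependent ℝ fun k => (π k).lift := by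
  unfold InContactWithGeneralizedCone
  rw [coplanar_iff_finrank_le_two, ← not_iff_not, not_not,
    ← affineIndependent_iff_not_finrank_vectorSpan_le ℝ _
      (show Fintype.card (Fin 4) = 2 + 2 by simp), affineIndependent_iff,
    Fintype.linearIndependent_iff]
  have key : ∀ g : Fin 4 → ℝ, ∑ k, g k • (π k).lift = 0 ↔
      ∑ k, g k • (π k).blaschke = 0 ∧ ∑ k, g k = 0 := by
    intro g
    simp only [Prod.ext_iff, Prod.fst_sum, Prod.snd_sum, OrientedPlane.lift,
      OrientedPlane.blaschke, Prod.smul_fst, Prod.smul_snd, Prod.fst_zero, Prod.snd_zero,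
      smul_eq_mul, mul_one, and_assoc]
  constructor
  · intro h g hg k
    exact h Finset.univ g ((key g).1 hg).2 ((key g).1 hg).1 k (Finset.mem_univ k)
  · intro h s w hw hs e he
    have := h (fun k => if k ∈ s then w k else 0) ((key _).2 ⟨?_, ?_⟩) e
    · simpa [he] using this
    · simpa [ite_smul, Finset.sum_ite_mem] using hs
    · simpa [Finset.sum_ite_mem] using hw

/-- Three different points of a sphere are not collinear. -/
theorem eq_zero_of_sum_smul_unit {v : Fin 3 → E3} (hv : ∀ k, ‖v k‖ = 1)
    (hinj : Function.Injective v) {c : Fin 3 → ℝ} (hc : ∑ k, c k = 0)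
    (h : ∑ k, c k • v k = 0) : c = 0 := by
  have key : ∀ a b d : Fin 3, a ≠ b → c a + c b + c d = 0 →
      c a • v a + c b • v b + c d • v d = 0 → c a * c b = 0 := by
    intro a b d hab h1 h2
    have h3 : c a • v a + c b • v b = (c a + c b) • v d := by
      rw [eq_neg_of_add_eq_zero_left h2, ← neg_smul]; congr 1; linarith
    have h4 := congrArg (fun x => inner ℝ x x) h3
    simp only [inner_add_left, inner_add_right, inner_smul_left, inner_smul_right,
      real_inner_self_eq_norm_sq, hv, real_inner_comm (v a) (v b)] at h4
    have h5 : c a * c b * (1 - inner ℝ (v a) (v b)) = 0 := by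
      simp only [conj_trivial] at h4
      linear_combination (-1 / 2) * h4
    rcases mul_eq_zero.1 h5 with h6 | h6
    · exact h6
    · exact absurd (hinj ((inner_eq_one_iff_of_norm_eq_one (𝕜 := ℝ) (hv a) (hv b)).1
        (sub_eq_zero.1 h6).symm)) hab
  rw [Fin.sum_univ_three] at hc h
  have h01 := key 0 1 2 (by decide) hc h
  have h12 := key 1 2 0 (by decide) (by linarith) (by rw [← h]; abel)
  have h20 := key 2 0 1 (by decide) (by linarith) (by rw [← h]; abel)
  have h0 : c 0 = 0 := by
    have : c 0 * c 0 = 0 := by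
      have : c 0 = - c 1 - c 2 := by linarith
      calc c 0 * c 0 = c 0 * (- c 1 - c 2) := by rw [← this]
        _ = 0 := by linarith
    exact mul_self_eq_zero.1 this
  have h1 : c 1 = 0 := by
    have : c 1 * c 1 = 0 := by
      have : c 1 = - c 2 := by linarith
      calc c 1 * c 1 = c 1 * (- c 2) := by rw [← this]
        _ = 0 := by linarith
    exact mul_self_eq_zero.1 this
  have h2 : c 2 = 0 := by linarith
  funext k; fin_cases k <;> simp [h0, h1, h2]

/-- The normals of the planes which touch a cone form a circle on the unit sphere. -/
theorem inner_axis_normal {π : OrientedPlane} {C : CircularCone} (h : InOrientedContact π C)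
    (hV : C.vertex ∈ π.carrier) : inner ℝ C.axis π.normal = Real.sin C.angle := by
  obtain ⟨h1, x, hx, hxV, hxπ⟩ := h
  set θ := C.angle
  have hs : 0 < Real.sin θ := Real.sin_pos_of_pos_of_lt_pi C.angle_pos
    (by linarith [C.angle_lt, Real.pi_pos])
  have hc : 0 < Real.cos θ := Real.cos_pos_of_mem_Ioo
    ⟨by linarith [C.angle_pos, Real.pi_pos], C.angle_lt⟩
  have hsc := Real.sin_sq_add_cos_sq θ
  set v := π.normal with hv
  set a := C.axis with ha
  have hvn : inner ℝ v v = (1 : ℝ) := by rw [real_inner_self_eq_norm_sq, π.norm_normal]; norm_num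
  have han : inner ℝ a a = (1 : ℝ) := by rw [real_inner_self_eq_norm_sq, C.norm_axis]; norm_num
  set c := inner ℝ a v with hcdef
  set u := v - c • a with hu
  have hau : inner ℝ a u = 0 := by
    rw [hu, inner_sub_right, inner_smul_right, han]; simp [hcdef]
  have huu : inner ℝ u u = 1 - c ^ 2 := by
    have : inner ℝ u u = inner ℝ v u := by
      conv_lhs => rw [hu, inner_sub_left, inner_smul_left, ← hu, hau]
      simp
    rw [this, hu, inner_sub_right, inner_smul_right, hvn, real_inner_comm, ← hcdef]; ring
  have hn : ‖u‖ ^ 2 = 1 - c ^ 2 := by rw [← huu, real_inner_self_eq_norm_sq]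
  have hvu : inner ℝ v u = ‖u‖ ^ 2 := by
    rw [hn, hu, inner_sub_right, inner_smul_right, hvn, real_inner_comm, ← hcdef]; ring
  simp only [OrientedPlane.carrier, Set.mem_ofPred_eq, CircularCone.nappe] at hV hxπ hx h1
  obtain ⟨y, hy⟩ : ∃ y, y = x - C.vertex := ⟨_, rfl⟩
  rw [← hy] at hx
  have hy0 : 0 < ‖y‖ := norm_pos_iff.2 (hy ▸ sub_ne_zero.2 hxV)
  have hvy : inner ℝ v y = 0 := by rw [hy, inner_sub_right, hV, hxπ, sub_self]
  have hdec : inner ℝ v y = c * inner ℝ a y + inner ℝ u y := by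
    have : v = c • a + u := by rw [hu]; abel
    conv_lhs => rw [this, inner_add_left, inner_smul_left]
    simp
  set z := y - (inner ℝ a y) • a with hz
  have huz : inner ℝ u y = inner ℝ u z := by
    rw [hz, inner_sub_right, inner_smul_right, real_inner_comm a u, hau, mul_zero, sub_zero]
  have hzn : ‖z‖ = Real.sin θ * ‖y‖ := by
    have : ‖z‖ ^ 2 = (Real.sin θ * ‖y‖) ^ 2 := by
      rw [hz, ← real_inner_self_eq_norm_sq, inner_sub_left, inner_sub_right, inner_sub_right,
        inner_smul_left, inner_smul_left, inner_smul_right, inner_smul_right, han,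
        real_inner_self_eq_norm_sq, real_inner_comm a y, hx]
      simp only [conj_trivial]
      linear_combination (-‖y‖ ^ 2) * hsc
    exact (sq_eq_sq₀ (norm_nonneg _) (by positivity)).1 this
  have hle : c * Real.cos θ ≤ ‖u‖ * Real.sin θ := by
    have h2 : -(‖u‖ * ‖z‖) ≤ inner ℝ u z := (abs_le.1 (abs_real_inner_le_norm u z)).1
    rw [hdec, huz, hx] at hvy
    rw [hzn] at h2
    have h3 : c * Real.cos θ * ‖y‖ ≤ ‖u‖ * Real.sin θ * ‖y‖ := by linarith
    exact le_of_mul_le_mul_right h3 hy0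
  have hu0 : u ≠ 0 := by
    intro h0
    rw [hdec, h0, inner_zero_left, add_zero, hx] at hvy
    have hc0 : c = 0 := by
      rcases mul_eq_zero.1 hvy with h | h
      · exact h
      · exact absurd h (by positivity)
    rw [h0, hc0] at hn
    norm_num at hn
  have hupos : 0 < ‖u‖ := norm_pos_iff.2 hu0
  have hge : ‖u‖ * Real.sin θ ≤ c * Real.cos θ := by
    -- the generator of the cone which is closest to the plane
    set w := Real.cos θ • a - (Real.sin θ / ‖u‖) • u with hw
    have haw : inner ℝ a w = Real.cos θ := by
      rw [hw, inner_sub_right, inner_smul_right, inner_smul_right, han, hau]; ring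
    have hww : ‖w‖ = 1 := by
      have : ‖w‖ ^ 2 = 1 ^ 2 := by
        rw [← real_inner_self_eq_norm_sq]
        conv_lhs => rw [hw, inner_sub_left, ← hw, inner_smul_left, inner_smul_left, haw]
        rw [hw, inner_sub_right, inner_smul_right, inner_smul_right, real_inner_comm, hau,
          real_inner_self_eq_norm_sq]
        simp only [conj_trivial]
        field_simp
        linear_combination ‖u‖ * hsc
      exact (sq_eq_sq₀ (norm_nonneg _) (by norm_num)).1 this
    have h2 := h1 (C.vertex + w) (by rw [add_sub_cancel_left, haw, hww, mul_one])
    rw [inner_add_right, hV, hw, inner_sub_right, inner_smul_right, inner_smul_right, hvu,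
      real_inner_comm, ← hcdef] at h2
    have h3 : Real.sin θ / ‖u‖ * ‖u‖ ^ 2 = ‖u‖ * Real.sin θ := by field_simp
    linarith
  have heq : c * Real.cos θ = ‖u‖ * Real.sin θ := le_antisymm hle hge
  have hc2 : c ^ 2 = Real.sin θ ^ 2 := by
    have := congrArg (· ^ 2) heq
    simp only [mul_pow, hn] at this
    linear_combination this - c ^ 2 * hsc
  have hcpos : 0 ≤ c := by
    by_contra hneg
    have := mul_neg_of_neg_of_pos (not_le.1 hneg) hc
    have := mul_pos hupos hs
    linarith
  exact (sq_eq_sq₀ hcpos hs.le).1 hc2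

/-- For `c ≠ 0` the planes through the point `x` whose normals `v` satisfy `⟪a, v⟫ = c` are those
whose homogeneous coordinate vectors belong to the range of this map. The range is
three-dimensional, and it corresponds to a planar section of the Blaschke cylinder. -/
noncomputable def pencilMap (x a : E3) (c : ℝ) : E3 →ₗ[ℝ] E3 × ℝ × ℝ :=
  LinearMap.prod LinearMap.id
    (LinearMap.prod (innerₗ E3 x) (c⁻¹ • innerₗ E3 a))

theorem pencilMap_apply (x a : E3) (c : ℝ) (v : E3) :
    pencilMap x a c v = (v, inner ℝ x v, c⁻¹ * inner ℝ a v) := rfl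

/-- Planes which meet in a conical point belong to a planar section of the Blaschke cylinder, which
is determined by the vertex, the axis and the angle of the cone. -/
theorem MeetInConicalPoint.exists_lift_eq {π : Fin 4 → OrientedPlane} (h : MeetInConicalPoint π)
    {x : E3} (hx : (⋂ k, (π k).carrier) = {x}) :
    ∃ (a : E3) (c : ℝ), c ≠ 0 ∧ ∀ k, (π k).lift = pencilMap x a c (π k).normal := by
  obtain ⟨C, hC, hk⟩ := h
  have hxC : x = C.vertex := by
    rw [hx] at hC; exact Set.singleton_eq_singleton_iff.1 hC
  subst hxC
  have hmem : ∀ k, C.vertex ∈ (π k).carrier := by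
    intro k
    have : C.vertex ∈ ⋂ k, (π k).carrier := by rw [hx]; rfl
    exact Set.mem_iInter.1 this k
  have hs : Real.sin C.angle ≠ 0 := (Real.sin_pos_of_pos_of_lt_pi C.angle_pos
    (by linarith [C.angle_lt, Real.pi_pos])).ne'
  refine ⟨C.axis, Real.sin C.angle, hs, fun k => ?_⟩
  rw [pencilMap_apply, inner_axis_normal (hk k) (hmem k), inv_mul_cancel₀ hs, real_inner_comm]
  have : inner ℝ (π k).normal C.vertex = (π k).offset := hmem k
  rw [this]; rfl

instance : DecidablePred IsVertexLabel := fun s =>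
  inferInstanceAs (Decidable ((Finset.univ.filter fun k => s k = true).card = 2))

theorem card_isVertexLabel (k : Fin 4) (ε : Bool) :
    Fintype.card {s : Fin 4 → Bool // IsVertexLabel s ∧ s k = ε} = 2 + 1 := by
  revert k ε; decide

variable {O : FacePlanes}

/-- The four planes of a vertex are in contact with a cone, hence coplanar as points of the Blaschke
cylinder; no three of them are collinear since the normals are different points of a sphere. -/
theorem IsConicalOctahedron.isCircuit (hO : IsConicalOctahedron O) {s : Fin 4 → Bool}
    (hs : IsVertexLabel s) : IsCircuit fun k => (O k (s k)).lift := by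
  obtain ⟨⟨hinj, V, hV, -⟩, hcon⟩ := hO
  obtain ⟨a, c, -, hl⟩ := (hcon s hs).exists_lift_eq (hV s hs)
  have hnorm : Function.Injective fun k => (O k (s k)).normal := by
    intro k j hkj
    have h1 : O k (s k) = O j (s j) := OrientedPlane.lift_injective (by
      rw [hl k, hl j]; exact congrArg _ hkj)
    exact (Prod.ext_iff.1 (@hinj (k, s k) (j, s j) h1)).1
  constructor
  · have hdep : ¬ LinearIndependent ℝ fun k => (O k (s k)).normal := by
      intro h
      have := h.fintype_card_le_finrank
      simp at this
    obtain ⟨c', h1, k, hk⟩ := Fintype.not_linearIndependent_iff.1 hdep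
    refine ⟨c', fun h => hk (by simp [h]), ?_⟩
    simp only [hl, ← map_smul, ← map_sum, h1, map_zero]
  · intro d hd k hk
    have h1 : ∑ j, d j • (O j (s j)).normal = 0 := by
      have := congrArg Prod.fst hd
      simpa [Prod.fst_sum, OrientedPlane.lift] using this
    have h2 : ∑ j, d j = 0 := by
      have := congrArg (fun x => x.2.2) hd
      simpa [Prod.snd_sum, OrientedPlane.lift] using this
    rw [Fin.sum_univ_succAbove _ k, hk] at h1 h2
    rw [zero_smul, zero_add] at h1
    rw [zero_add] at h2
    have h3 := eq_zero_of_sum_smul_unit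
      (v := fun j => (O (k.succAbove j) (s (k.succAbove j))).normal)
      (fun j => (O _ _).norm_normal)
      (fun i j hij => Fin.succAbove_right_injective (hnorm hij)) h2 h1
    funext j
    rcases Fin.eq_self_or_eq_succAbove k j with rfl | ⟨j', rfl⟩
    · exact hk
    · exact congrFun h3 j'

theorem IsConicalOctahedron.span_le_range (hO : IsConicalOctahedron O) {s : Fin 4 → Bool}
    (hs : IsVertexLabel s) {x : E3} (hx : (⋂ k, (O k (s k)).carrier) = {x}) :
    ∃ (a : E3) (c : ℝ), c ≠ 0 ∧ (∀ k, (O k (s k)).lift = pencilMap x a c (O k (s k)).normal) ∧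
      span ℝ (Set.range fun k => (O k (s k)).lift) ≤ LinearMap.range (pencilMap x a c) := by
  obtain ⟨a, c, hc, hl⟩ := (hO.2 s hs).exists_lift_eq hx
  refine ⟨a, c, hc, hl, Submodule.span_le.2 ?_⟩
  rintro _ ⟨k, rfl⟩
  exact ⟨_, (hl k).symm⟩

/-- The direction `(0, 1, 0)` of the generators of the Blaschke cylinder does not belong to the
plane of a vertex. -/
theorem IsConicalOctahedron.fst_ne_zero (hO : IsConicalOctahedron O) {s : Fin 4 → Bool}
    (hs : IsVertexLabel s) {y : E3 × ℝ × ℝ}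
    (hy : y ∈ span ℝ (Set.range fun k => (O k (s k)).lift)) (h0 : y.1 = 0) : y = 0 := by
  obtain ⟨V, hV, -⟩ := hO.1.2
  obtain ⟨a, c, -, -, hle⟩ := hO.span_le_range hs (hV s hs)
  obtain ⟨v, rfl⟩ := hle hy
  rw [pencilMap_apply] at h0 ⊢
  simp only at h0
  simp [h0]

/-- A plane whose coordinate vector belongs to the spans of the three vertices of a face passes
through these vertices. As they are not collinear, the plane is the plane of the face. -/
theorem IsConicalOctahedron.isCube (hO : IsConicalOctahedron O) :
    IsCube fun k ε => (O k ε).lift := by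
  refine ⟨fun s hs => hO.isCircuit hs, fun k ε y hy => ?_⟩
  obtain ⟨V, hV, haff⟩ := hO.1.2
  have haff := haff k ε
  have hcard := card_isVertexLabel k ε
  set W := vectorSpan ℝ (Set.range fun s : {s : Fin 4 → Bool // IsVertexLabel s ∧ s k = ε} => V s.1)
    with hWdef
  -- the normals of the planes through the three vertices of the face form the line `Wᗮ`
  have hW : Module.finrank ℝ W = 2 := haff.finrank_vectorSpan hcard
  have hWo : Module.finrank ℝ Wᗮ = 1 := by
    have := W.finrank_add_finrank_orthogonal
    rw [hW, finrank_euclideanSpace_fin] at this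
    omega
  obtain ⟨s₀⟩ : Nonempty {s : Fin 4 → Bool // IsVertexLabel s ∧ s k = ε} := by
    rw [← Fintype.card_pos_iff, hcard]; norm_num
  have hperp : ∀ v : E3, ∀ d : ℝ, (∀ s : {s : Fin 4 → Bool // IsVertexLabel s ∧ s k = ε},
      inner ℝ (V s.1) v = d) → v ∈ Wᗮ := by
    intro v d h
    rw [Submodule.mem_orthogonal]
    intro u hu
    rw [hWdef, vectorSpan_range_eq_span_range_vsub_left ℝ _ s₀] at hu
    induction hu using Submodule.span_induction with
    | mem x hx =>
      obtain ⟨s, rfl⟩ := hx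
      change inner ℝ (V s₀.1 - V s.1) v = 0
      rw [inner_sub_left, h, h, sub_self]
    | zero => simp
    | add x y _ _ hx hy => rw [inner_add_left, hx, hy, add_zero]
    | smul r x _ hx => rw [inner_smul_left, hx, mul_zero]
  have hy1 : ∀ s : {s : Fin 4 → Bool // IsVertexLabel s ∧ s k = ε},
      ∃ (a : E3) (c : ℝ), c ≠ 0 ∧ (O k ε).lift = pencilMap (V s.1) a c (O k ε).normal ∧
        y = pencilMap (V s.1) a c y.1 := by
    rintro ⟨s, hs, hsk⟩
    obtain ⟨a, c, hc, hl, hle⟩ := hO.span_le_range hs (hV s hs)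
    obtain ⟨v, hv⟩ := hle (hy s hs hsk)
    have hl' := hl k
    rw [hsk] at hl'
    refine ⟨a, c, hc, hl', ?_⟩
    rw [← hv]; rfl
  have hmem : y.1 ∈ Wᗮ := hperp y.1 y.2.1 fun s => by
    obtain ⟨a, c, -, -, h⟩ := hy1 s
    rw [pencilMap_apply] at h
    conv_rhs => rw [h]
  have hmem' : (O k ε).normal ∈ Wᗮ := hperp _ (O k ε).offset fun s => by
    obtain ⟨a, c, -, h, -⟩ := hy1 s
    rw [pencilMap_apply, OrientedPlane.lift] at h
    exact (congrArg (fun x => x.2.1) h).symm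
  have hn0 : (⟨(O k ε).normal, hmem'⟩ : Wᗮ) ≠ 0 := by
    intro h
    have h1 := (O k ε).norm_normal
    rw [show (O k ε).normal = 0 from congrArg Subtype.val h, norm_zero] at h1
    norm_num at h1
  obtain ⟨r, hr⟩ := (finrank_eq_one_iff_of_nonzero' _ hn0).1 hWo ⟨y.1, hmem⟩
  have hr' : r • (O k ε).normal = y.1 := congrArg Subtype.val hr
  obtain ⟨a, c, -, h1, h2⟩ := hy1 s₀
  rw [mem_span_singleton]
  exact ⟨r, by rw [h1, ← map_smul, hr', ← h2]⟩

end Lift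

/-! ### Uniqueness -/

section Uniqueness

/-- Each plane of a conical octahedron is determined by the other seven. -/
theorem IsConicalOctahedron.eq_of_inContact {O : FacePlanes} (hO : IsConicalOctahedron O)
    {k : Fin 4} {ε : Bool} {π : OrientedPlane}
    (h : ∀ s, IsVertexLabel s → s k = ε →
      InContactWithGeneralizedCone (Function.update (fun j => O j (s j)) k π)) :
    π = O k ε := by
  refine OrientedPlane.eq_of_lift_mem_span (hO.isCube.face k ε _ fun s hs hk => ?_)
  refine (hO.isCircuit hs).mem_span_of_update (k := k) ?_
  have h1 := (inContactWithGeneralizedCone_iff _).1 (h s hs hk)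
  have h2 : (fun j => (Function.update (fun j => O j (s j)) k π j).lift)
      = Function.update (fun j => (O j (s j)).lift) k π.lift := by
    funext j
    by_cases hj : j = k
    · subst hj; simp
    · simp [Function.update_of_ne hj]
  rwa [h2] at h1

theorem IsConicalOctahedron.inContact {O : FacePlanes} (hO : IsConicalOctahedron O)
    {s : Fin 4 → Bool} (hs : IsVertexLabel s) :
    InContactWithGeneralizedCone fun k => O k (s k) :=
  (inContactWithGeneralizedCone_iff _).2 (hO.isCircuit hs).not_linearIndependent

theorem IsVertexLabel.sum_eq {s : Fin 4 → Bool} (hs : IsVertexLabel s) :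
    ∑ k, (if s k = true then (1 : ℤ) else 0) = 2 := by
  rw [Finset.sum_boole, hs]; rfl

theorem sum_add_vertexLabel {x : Fin 4 → ℤ} (hx : ∑ k, x k = 0) {s : Fin 4 → Bool}
    (hs : IsVertexLabel s) : ∑ k, (x k + if s k = true then 1 else 0) = 2 := by
  rw [Finset.sum_add_distrib, hx, hs.sum_eq, zero_add]

/-- If two families agree in the other planes of a conical octahedron, they agree in the eighth
plane. -/
theorem eq_of_cell {N : ℕ} {P Q : PlaneFamily} (hP : IsConicalOctahedralGridUpTo N P)
    (hQ : IsGeneralizedConicalGridUpTo N Q) {x : Fin 4 → ℤ}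
    (hx : ∀ k, -(N : ℤ) ≤ x k ∧ x k ≤ N) (hx0 : ∑ k, x k = 0) (k : Fin 4) (ε : Bool)
    (h : ∀ j, j ≠ k → ∀ b, cell P x j b = cell Q x j b) : cell P x k ε = cell Q x k ε := by
  refine ((hP x hx hx0).eq_of_inContact fun s hs hk => ?_).symm
  have h1 := hQ (fun k => x k + if s k = true then 1 else 0) (fun j => ?_)
    (sum_add_vertexLabel hx0 hs)
  · convert h1 using 1
    funext j
    by_cases hj : j = k
    · subst hj; simp [cell, hk]
    · rw [Function.update_of_ne hj, h j hj]; rfl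
  · have := hx j
    split_ifs <;> constructor <;> linarith

theorem exists_enum (k : Fin 4) : ∃ a b c : Fin 4, a ≠ k ∧ b ≠ k ∧ c ≠ k ∧ a ≠ b ∧ a ≠ c ∧ b ≠ c ∧
    ∀ j, j = k ∨ j = a ∨ j = b ∨ j = c := by
  revert k; decide

theorem exists_enum₂ {i l : Fin 4} (h : i ≠ l) : ∃ a b : Fin 4, a ≠ i ∧ a ≠ l ∧ b ≠ i ∧ b ≠ l ∧
    a ≠ b ∧ ∀ j, j = i ∨ j = l ∨ j = a ∨ j = b := by
  revert i l; decide

theorem cell_agree {P Q : PlaneFamily} {x : Fin 4 → ℤ} {j : Fin 4} {z : ℤ} (hz : x j = z)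
    (h0 : P j z = Q j z) (h1 : P j (z + 1) = Q j (z + 1)) (b : Bool) :
    cell P x j b = cell Q x j b := by
  subst hz
  cases b <;> simp [cell, h0, h1]

/-- Induction step for the uniqueness: the planes with indices in `[-M, M + 1]` determine the
planes with the indices `-M - 1` and `M + 2`. -/
theorem agree_succ {N M : ℕ} {P Q : PlaneFamily} (hP : IsConicalOctahedralGridUpTo N P)
    (hQ : IsGeneralizedConicalGridUpTo N Q) (hM : 1 ≤ M) (hMN : M + 1 ≤ N)
    (h : ∀ (k : Fin 4) (m : ℤ), -(M : ℤ) ≤ m → m ≤ M + 1 → P k m = Q k m) :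
    ∀ (k : Fin 4) (m : ℤ), -((M + 1 : ℕ) : ℤ) ≤ m → m ≤ (M + 1 : ℕ) + 1 → P k m = Q k m := by
  intro k m hm1 hm2
  obtain ⟨a, b, c, hak, hbk, hck, hab, hac, hbc, hall⟩ := exists_enum k
  have hM' : (1 : ℤ) ≤ M := by exact_mod_cast hM
  have hN' : (M : ℤ) + 1 ≤ N := by exact_mod_cast hMN
  push_cast at hm1 hm2
  have key : ∀ (σ : ℤ) (ε : Bool), (σ = 1 ∨ σ = -1) →
      cell P (Pi.single k (σ * (M + 1)) - Pi.single a (σ * 1) - Pi.single b (σ * M)) k ε =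
      cell Q (Pi.single k (σ * (M + 1)) - Pi.single a (σ * 1) - Pi.single b (σ * M)) k ε := by
    intro σ ε hσ
    apply eq_of_cell hP hQ
    · intro j
      rcases hall j with rfl | rfl | rfl | rfl <;> rcases hσ with rfl | rfl <;>
        simp [*, Ne.symm hak, Ne.symm hbk, Ne.symm hab] <;> omega
    · simp [Finset.sum_sub_distrib]; ring
    · intro j hj ε
      rcases hall j with rfl | rfl | rfl | rfl
      · exact absurd rfl hj
      · apply cell_agree (z := - σ) (by simp [*]) <;> apply h <;>
          rcases hσ with rfl | rfl <;> omega
      · apply cell_agree (z := - (σ * M)) (by simp [*, Ne.symm hab]) <;>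
          apply h <;> rcases hσ with rfl | rfl <;> omega
      · apply cell_agree (z := 0) (by simp [*, Ne.symm hac, Ne.symm hbc]) <;>
          apply h <;> omega
  have hka : ∀ z : ℤ, (Pi.single a z : Fin 4 → ℤ) k = 0 := fun z => by simp [hak.symm]
  have hkb : ∀ z : ℤ, (Pi.single b z : Fin 4 → ℤ) k = 0 := fun z => by simp [hbk.symm]
  by_cases h1 : m = M + 2
  · have := key 1 true (Or.inl rfl)
    simp only [cell, Pi.sub_apply, Pi.single_eq_same, hka, hkb, if_true] at this
    rw [h1]
    convert this using 2 <;> ring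
  by_cases h2 : m = -(M + 1)
  · have := key (-1) false (Or.inr rfl)
    simp only [cell, Pi.sub_apply, Pi.single_eq_same, hka, hkb] at this
    rw [h2]
    convert this using 2 <;> simp
  · exact h k m (by omega) (by omega)

theorem cell_single_sub_single {P : PlaneFamily} {a b : Fin 4} (hab : a ≠ b) (ε : Bool) :
    cell P (Pi.single a 1 - Pi.single b 1) a ε = P a (if ε then 2 else 1) ∧
    cell P (Pi.single a 1 - Pi.single b 1) b ε = P b (if ε then 0 else -1) ∧
    ∀ j, j ≠ a → j ≠ b → cell P (Pi.single a 1 - Pi.single b 1) j ε = P j (if ε then 1 else 0) := by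
  refine ⟨?_, ?_, fun j ha hb => ?_⟩ <;> cases ε <;>
    simp [cell, *, Ne.symm hab]

theorem ContainsPair.apply_zero_one {P : PlaneFamily} {O O' : FacePlanes} {i l : Fin 4}
    (h : ContainsPair P O O' i l) (k : Fin 4) : P k 0 = O k false ∧ P k 1 = O k true := by
  constructor
  · simpa [cell] using congrFun (congrFun h.1 k) false
  · simpa [cell] using congrFun (congrFun h.1 k) true

theorem ContainsPair.apply_two {P : PlaneFamily} {O O' : FacePlanes} {i l : Fin 4}
    (h : ContainsPair P O O' i l) (hil : i ≠ l) :
    P i 2 = O' i true ∧ P l (-1) = O' l false := by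
  constructor
  · rw [← h.2, (cell_single_sub_single hil true).1]; rfl
  · rw [← h.2, (cell_single_sub_single hil false).2.1]; rfl

/-- Start of the induction for the uniqueness. The octahedron at `e_a - e_b` involves only two
planes whose indices are different from `0` and `1`, those with the labels `(a, 2)` and `(b, -1)`,
so each of them determines the other one. Starting from `(i, 2)` and `(l, -1)`, this yields all
planes with the indices `2` and `-1`. -/
theorem agree_one {N : ℕ} {P Q : PlaneFamily} (hP : IsConicalOctahedralGridUpTo N P)
    (hQ : IsGeneralizedConicalGridUpTo N Q) (hN : 1 ≤ N) {i l : Fin 4} (hil : i ≠ l)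
    (h0 : ∀ k, P k 0 = Q k 0) (h1 : ∀ k, P k 1 = Q k 1) (hi : P i 2 = Q i 2)
    (hl : P l (-1) = Q l (-1)) :
    ∀ (k : Fin 4) (m : ℤ), -1 ≤ m → m ≤ 2 → P k m = Q k m := by
  have hN' : (1 : ℤ) ≤ N := by exact_mod_cast hN
  have hbd : ∀ a b : Fin 4, a ≠ b → ∀ k, -(N : ℤ) ≤
      (Pi.single a 1 - Pi.single b 1 : Fin 4 → ℤ) k ∧
      (Pi.single a 1 - Pi.single b 1 : Fin 4 → ℤ) k ≤ N := by
    intro a b hab k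
    by_cases ha : k = a
    · subst ha; simp [Pi.single_eq_of_ne hab]; omega
    by_cases hb : k = b
    · subst hb; simp [Pi.single_eq_of_ne ha]; omega
    simp [Pi.single_eq_of_ne ha, Pi.single_eq_of_ne hb]
  have hsum : ∀ a b : Fin 4, ∑ k, (Pi.single a 1 - Pi.single b 1 : Fin 4 → ℤ) k = 0 := by
    intro a b; simp [Finset.sum_sub_distrib]
  have up : ∀ a b : Fin 4, a ≠ b → P b (-1) = Q b (-1) → P a 2 = Q a 2 := by
    intro a b hab hb
    have := eq_of_cell hP hQ (hbd a b hab) (hsum a b) a true fun j hj ε => ?_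
    · rwa [(cell_single_sub_single hab true).1, (cell_single_sub_single hab true).1] at this
    · by_cases hjb : j = b
      · subst hjb
        rw [(cell_single_sub_single hab _).2.1, (cell_single_sub_single hab _).2.1]
        cases ε <;> simp [*]
      · rw [(cell_single_sub_single hab _).2.2 j hj hjb,
        (cell_single_sub_single hab _).2.2 j hj hjb]
        cases ε <;> simp [*]
  have down : ∀ a b : Fin 4, a ≠ b → P a 2 = Q a 2 → P b (-1) = Q b (-1) := by
    intro a b hab hb
    have := eq_of_cell hP hQ (hbd a b hab) (hsum a b) b false fun j hj ε => ?_
    · rwa [(cell_single_sub_single hab false).2.1, (cell_single_sub_single hab false).2.1] at this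
    · by_cases hja : j = a
      · subst hja
        rw [(cell_single_sub_single hab _).1, (cell_single_sub_single hab _).1]
        cases ε <;> simp [*]
      · rw [(cell_single_sub_single hab _).2.2 j hja hj,
        (cell_single_sub_single hab _).2.2 j hja hj]
        cases ε <;> simp [*]
  -- both new planes of a third sequence `a` are known; all other sequences are reached from
  -- this one
  obtain ⟨a, b, hai, hal, hbi, hbl, hab, hall⟩ := exists_enum₂ hil
  have ha2 := up a l hal hl
  have ha1 := down i a hai.symm hi
  have h2 : ∀ k, P k 2 = Q k 2 := by
    intro k
    by_cases hk : k = a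
    · exact hk ▸ ha2
    · exact up k a hk ha1
  have hm : ∀ k, P k (-1) = Q k (-1) := by
    intro k
    by_cases hk : k = a
    · exact hk ▸ ha1
    · exact down a k (Ne.symm hk) ha2
  intro k m hm1 hm2
  interval_cases m
  exacts [hm k, h0 k, h1 k, h2 k]

/-- A generalised conical grid agrees with a conical octahedral grid which contains the same pair
of octahedra. -/
theorem eq_of_containsPair {O O' : FacePlanes} {i l : Fin 4} (hil : i ≠ l) (N : ℕ)
    (P Q : PlaneFamily) (hPO : ContainsPair P O O' i l) (hP : IsConicalOctahedralGridUpTo N P)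
    (hQO : ContainsPair Q O O' i l) (hQ : IsGeneralizedConicalGridUpTo N Q) :
    ∀ (k : Fin 4) (m : ℤ), -(N : ℤ) ≤ m → m ≤ N + 1 → P k m = Q k m := by
  have h0 : ∀ k, P k 0 = Q k 0 := fun k => by
    rw [(hPO.apply_zero_one k).1, (hQO.apply_zero_one k).1]
  have h1 : ∀ k, P k 1 = Q k 1 := fun k => by
    rw [(hPO.apply_zero_one k).2, (hQO.apply_zero_one k).2]
  have key : ∀ M : ℕ, M ≤ N → ∀ (k : Fin 4) (m : ℤ), -(M : ℤ) ≤ m → m ≤ M + 1 →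
      P k m = Q k m := by
    intro M
    induction M with
    | zero =>
      intro _ k m hm1 hm2
      have : m = 0 ∨ m = 1 := by push_cast at hm1 hm2; omega
      rcases this with rfl | rfl
      exacts [h0 k, h1 k]
    | succ M ih =>
      intro hM
      rcases Nat.eq_zero_or_pos M with rfl | hpos
      · have := agree_one hP hQ hM hil h0 h1
          (by rw [(hPO.apply_two hil).1, (hQO.apply_two hil).1])
          (by rw [(hPO.apply_two hil).2, (hQO.apply_two hil).2])
        intro k m hm1 hm2
        push_cast at hm1 hm2
        exact this k m (by omega) (by omega)
      · exact agree_succ hP hQ hpos hM (ih (by omega))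
  exact key N le_rfl

theorem IsConicalOctahedralGrid.isGeneralizedConicalGrid {P : PlaneFamily}
    (hP : IsConicalOctahedralGrid P) : IsGeneralizedConicalGrid P := by
  intro n hn
  -- the vertex `n` belongs to the octahedron at `n - (1, 1, 0, 0)`
  set s : Fin 4 → Bool := ![true, true, false, false]
  have hs : IsVertexLabel s := by decide
  have h := (hP (fun k => n k - if s k = true then 1 else 0)
    (by rw [Finset.sum_sub_distrib, hn, hs.sum_eq]; norm_num)).inContact hs
  simpa [cell] using h

end Uniqueness

/-! ### Quadrics through the vertices of a cube -/

section Pencil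

variable {U : Type*} [AddCommGroup U] [Module ℝ U] {x : Fin 4 → Bool → U}

/-- The label `ε` for `k` and `a` and the opposite label for the other two indices. The vertices of
the octahedron which are incident with the face `(k, ε)` correspond to the indices `a ≠ k` in this
way. -/
def edgeLabel (k a : Fin 4) (ε : Bool) : Fin 4 → Bool := fun m => if m = k ∨ m = a then ε else !ε

theorem isVertexLabel_edgeLabel {k a : Fin 4} (h : a ≠ k) (ε : Bool) :
    IsVertexLabel (edgeLabel k a ε) := by
  revert k a ε; decide

theorem eq_edgeLabel {s : Fin 4 → Bool} (hs : IsVertexLabel s) (k : Fin 4) :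
    ∃ a, a ≠ k ∧ s = edgeLabel k a (s k) := by
  revert s k; decide

theorem exists_ne_ne_ne (k a b : Fin 4) : ∃ c : Fin 4, c ≠ k ∧ c ≠ a ∧ c ≠ b := by
  revert k a b; decide

theorem exists_ne_ne (k a : Fin 4) : ∃ c : Fin 4, c ≠ k ∧ c ≠ a := by
  revert k a; decide

/-- The label `ε` for `k` and the opposite label for all other indices. In the cube whose vertices
are the face vectors these labels describe the vertex `(k, ε)` and its three neighbours. -/
def starLabel (k : Fin 4) (ε : Bool) : Fin 4 → Bool := fun m => if m = k then ε else !ε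

theorem edgeLabel_eq_starLabel {k a m : Fin 4} (ε : Bool) (h : m ≠ a ∨ m = k) :
    edgeLabel k a ε m = starLabel k ε m := by
  unfold edgeLabel starLabel
  rcases h with h | h <;> simp [h]

theorem mem_span_edge {k a m : Fin 4} {ε : Bool} (h : m ≠ a ∨ m = k) :
    x m (starLabel k ε m) ∈ span ℝ (Set.range fun m => x m (edgeLabel k a ε m)) :=
  subset_span ⟨m, by rw [← edgeLabel_eq_starLabel ε h]⟩

theorem IsCube.not_mem_span_singleton (hx : IsCube x) {k m : Fin 4} {ε : Bool} (hm : m ≠ k) :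
    x m (!ε) ∉ span ℝ {x k ε} ∧ x k ε ∉ span ℝ {x m (!ε)} := by
  obtain ⟨a, hak, ham⟩ := exists_ne_ne k m
  have hc := hx.circuit _ (isVertexLabel_edgeLabel hak ε)
  have h1 := hc.not_mem_span_singleton hm
  have h2 := hc.not_mem_span_singleton hm.symm
  simp only [edgeLabel, hm, ham.symm, or_self, if_false, true_or, if_true] at h1 h2
  exact ⟨h1, h2⟩

/-- A vertex of a cube and its three neighbours are not coplanar: in a linear relation between them,
a neighbour with a non-zero coefficient would lie in the planes of the three circuits through the
vertex, and hence would coincide with it. -/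
theorem IsCube.linearIndependent (hx : IsCube x) (k : Fin 4) (ε : Bool) :
    LinearIndependent ℝ fun m => x m (starLabel k ε m) := by
  rw [Fintype.linearIndependent_iff]
  intro c hc
  have key : ∀ m, m ≠ k → c m = 0 := by
    intro m hm
    by_contra hcm
    have hm0 : x m (starLabel k ε m) = x m (!ε) := by simp [starLabel, hm]
    have hk0 : x k (starLabel k ε k) = x k ε := by simp [starLabel]
    refine (hx.not_mem_span_singleton (ε := ε) hm).1 (hx.face k ε _ fun s hs hsk => ?_)
    obtain ⟨a, ha, rfl⟩ : ∃ a, a ≠ k ∧ s = edgeLabel k a ε := by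
      have := eq_edgeLabel hs k
      rwa [hsk] at this
    rw [← hm0]
    by_cases hma : m = a
    · subst hma
      rw [← Finset.add_sum_erase _ _ (Finset.mem_univ m)] at hc
      have h1 : x m (starLabel k ε m) = -(c m)⁻¹ • ∑ j ∈ Finset.univ.erase m,
          c j • x j (starLabel k ε j) := by
        rw [neg_smul, ← smul_neg, ← eq_neg_of_add_eq_zero_left hc, smul_smul, inv_mul_cancel₀ hcm,
          one_smul]
      rw [h1]
      exact smul_mem _ _ (sum_mem fun j hj => smul_mem _ _
        (mem_span_edge (Or.inl (Finset.ne_of_mem_erase hj))))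
    · exact mem_span_edge (Or.inl hma)
  intro m
  by_cases hm : m = k
  · subst hm
    rw [Finset.sum_eq_single m (fun j _ hj => by rw [key j hj, zero_smul]) (by simp)] at hc
    refine (smul_eq_zero.1 hc).resolve_right fun h0 => ?_
    obtain ⟨a, ha⟩ := exists_ne m
    exact (hx.not_mem_span_singleton (ε := ε) ha).2 (by
      rw [show x m ε = 0 by simpa [starLabel] using h0]; exact zero_mem _)
  · exact key m hm

/-- A vertex of the cube and its three neighbours form a basis of the four-dimensional space. -/
noncomputable def IsCube.basis (hx : IsCube x) (hU : Module.finrank ℝ U = 4) (k : Fin 4)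
    (ε : Bool) : Module.Basis (Fin 4) ℝ U :=
  have : FiniteDimensional ℝ U := Module.finite_of_finrank_pos (by omega)
  basisOfLinearIndependentOfCardEqFinrank (hx.linearIndependent k ε) (by simp [hU])

theorem IsCube.basis_apply (hx : IsCube x) (hU : Module.finrank ℝ U = 4) (k : Fin 4) (ε : Bool)
    (m : Fin 4) : hx.basis hU k ε m = x m (starLabel k ε m) := by
  simp [IsCube.basis]

/-- With respect to the basis given by a vertex of the cube and its three neighbours, the three
faces through this vertex are coordinate planes. -/
theorem IsCube.coord_eq_zero (hx : IsCube x) (hU : Module.finrank ℝ U = 4) {k a : Fin 4}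
    (ε : Bool) (ha : a ≠ k) {u : U}
    (hu : u ∈ span ℝ (Set.range fun m => x m (edgeLabel k a ε m))) :
    (hx.basis hU k ε).coord a u = 0 := by
  obtain ⟨c, hca, rfl⟩ :=
    (hx.circuit _ (isVertexLabel_edgeLabel ha ε)).exists_of_mem_span hu a
  have : ∑ j, c j • x j (edgeLabel k a ε j) = ∑ j, c j • hx.basis hU k ε j := by
    refine Finset.sum_congr rfl fun j _ => ?_
    by_cases hj : j = a
    · rw [hj, hca, zero_smul, zero_smul]
    · rw [hx.basis_apply, edgeLabel_eq_starLabel ε (Or.inl hj)]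
  rw [this, map_sum]
  simp [Finsupp.single_apply, hca]

theorem IsCube.mem_span_of_coord_eq_zero (hx : IsCube x) (hU : Module.finrank ℝ U = 4)
    {k a : Fin 4} (ε : Bool) {u : U} (hu : (hx.basis hU k ε).coord a u = 0) :
    u ∈ span ℝ (Set.range fun m => x m (edgeLabel k a ε m)) := by
  rw [← (hx.basis hU k ε).sum_repr u]
  refine sum_mem fun j _ => ?_
  by_cases hj : j = a
  · rw [hj, show (hx.basis hU k ε).repr u a = 0 from hu, zero_smul]; exact zero_mem _
  · rw [hx.basis_apply]; exact smul_mem _ _ (mem_span_edge (Or.inl hj))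

theorem polar_linMulLin (f g : U →ₗ[ℝ] ℝ) (u v : U) :
    polar (linMulLin f g) u v = f u * g v + f v * g u := by
  simp only [polar, linMulLin_apply, map_add]; ring

/-- A quadric through seven vertices of the cube which is singular in the seventh of them, the
vertex opposite to the missing one, vanishes. -/
theorem IsCube.eq_zero_of_polar_eq_zero (hx : IsCube x) (hU : Module.finrank ℝ U = 4) (k : Fin 4)
    (ε : Bool) {G : QuadraticForm ℝ U} (hG : ∀ m b, ¬ (m = k ∧ b = !ε) → G (x m b) = 0)
    (hp : ∀ u, polar G (x k ε) u = 0) : G = 0 := by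
  have hy : ∀ m, G (hx.basis hU k ε m) = 0 := by
    intro m
    rw [hx.basis_apply]
    refine hG _ _ ?_
    rintro ⟨rfl, h⟩
    simp [starLabel] at h
  have hk0 : ∀ u, polar G (hx.basis hU k ε k) u = 0 := by
    intro u; rw [hx.basis_apply]; simpa [starLabel] using hp u
  have key : polarBilin G = 0 := by
    refine (hx.basis hU k ε).ext fun a => (hx.basis hU k ε).ext fun b => ?_
    change polar G _ _ = 0
    by_cases hak : a = k
    · subst hak; exact hk0 _
    by_cases hbk : b = k
    · subst hbk; rw [polar_comm]; exact hk0 _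
    by_cases hab : a = b
    · subst hab; rw [polar_self, hy]; simp
    obtain ⟨c, hck, hca, hcb⟩ := exists_ne_ne_ne k a b
    -- the circuit of `(k, ε)`, `(c, ε)`, `(a, !ε)`, `(b, !ε)`
    obtain ⟨d, hd, hs⟩ := (hx.circuit _ (isVertexLabel_edgeLabel hck ε)).exists_rel_ne
    have hs' : d c • x c ε + (d k • hx.basis hU k ε k + (d a • hx.basis hU k ε a +
        d b • hx.basis hU k ε b)) = 0 := by
      rw [← hs]
      have huniv : (Finset.univ : Finset (Fin 4)) = {c, k, a, b} := by
        clear * - hak hbk hab hck hca hcb; revert k a b c; decide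
      rw [huniv, Finset.sum_insert (by simp [*]), Finset.sum_insert (by simp [Ne.symm hak,
        Ne.symm hbk]),
        Finset.sum_insert (by simp [*]), Finset.sum_singleton]
      simp only [hx.basis_apply]
      rw [← edgeLabel_eq_starLabel (a := c) ε (Or.inl hca.symm),
        ← edgeLabel_eq_starLabel (a := c) ε (Or.inl hcb.symm),
        ← edgeLabel_eq_starLabel (a := c) ε (Or.inl hck.symm)]
      simp [edgeLabel]
    have h1 : G (d c • x c ε) = 0 := by
      rw [QuadraticMap.map_smul, hG c ε (by simp [hck]), smul_zero]
    rw [eq_neg_of_add_eq_zero_left hs', QuadraticMap.map_neg, QuadraticMap.map_add G,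
      QuadraticMap.map_add G, QuadraticMap.map_smul, QuadraticMap.map_smul, QuadraticMap.map_smul,
      hy, hy, hy, polar_smul_left, polar_smul_right, polar_smul_left G (d k), hk0] at h1
    simpa [hd a, hd b] using h1
  ext u
  have : polar G u u = 0 :=
    congrFun (congrArg DFunLike.coe (congrFun (congrArg DFunLike.coe key) u)) u
  rw [polar_self] at this
  simpa using this

theorem edgeLabel_not {k a : Fin 4} (ε : Bool) (m : Fin 4) :
    edgeLabel k a (!ε) m = !edgeLabel k a ε m := by
  unfold edgeLabel; split_ifs <;> simp

/-- There is a quadric through the eight vertices of the cube with any prescribed tangent plane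
in a vertex. It is a combination of the three pairs of opposite face planes. -/
theorem IsCube.exists_quadric (hx : IsCube x) (hU : Module.finrank ℝ U = 4) (k : Fin 4) (ε : Bool)
    (φ : U →ₗ[ℝ] ℝ) (hφ : φ (x k ε) = 0) :
    ∃ D : QuadraticForm ℝ U, (∀ m b, D (x m b) = 0) ∧ ∀ u, polar D (x k ε) u = φ u := by
  set y := hx.basis hU k ε with hy
  set z := hx.basis hU k (!ε) with hz
  have hyk : y k = x k ε := by rw [hy, hx.basis_apply]; simp [starLabel]
  have hmem : ∀ a, a ≠ k → ∀ m b, (linMulLin (y.coord a) (z.coord a)) (x m b) = 0 := by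
    intro a ha m b
    rw [linMulLin_apply]
    by_cases hb : b = edgeLabel k a ε m
    · rw [hx.coord_eq_zero hU ε ha (subset_span ⟨m, by rw [hb]⟩), zero_mul]
    · rw [hx.coord_eq_zero hU (!ε) ha (subset_span ⟨m, ?_⟩), mul_zero]
      simp only [edgeLabel_not, ← Bool.eq_not_of_ne hb]
  have hne : ∀ a, a ≠ k → z.coord a (x k ε) ≠ 0 := by
    intro a ha h0
    refine (hx.not_mem_span_singleton (ε := ε) ha).2 (hx.face a (!ε) _ fun s hs hsa => ?_)
    obtain ⟨b, hb, rfl⟩ : ∃ b, b ≠ a ∧ s = edgeLabel a b (!ε) := by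
      have := eq_edgeLabel hs a
      rwa [hsa] at this
    by_cases hbk : b = k
    · subst hbk
      have := hx.mem_span_of_coord_eq_zero hU (!ε) h0
      convert this using 4
      simp [edgeLabel, or_comm]
    · refine subset_span ⟨k, ?_⟩
      simp [edgeLabel, Ne.symm ha, Ne.symm hbk]
  refine ⟨∑ a ∈ Finset.univ.erase k, (φ (y a) / z.coord a (x k ε)) •
    linMulLin (y.coord a) (z.coord a), fun m b => ?_, fun u => ?_⟩
  · rw [_root_.sum_apply]
    refine Finset.sum_eq_zero fun a ha => ?_
    rw [_root_.smul_apply, hmem a (Finset.ne_of_mem_erase ha), smul_zero]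
  · have hlin : polarBilin (∑ a ∈ Finset.univ.erase k, (φ (y a) / z.coord a (x k ε)) •
        linMulLin (y.coord a) (z.coord a)) (x k ε) = φ := by
      refine y.ext fun m => ?_
      have h1 : ∀ (s : Finset (Fin 4)) (f : Fin 4 → QuadraticForm ℝ U) (u v : U),
          polar (∑ a ∈ s, f a : QuadraticForm ℝ U) u v = ∑ a ∈ s, polar (f a) u v := by
        intro s f u v
        simp [polar, _root_.sum_apply, Finset.sum_sub_distrib]
      change polar _ _ _ = _
      rw [h1]
      have h2 : ∀ a ∈ Finset.univ.erase k, polar ((φ (y a) / z.coord a (x k ε)) •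
          linMulLin (y.coord a) (z.coord a) : QuadraticForm ℝ U) (x k ε) (y m)
          = if a = m then φ (y m) else 0 := by
        intro a ha
        have hak := Finset.ne_of_mem_erase ha
        rw [FunLike.coe_smul, polar_smul, polar_linMulLin]
        have : y.coord a (x k ε) = 0 := by
          rw [← hyk]; simp [hak.symm]
        rw [this]
        by_cases ham : a = m
        · subst ham
          have := hne a hak
          simp [-Module.Basis.coord_apply, Module.Basis.coord_apply y]
          field_simp
        · simp [ham]
      rw [Finset.sum_congr rfl h2, Finset.sum_ite_eq']
      by_cases hm : m = k
      · subst hm; simp [hyk, hφ]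
      · simp [hm]
    exact congrFun (congrArg DFunLike.coe hlin) u

/-- A quadric through seven vertices of the cube contains the eighth vertex. -/
theorem IsCube.eighth_point (hx : IsCube x) (hU : Module.finrank ℝ U = 4) (k : Fin 4) (ε : Bool)
    {G : QuadraticForm ℝ U} (hG : ∀ m b, ¬ (m = k ∧ b = !ε) → G (x m b) = 0) :
    G (x k (!ε)) = 0 := by
  obtain ⟨D, hD, hDp⟩ := hx.exists_quadric hU k ε (polarBilin G (x k ε)) (by
    change polar G _ _ = 0
    rw [polar_self, hG k ε (by simp), smul_zero])
  have h0 : G - D = 0 := hx.eq_zero_of_polar_eq_zero hU k ε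
    (fun m b h => by rw [_root_.sub_apply, hG m b h, hD, sub_zero])
    (fun u => by
      have h1 := hDp u
      have h2 : polar (G - D) (x k ε) u = polar G (x k ε) u - polar D (x k ε) u := by
        simp only [polar, _root_.sub_apply]; ring
      rw [h2, h1]; exact sub_self _)
  rw [sub_eq_zero.1 h0, hD]

/-- The quadrics of the pencil spanned by `Q` and `R` have different tangent planes in `p`: the
curve in which the quadrics meet is smooth in `p`. -/
def PencilSmooth (Q R : QuadraticForm ℝ U) (p : U) : Prop :=
  ∀ α β : ℝ, (∀ u, α * polar Q p u + β * polar R p u = 0) → α = 0 ∧ β = 0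

/-- By `IsCube.eq_zero_of_polar_eq_zero`, no quadric through the vertices of a cube is singular in a
vertex. -/
theorem IsCube.pencilSmooth (hx : IsCube x) (hU : Module.finrank ℝ U = 4)
    {Q R : QuadraticForm ℝ U} (hQ : ∀ m b, Q (x m b) = 0) (hR : ∀ m b, R (x m b) = 0)
    (hQR : ∀ α β : ℝ, α • Q + β • R = 0 → α = 0 ∧ β = 0) (k : Fin 4) (ε : Bool) :
    PencilSmooth Q R (x k ε) := by
  intro α β h
  refine hQR α β (hx.eq_zero_of_polar_eq_zero hU k ε (fun m b _ => ?_) fun u => ?_)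
  · simp [hQ, hR]
  · rw [← h u]
    simp only [polar, _root_.add_apply, _root_.smul_apply, smul_eq_mul]; ring

/-- Two neighbouring cubes on a quadric `Q` lie on the intersection of `Q` with a second quadric.
There is a three-dimensional space of quadrics through the vertices of the first cube. For a quadric
of this space, passing through one of the two remaining vertices of the second cube is one linear
condition, and by `IsCube.eighth_point` it implies that the quadric passes through the other one. So
there are at least two independent quadrics through all vertices. -/
theorem exists_pencil {O O' : Fin 4 → Bool → U} (hO : IsCube O) (hO' : IsCube O')
    (hU : Module.finrank ℝ U = 4) {i l : Fin 4} (hil : i ≠ l) (hi : O' i false = O i true)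
    (hl : O' l true = O l false) (hk : ∀ k, k ≠ i → k ≠ l → ∀ ε, O' k ε = O k ε)
    {Q : QuadraticForm ℝ U} (hQ0 : Q ≠ 0) (hQ : ∀ m b, Q (O m b) = 0)
    (hQ' : ∀ m b, Q (O' m b) = 0) :
    ∃ R : QuadraticForm ℝ U, (∀ m b, R (O m b) = 0) ∧ (∀ m b, R (O' m b) = 0) ∧
      (∀ m b, PencilSmooth Q R (O m b)) ∧ ∀ m b, PencilSmooth Q R (O' m b) := by
  obtain ⟨k, ε⟩ : Fin 4 × Bool := (0, true)
  -- a basis of the space of the quadrics through the vertices of the first cube: a quadric is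
  -- determined by its tangent plane in the vertex `(k, ε)`
  have hcoord : ∀ a : {a // a ≠ k}, ∃ D : QuadraticForm ℝ U, (∀ m b, D (O m b) = 0) ∧
      ∀ u, polar D (O k ε) u = (hO.basis hU k ε).coord a u := fun a =>
    hO.exists_quadric hU k ε _ (by
      have := hO.basis_apply hU k ε k
      rw [show starLabel k ε k = ε by simp [starLabel]] at this
      rw [← this]; simp [a.2.symm])
  choose D hD hDp using hcoord
  set T : ({a // a ≠ k} → ℝ) →ₗ[ℝ] ℝ := Fintype.linearCombination ℝ fun a => D a (O' i true)
  -- coefficients of a quadric through the vertex `(i, true)` of the second cube which is not a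
  -- multiple of `Q`
  obtain ⟨r, hr, hrq⟩ : ∃ r : {a // a ≠ k} → ℝ, T r = 0 ∧
      ∀ c : ℝ, r ≠ c • fun a : {a // a ≠ k} => polar Q (O k ε) (hO.basis hU k ε a) := by
    by_contra! hcon
    have h1 : LinearMap.ker T ≤
        span ℝ {fun a : {a // a ≠ k} => polar Q (O k ε) (hO.basis hU k ε a)} := by
      intro r hr
      obtain ⟨c, hc⟩ := hcon r hr
      exact mem_span_singleton.2 ⟨c, hc.symm⟩
    have h2 := Submodule.finrank_mono h1
    have h3 := finrank_span_le_card (R := ℝ)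
      {fun a : {a // a ≠ k} => polar Q (O k ε) (hO.basis hU k ε a)}
    have h4 := T.finrank_range_add_finrank_ker
    have h5 := (LinearMap.range T).finrank_le
    have h6 := h2.trans h3
    have h7 : Fintype.card {a // a ≠ k} = 3 := by simp
    rw [Module.finrank_self] at h5
    rw [Module.finrank_fintype_fun_eq_card, h7] at h4
    rw [Set.toFinset_card, Set.card_singleton] at h6
    omega
  set R : QuadraticForm ℝ U := ∑ a, r a • D a with hRdef
  have hR : ∀ m b, R (O m b) = 0 := by
    intro m b
    rw [hRdef, _root_.sum_apply]
    exact Finset.sum_eq_zero fun a _ => by rw [_root_.smul_apply, hD, smul_zero]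
  have hRY : R (O' i true) = 0 := by
    rw [hRdef, _root_.sum_apply, ← hr]
    simp [T, Fintype.linearCombination_apply]
  have hR' : ∀ m b, R (O' m b) = 0 := by
    have h7 : ∀ m b, ¬ (m = l ∧ b = !true) → R (O' m b) = 0 := by
      intro m b hmb
      by_cases hmi : m = i
      · subst hmi
        cases b
        · rw [hi]; exact hR _ _
        · exact hRY
      · by_cases hml : m = l
        · subst hml
          cases b
          · simp at hmb
          · rw [hl]; exact hR _ _
        · rw [hk m hmi hml]; exact hR _ _
    intro m b
    by_cases hmb : m = l ∧ b = !true
    · obtain ⟨rfl, rfl⟩ := hmb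
      exact hO'.eighth_point hU m true h7
    · exact h7 m b hmb
  have hRp : ∀ a : {a // a ≠ k}, polar R (O k ε) (hO.basis hU k ε a) = r a := by
    intro a
    have h1 : polar R (O k ε) (hO.basis hU k ε a)
        = ∑ b, r b * polar (D b) (O k ε) (hO.basis hU k ε a) := by
      rw [hRdef]
      simp only [polar, _root_.sum_apply, _root_.smul_apply, smul_eq_mul, mul_sub,
        Finset.sum_sub_distrib]
    rw [h1]
    simp only [hDp]
    simp [Finsupp.single_apply, ← Subtype.ext_iff]
  have hind : ∀ α β : ℝ, α • Q + β • R = 0 → α = 0 ∧ β = 0 := by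
    intro α β h
    have hβ : β = 0 := by
      by_contra hβ
      refine hrq (-α / β) (funext fun a => ?_)
      have h1 := congrArg (fun G : QuadraticForm ℝ U => polar G (O k ε) (hO.basis hU k ε a)) h
      have h2 : polar (α • Q + β • R) (O k ε) (hO.basis hU k ε a) =
          α * polar Q (O k ε) (hO.basis hU k ε a) + β * r a := by
        rw [← hRp a]
        simp only [polar, _root_.add_apply, _root_.smul_apply, smul_eq_mul]; ring
      have h3 : polar (0 : QuadraticForm ℝ U) (O k ε) (hO.basis hU k ε a) = 0 := by simp [polar]
      simp only [h2, h3] at h1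
      simp only [Pi.smul_apply, smul_eq_mul]
      field_simp
      linarith
    subst hβ
    rw [zero_smul, add_zero] at h
    exact ⟨(smul_eq_zero.1 h).resolve_right hQ0, rfl⟩
  exact ⟨R, hR, hR', hO.pencilSmooth hU hQ hR hind, hO'.pencilSmooth hU hQ' hR' hind⟩

end Pencil

/-! ### Grids from abelian groups -/

section Grid

variable {U : Type*} [AddCommGroup U] [Module ℝ U]

/-- Points of the quadric `Q` whose homogeneous coordinate vectors form a generalised conical grid
which contains the points of the two given cubes. Singular points of `Q` are excluded, since they do
not correspond to oriented planes. -/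
def HasGrid (Q : QuadraticForm ℝ U) (O O' : Fin 4 → Bool → U) (i l : Fin 4) : Prop :=
  ∃ Y : Fin 4 → ℤ → U, (∀ k n, Q (Y k n) = 0 ∧ ∃ u, polar Q (Y k n) u ≠ 0) ∧
    (∀ n : Fin 4 → ℤ, ∑ k, n k = 2 → ¬ LinearIndependent ℝ fun k => Y k (n k)) ∧
    (∀ k, Y k 0 ∈ span ℝ {O k false} ∧ Y k 1 ∈ span ℝ {O k true}) ∧
    Y i 2 ∈ span ℝ {O' i true} ∧ Y l (-1) ∈ span ℝ {O' l false}

/-- If `(k, s k)` is the label of a plane in the second octahedron, then `shiftLabel i l s k` is the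
parity of the index of this plane in the grid. -/
def shiftLabel (i l : Fin 4) (s : Fin 4 → Bool) : Fin 4 → Bool :=
  fun k => if k = i ∨ k = l then !s k else s k

theorem isVertexLabel_pair {a b : Fin 4} (h : a ≠ b) :
    IsVertexLabel fun k => decide (k = a ∨ k = b) := by
  revert a b; decide

theorem sum_four {M : Type*} [AddCommMonoid M] {a b c d : Fin 4} (hab : a ≠ b) (hac : a ≠ c)
    (had : a ≠ d) (hbc : b ≠ c) (hbd : b ≠ d) (hcd : c ≠ d) (f : Fin 4 → M) :
    ∑ k, f k = f a + (f b + (f c + f d)) := by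
  have huniv : (Finset.univ : Finset (Fin 4)) = {a, b, c, d} := by
    revert a b c d; decide
  rw [huniv, Finset.sum_insert (by simp [*]), Finset.sum_insert (by simp [*]),
    Finset.sum_insert (by simp [*]), Finset.sum_singleton]

/-- Construction of grids. Suppose that the points of the curve under consideration are
parametrised by an abelian group in such a way that points are coplanar if the sum of their
parameters is `κ`; the parametrisation `ψ k e` may depend on the index `k` and on the parity `e` of
the index in the grid, and there may be parities for which the points are always coplanar. Then
each of the four sequences of the grid consists of two arithmetic progressions, one for the even
and one for the odd indices, all with the same difference. -/
theorem hasGrid_of_group {Q : QuadraticForm ℝ U} {O O' : Fin 4 → Bool → U} {i l : Fin 4}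
    (hil : i ≠ l) (hi : O' i false = O i true)
    (hl : O' l true = O l false) (hk : ∀ k, k ≠ i → k ≠ l → ∀ ε, O' k ε = O k ε)
    {G : Type*} [AddCommGroup G] (ψ : Fin 4 → Bool → G → U) (free : (Fin 4 → Bool) → Prop)
    (κ : G) (γ : Fin 4 → U → G)
    (hψ : ∀ k e g, Q (ψ k e g) = 0 ∧ ∃ u, polar Q (ψ k e g) u ≠ 0)
    (hcop : ∀ e : Fin 4 → Bool, Even (Finset.univ.filter fun k => e k = true).card →
      ∀ g : Fin 4 → G, (¬ free e → ∑ k, g k = κ) → ¬ LinearIndependent ℝ fun k => ψ k (e k) (g k))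
    (hO : ∀ k b, ψ k b (γ k (O k b)) ∈ span ℝ {O k b})
    (hO' : ∀ k s, ψ k (shiftLabel i l s k) (γ k (O' k (s k))) ∈ span ℝ {O' k (s k)})
    (hrel : ∀ s, IsVertexLabel s → ¬ free s → ∑ k, γ k (O k (s k)) = κ)
    (hrel' : ∀ s, IsVertexLabel s → ¬ free (shiftLabel i l s) → ∑ k, γ k (O' k (s k)) = κ)
    (hfree : ∃ c, c ≠ i ∧ c ≠ l ∧ ¬ free (fun k => decide (k = l ∨ k = c))) :
    HasGrid Q O O' i l := by
  obtain ⟨σ, hσ⟩ : ∃ σ, σ = γ i (O' i true) - γ i (O i false) := ⟨_, rfl⟩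
  -- the same difference occurs in the sequence with index `l`
  have hσl : σ = γ l (O l true) - γ l (O' l false) := by
    obtain ⟨c, hci, hcl, hc⟩ := hfree
    obtain ⟨d, hdi, hdl, hdc⟩ := exists_ne_ne_ne i l c
    have h1 := hrel _ (isVertexLabel_pair hcl.symm) hc
    have h2 := hrel' (fun k => decide (k = i ∨ k = c)) (isVertexLabel_pair hci.symm) (by
      convert hc using 2
      funext k
      by_cases h1 : k = i
      · subst h1; simp [shiftLabel, hil, hci.symm]
      by_cases h2 : k = l
      · subst h2; simp [shiftLabel, hil.symm, hcl.symm]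
      · simp [shiftLabel, h1, h2])
    rw [sum_four hil hci.symm hdi.symm hcl.symm hdl.symm hdc.symm] at h1 h2
    simp only [hil, hci, hcl, hdi, hdl, hdc, hil.symm, hci.symm, hcl.symm, or_self, or_true,
      true_or, decide_true, decide_false, hk c hci hcl, hk d hdi hdl] at h1 h2
    rw [hσ, sub_eq_sub_iff_add_eq_add]
    have h3 := h2.trans h1.symm
    rw [← add_assoc, ← add_assoc (γ i (O i false))] at h3
    rw [add_right_cancel h3, add_comm]
  -- The points with even and with odd indices form arithmetic progressions which start at the
  -- points with the indices `0` and `1`.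
  set odd : ℤ → Bool := fun n => decide (n % 2 = 1) with hodd
  refine ⟨fun k n => ψ k (odd n) (γ k (O k (odd n)) + (n / 2) • σ), fun k n => hψ _ _ _,
    fun n hn => ?_, fun k => ⟨?_, ?_⟩, ?_, ?_⟩
  · set e : Fin 4 → Bool := fun k => odd (n k) with he
    have hmod : ∀ k, n k = 2 * (n k / 2) + if e k = true then 1 else 0 := by
      intro k
      have := Int.emod_two_eq_zero_or_one (n k)
      simp only [he, hodd, decide_eq_true_eq]
      split_ifs <;> omega
    have hsum : 2 * (∑ k, n k / 2) + ((Finset.univ.filter fun k => e k = true).card : ℤ) = 2 := by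
      rw [Finset.mul_sum, ← Finset.sum_boole, ← Finset.sum_add_distrib]
      refine Eq.trans ?_ hn
      exact Finset.sum_congr rfl fun k _ => (hmod k).symm
    have hle : (Finset.univ.filter fun k => e k = true).card ≤ 4 := by
      simpa using Finset.card_filter_le (Finset.univ : Finset (Fin 4)) fun k => e k = true
    refine hcop e ?_ _ fun hf => ?_
    · rw [Nat.even_iff]; omega
    · rw [Finset.sum_add_distrib, ← Finset.sum_smul]
      -- The number of odd indices is `2`, `0` or `4`. The sum of the parameters is given by a
      -- vertex of the first octahedron in the first case, and by the end points of the opposite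
      -- edge of the second octahedron, whose indices in the grid have constant parity, in the
      -- other cases.
      have hcase : (Finset.univ.filter fun k => e k = true).card = 2 ∧ ∑ k, n k / 2 = 0 ∨
          (Finset.univ.filter fun k => e k = true).card = 0 ∧ ∑ k, n k / 2 = 1 ∨
          (Finset.univ.filter fun k => e k = true).card = 4 ∧ ∑ k, n k / 2 = -1 := by omega
      rcases hcase with ⟨h1, h2⟩ | ⟨h1, h2⟩ | ⟨h1, h2⟩
      · rw [h2, zero_smul, add_zero]
        exact hrel e h1 hf
      · have he0 : ∀ k, e k = false := by
          intro k
          have := Finset.filter_eq_empty_iff.1 (Finset.card_eq_zero.1 h1) (Finset.mem_univ k)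
          simpa using this
        have h3 := hrel' (fun k => decide (k = i ∨ k = l)) (isVertexLabel_pair hil) (by
          convert hf using 2
          funext k
          rw [he0 k]
          by_cases h : k = i ∨ k = l <;> simp [shiftLabel, h])
        rw [h2, one_smul, hσ, ← h3]
        obtain ⟨a, b, hai, hal, hbi, hbl, hab, -⟩ := exists_enum₂ hil
        rw [sum_four hil hai.symm hbi.symm hal.symm hbl.symm hab,
          sum_four hil hai.symm hbi.symm hal.symm hbl.symm hab]
        change γ i (O i (e i)) + (γ l (O l (e l)) + (γ a (O a (e a)) + γ b (O b (e b)))) + _ = _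
        simp only [he0, hai, hal, hbi, hbl, or_self, or_true, true_or, decide_true,
          decide_false, hl, hk a hai hal, hk b hbi hbl]
        abel
      · have he1 : ∀ k, e k = true := by
          intro k
          have h4 := (Finset.card_eq_iff_eq_univ _).1 (h1.trans (by simp))
          have : k ∈ Finset.univ.filter fun k => e k = true := by rw [h4]; exact Finset.mem_univ k
          exact (Finset.mem_filter.1 this).2
        have h3 := hrel' (fun k => !decide (k = i ∨ k = l)) (by
            clear * - hil; revert i l; decide) (by
          convert hf using 2
          funext k
          rw [he1 k]
          by_cases h : k = i ∨ k = l <;> simp [shiftLabel, h])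
        rw [h2, neg_one_smul, hσl, ← h3]
        obtain ⟨a, b, hai, hal, hbi, hbl, hab, -⟩ := exists_enum₂ hil
        rw [sum_four hil hai.symm hbi.symm hal.symm hbl.symm hab,
          sum_four hil hai.symm hbi.symm hal.symm hbl.symm hab]
        change γ i (O i (e i)) + (γ l (O l (e l)) + (γ a (O a (e a)) + γ b (O b (e b)))) + _ = _
        simp only [he1, hai, hal, hbi, hbl, or_self, or_true, true_or, decide_true,
          decide_false, Bool.not_true, Bool.not_false, hi, hk a hai hal, hk b hbi hbl]
        abel
  · simpa [hodd] using hO k false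
  · simpa [hodd] using hO k true
  · have h1 := hO' i (fun _ => true)
    simp only [shiftLabel, true_or, if_true, Bool.not_true] at h1
    simpa [hodd, hσ] using h1
  · have h1 := hO' l (fun _ => false)
    simp only [shiftLabel, or_true, if_true, Bool.not_false] at h1
    simpa [hodd, hσl] using h1

end Grid

/-! ### Planes given by the points of a quadric -/

section Realization

/-- The vertices of a cube lie in the four-dimensional space which is spanned by one of them and its
three neighbours. -/
theorem IsCube.mem_span_star {V : Type*} [AddCommGroup V] [Module ℝ V] {x : Fin 4 → Bool → V}
    (hx : IsCube x) (k : Fin 4) (ε : Bool) (m : Fin 4) (b : Bool) :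
    x m b ∈ span ℝ (Set.range fun m => x m (starLabel k ε m)) := by
  have hstar : ∀ m, x m (starLabel k ε m) ∈ span ℝ (Set.range fun m => x m (starLabel k ε m)) :=
    fun m => subset_span ⟨m, rfl⟩
  have h1 : ∀ m, x m ε ∈ span ℝ (Set.range fun m => x m (starLabel k ε m)) := by
    intro m
    by_cases hm : m = k
    · have := hstar m
      rwa [show starLabel k ε m = ε by simp [starLabel, hm]] at this
    · obtain ⟨c, hc, hs⟩ := (hx.circuit _ (isVertexLabel_edgeLabel hm ε)).exists_of_mem_span
        (subset_span ⟨m, rfl⟩) m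
      dsimp only at hs
      rw [show edgeLabel k m ε m = ε by simp [edgeLabel]] at hs
      rw [← hs]
      refine sum_mem fun j _ => ?_
      by_cases hj : j = m
      · rw [hj, hc, zero_smul]; exact zero_mem _
      · rw [edgeLabel_eq_starLabel ε (Or.inl hj)]; exact smul_mem _ _ (hstar j)
  by_cases hb : b = ε
  · rw [hb]; exact h1 m
  obtain rfl : b = !ε := Bool.eq_not_of_ne hb
  by_cases hm : m = k
  · subst hm
    obtain ⟨a, ha⟩ := exists_ne m
    obtain ⟨c, hc, hs⟩ := (hx.circuit _ (isVertexLabel_edgeLabel ha (!ε))).exists_of_mem_span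
        (subset_span ⟨m, rfl⟩) m
    dsimp only at hs
    rw [show edgeLabel m a (!ε) m = !ε by simp [edgeLabel]] at hs
    rw [← hs]
    refine sum_mem fun j _ => ?_
    by_cases hj : j = m
    · rw [hj, hc, zero_smul]; exact zero_mem _
    · refine smul_mem _ _ ?_
      by_cases hja : j = a
      · have := hstar j
        rwa [show starLabel m ε j = edgeLabel m a (!ε) j by simp [starLabel, edgeLabel, ha, hja]]
          at this
      · rw [show edgeLabel m a (!ε) j = ε by simp [edgeLabel, hj, hja]]; exact h1 j
  · have := hstar m
    rwa [show starLabel k ε m = !ε by simp [starLabel, hm]] at this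

/-- The quadratic form `‖v‖² - w²`, whose zeros with `w = 1` are the points of the Blaschke
cylinder. -/
noncomputable def blaschkeForm : QuadraticForm ℝ (E3 × ℝ × ℝ) :=
  LinearMap.BilinMap.toQuadraticMap
    ((innerₗ E3).compl₁₂ (LinearMap.fst ℝ E3 (ℝ × ℝ)) (LinearMap.fst ℝ E3 (ℝ × ℝ)) -
      (LinearMap.mul ℝ ℝ).compl₁₂
        (LinearMap.snd ℝ ℝ ℝ ∘ₗ LinearMap.snd ℝ E3 (ℝ × ℝ))
        (LinearMap.snd ℝ ℝ ℝ ∘ₗ LinearMap.snd ℝ E3 (ℝ × ℝ)))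

theorem blaschkeForm_apply (x : E3 × ℝ × ℝ) :
    blaschkeForm x = inner ℝ x.1 x.1 - x.2.2 * x.2.2 := rfl

theorem polar_blaschkeForm (x y : E3 × ℝ × ℝ) :
    polar blaschkeForm x y = 2 * (inner ℝ x.1 y.1 - x.2.2 * y.2.2) := by
  simp only [polar, blaschkeForm_apply, Prod.fst_add, Prod.snd_add, inner_add_left,
    inner_add_right, real_inner_comm x.1 y.1]
  ring

theorem blaschkeForm_lift (π : OrientedPlane) : blaschkeForm π.lift = 0 := by
  rw [blaschkeForm_apply, OrientedPlane.lift, real_inner_self_eq_norm_sq, π.norm_normal]; norm_num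

/-- The zeros at infinity of the quadratic form are the multiples of the direction `(0, 1, 0)` of
the generators of the cylinder. -/
theorem blaschkeForm_eq_zero {x : E3 × ℝ × ℝ} (hx : blaschkeForm x = 0) (hw : x.2.2 = 0) :
    x.1 = 0 := by
  rw [blaschkeForm_apply, hw, mul_zero, sub_zero] at hx
  exact inner_self_eq_zero.1 hx

/-- A non-singular zero of the quadratic form is a multiple of the coordinate vector of an oriented
plane. -/
theorem exists_orientedPlane {x : E3 × ℝ × ℝ} (hx : blaschkeForm x = 0)
    (h : ∃ u, polar blaschkeForm x u ≠ 0) : ∃ (π : OrientedPlane) (c : ℝ), c ≠ 0 ∧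
      π.lift = c • x := by
  have hw : x.2.2 ≠ 0 := by
    intro hw
    obtain ⟨u, hu⟩ := h
    rw [polar_blaschkeForm, hw, blaschkeForm_eq_zero hx hw] at hu
    simp at hu
  refine ⟨⟨x.2.2⁻¹ • x.1, x.2.2⁻¹ * x.2.1, ?_⟩, x.2.2⁻¹, inv_ne_zero hw, ?_⟩
  · rw [blaschkeForm_apply, real_inner_self_eq_norm_sq, sub_eq_zero, ← _root_.sq,
    sq_eq_sq_iff_abs_eq_abs,
      abs_norm] at hx
    rw [norm_smul, norm_inv, Real.norm_eq_abs, hx, inv_mul_cancel₀ (abs_ne_zero.2 hw)]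
  · ext <;> simp [OrientedPlane.lift, hw]

end Realization

/-! ### Neighbouring cubes on a space curve -/

section CubePair

variable {U : Type*} [AddCommGroup U] [Module ℝ U]

/-- Two neighbouring cubes on the smooth part of the curve in which the quadrics `Q` and `R` of a
three-dimensional projective space meet. -/
structure CubePair (Q R : QuadraticForm ℝ U) (O O' : Fin 4 → Bool → U) (i l : Fin 4) : Prop where
  finrank_eq : Module.finrank ℝ U = 4
  left : IsCube O
  right : IsCube O'
  ne : i ≠ l
  eq_i : O' i false = O i true
  eq_l : O' l true = O l false
  eq_of_ne : ∀ k, k ≠ i → k ≠ l → ∀ ε, O' k ε = O k ε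
  Q_left : ∀ m b, Q (O m b) = 0
  Q_right : ∀ m b, Q (O' m b) = 0
  R_left : ∀ m b, R (O m b) = 0
  R_right : ∀ m b, R (O' m b) = 0
  smooth_left : ∀ m b, PencilSmooth Q R (O m b)
  smooth_right : ∀ m b, PencilSmooth Q R (O' m b)

end CubePair

/-! ### Functions and divisors on Weierstrass curves -/

section WeierstrassDivisors

open Polynomial WeierstrassCurve.Affine WeierstrassCurve.Affine.CoordinateRing
open scoped Polynomial.Bivariate nonZeroDivisors

namespace WeierstrassCurve.Affine

variable {F : Type*} [Field F] {W : WeierstrassCurve.Affine F}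

theorem CoordinateRing.smul_basis_eq_mk (p q : F[X]) :
    p • (1 : W.CoordinateRing) + q • mk W Y = mk W (C p + C q * Y) := by
  rw [CoordinateRing.smul, CoordinateRing.smul, mul_one, map_add, map_mul]

/-- The value of a regular function in an affine point. -/
noncomputable def CoordinateRing.evalHom {x y : F} (h : W.Equation x y) : W.CoordinateRing →+* F :=
  AdjoinRoot.lift (Polynomial.evalRingHom x) y (by
    rw [Polynomial.eval₂_evalRingHom]; exact h)

theorem CoordinateRing.evalHom_apply {x y : F} (h : W.Equation x y) (p q : F[X]) :
    evalHom h (mk W (C p + C q * Y)) = p.eval x + q.eval x * y := by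
  simp [evalHom]

theorem CoordinateRing.mem_XYIdeal_iff {x y : F} (h : W.Equation x y) (f : W.CoordinateRing) :
    f ∈ XYIdeal W x (C y) ↔ evalHom h f = 0 := by
  constructor
  · intro hf
    have : XYIdeal W x (C y) ≤ RingHom.ker (evalHom h) := by
      rw [XYIdeal, Ideal.span_le]
      rintro g (rfl | rfl)
      · simp [XClass, evalHom]
      · simp [YClass, evalHom]
    exact this hf
  · intro hf
    obtain ⟨p, q, rfl⟩ := exists_smul_basis_eq f
    rw [smul_basis_eq_mk] at hf ⊢
    rw [evalHom_apply] at hf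
    obtain ⟨a, ha⟩ := X_sub_C_dvd_sub_C_eval (p := p) (a := x)
    obtain ⟨b, hb⟩ := X_sub_C_dvd_sub_C_eval (p := q) (a := x)
    rw [sub_eq_iff_eq_add] at ha hb
    have h1 : mk W (C p + C q * Y) = mk W (C a + C b * Y) * XClass W x +
        mk W (C (C (q.eval x))) * YClass W (C y) := by
      rw [XClass, YClass, ← map_mul, ← map_mul, ← map_add]
      congr 1
      conv_lhs => rw [ha, hb]
      have h2 : C (p.eval x) = - (C (q.eval x) * C y) := by
        rw [← C_mul, ← C_neg]; congr 1; linear_combination hf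
      rw [h2]
      simp only [C_add, C_mul, C_neg, C_sub]
      ring
    rw [h1]
    exact add_mem (Ideal.mul_mem_left _ _ (Ideal.subset_span (by simp)))
      (Ideal.mul_mem_left _ _ (Ideal.subset_span (by simp)))

theorem CoordinateRing.isPrime_XYIdeal {x y : F} (h : W.Equation x y) :
    (XYIdeal W x (C y)).IsPrime := by
  have : XYIdeal W x (C y) = RingHom.ker (evalHom h) := Ideal.ext fun f => mem_XYIdeal_iff h f
  rw [this]
  exact RingHom.ker_isPrime _

/-- The automorphism of the coordinate ring which is induced by the negation of points. -/
noncomputable def CoordinateRing.conj : W.CoordinateRing →+* W.CoordinateRing :=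
  AdjoinRoot.lift (algebraMap F[X] W.CoordinateRing) (mk W W.negPolynomial) (by
    have h1 : ∀ p : F[X], algebraMap F[X] W.CoordinateRing p = mk W (C p) := fun p => rfl
    simp only [polynomial, eval₂_add, eval₂_sub, eval₂_mul, eval₂_pow, eval₂_X, eval₂_C, h1,
      ← map_mul, ← map_pow, ← map_add, ← map_sub]
    refine AdjoinRoot.mk_eq_zero.2 ⟨1, ?_⟩
    rw [polynomial, negPolynomial]
    ring)

theorem CoordinateRing.conj_mk (p q : F[X]) :
    conj (mk W (C p + C q * Y)) = mk W (C p + C q * W.negPolynomial) := by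
  simp [conj]

/-- The norm of a regular function is its product with the conjugate function. -/
theorem CoordinateRing.mul_conj (f : W.CoordinateRing) :
    f * conj f = algebraMap F[X] W.CoordinateRing (Algebra.norm F[X] f) := by
  obtain ⟨p, q, rfl⟩ := exists_smul_basis_eq f
  have h := coe_norm_smul_basis (W' := W) p q
  rw [smul_basis_eq_mk] at h ⊢
  rw [conj_mk, ← map_mul]
  exact h.symm

theorem CoordinateRing.map_conj_XYIdeal (x y : F) :
    (XYIdeal W x (C y)).map conj = XYIdeal W x (C (W.negY x y)) := by
  have h1 : conj (XClass W x) = XClass W x := by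
    have := conj_mk (W := W) (X - C x) 0
    simpa [XClass] using this
  have h2 : conj (YClass W (C y)) =
      -YClass W (C (W.negY x y)) - mk W (C (C W.a₁)) * XClass W x := by
    have := conj_mk (W := W) (-C y) 1
    rw [YClass, YClass, XClass, ← map_mul, ← map_neg, ← map_sub]
    rw [show (Y - C (C y) : F[X][Y]) = C (-C y) + C 1 * Y by simp; ring, this]
    congr 1
    rw [negPolynomial, negY]
    simp only [C_add, C_mul, C_neg, C_sub, C_1]
    ring
  rw [XYIdeal, Ideal.map_span, Set.image_pair, h1, h2, XYIdeal]
  apply le_antisymm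
  · rw [Ideal.span_le]
    rintro g (rfl | rfl)
    · exact Ideal.subset_span (by simp)
    · exact sub_mem (neg_mem (Ideal.subset_span (by simp)))
        (Ideal.mul_mem_left _ _ (Ideal.subset_span (by simp)))
  · rw [Ideal.span_le]
    rintro g (rfl | rfl)
    · exact Ideal.subset_span (by simp)
    · set I := Ideal.span {XClass W x, -YClass W (C (W.negY x y)) - mk W (C (C W.a₁)) * XClass W x}
      have h3 : XClass W x ∈ I := Ideal.subset_span (by simp)
      have h4 : -YClass W (C (W.negY x y)) - mk W (C (C W.a₁)) * XClass W x ∈ I :=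
        Ideal.subset_span (by simp)
      have h5 := neg_mem (add_mem h4 (Ideal.mul_mem_left _ (mk W (C (C W.a₁))) h3))
      rwa [sub_add_cancel, neg_neg] at h5

/-- The ideal of the regular functions which vanish in a point; the unit ideal for the point at
infinity. -/
noncomputable def Point.ideal : W.Point → Ideal W.CoordinateRing
  | .zero => ⊤
  | .some x y _ => XYIdeal W x (C y)

/-- A generator of the norm of the ideal of a point. -/
noncomputable def Point.linearFactor : W.Point → F[X]
  | .zero => 1
  | .some x _ _ => X - C x

theorem Point.isPrime_ideal {P : W.Point} (hP : P ≠ 0) : P.ideal.IsPrime := by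
  rcases P with _ | ⟨x, y, h⟩
  · exact absurd rfl hP
  · exact isPrime_XYIdeal h.1

theorem Point.eq_of_ideal_le {P Q : W.Point} (hP : P ≠ 0) (h : Q.ideal ≤ P.ideal) : Q = P := by
  rcases P with _ | ⟨x, y, hxy⟩
  · exact absurd rfl hP
  rcases Q with _ | ⟨x', y', hxy'⟩
  · exact absurd (top_le_iff.1 h) (isPrime_XYIdeal hxy.1).ne_top
  have h1 : XClass W x' ∈ XYIdeal W x (C y) := h (Ideal.subset_span (by simp))
  have h2 : YClass W (C y') ∈ XYIdeal W x (C y) := h (Ideal.subset_span (by simp))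
  rw [mem_XYIdeal_iff hxy.1] at h1 h2
  have h3 : x = x' := by
    have : x - x' = 0 := by simpa [XClass, evalHom] using h1
    linear_combination this
  have h4 : y = y' := by
    have : y - y' = 0 := by simpa [YClass, evalHom] using h2
    linear_combination this
  subst h3; subst h4; rfl

theorem Point.ideal_mul_map_conj (P : W.Point) :
    P.ideal * P.ideal.map conj = Ideal.span {algebraMap F[X] W.CoordinateRing P.linearFactor} := by
  rcases P with _ | ⟨x, y, h⟩
  · change ⊤ * Ideal.map conj ⊤ = Ideal.span {algebraMap F[X] W.CoordinateRing 1}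
    rw [Ideal.map_top, map_one, Ideal.span_singleton_one, Ideal.mul_top]
  · change XYIdeal W x (C y) * (XYIdeal W x (C y)).map conj = _
    rw [map_conj_XYIdeal, mul_comm, XYIdeal_neg_mul h]
    rfl

/-- The degree of the norm of a regular function is the number of its zeros. -/
theorem Point.natDegree_norm {s : Multiset W.Point} {f : W.CoordinateRing}
    (h : (s.map Point.ideal).prod = Ideal.span {f}) :
    (Algebra.norm F[X] f).natDegree = (s.map fun P => P.linearFactor.natDegree).sum := by
  have h1 : (s.map Point.ideal).prod.map conj = (s.map fun P => P.ideal.map conj).prod := by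
    rw [← Ideal.mapHom_apply, map_multiset_prod, Multiset.map_map]; rfl
  have h2 : Ideal.span {f * conj f} =
      Ideal.span {algebraMap F[X] W.CoordinateRing (s.map Point.linearFactor).prod} := by
    rw [← Ideal.span_singleton_mul_span_singleton, ← Set.image_singleton, ← Ideal.map_span, ← h, h1,
      ← Multiset.prod_map_mul]
    simp only [Point.ideal_mul_map_conj]
    rw [map_multiset_prod, Multiset.map_map, ← Ideal.multiset_prod_span_singleton,
      Multiset.map_map]
    rfl
  rw [mul_conj, Ideal.span_singleton_eq_span_singleton] at h2
  have h3 := Polynomial.degree_eq_degree_of_associated (h2.map (Algebra.norm F[X]))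
  have h4 : Module.finrank F[X] W.CoordinateRing = 2 := by
    rw [Module.finrank_eq_card_basis (CoordinateRing.basis W), Fintype.card_fin]
  rw [Algebra.norm_algebraMap_of_basis (CoordinateRing.basis W),
    Algebra.norm_algebraMap_of_basis (CoordinateRing.basis W), Fintype.card_fin] at h3
  have h5 := natDegree_eq_natDegree h3
  rw [natDegree_pow, natDegree_pow, natDegree_multiset_prod, Multiset.map_map] at h5
  · exact Nat.eq_of_mul_eq_mul_left two_pos h5
  · intro h0
    obtain ⟨P, -, hP⟩ := Multiset.mem_map.1 h0
    rcases P with _ | ⟨x, y, h⟩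
    · exact one_ne_zero hP
    · exact X_sub_C_ne_zero x hP

theorem Point.natDegree_linearFactor {P : W.Point} (hP : P ≠ 0) :
    P.linearFactor.natDegree = 1 := by
  rcases P with _ | ⟨x, y, h⟩
  · exact absurd rfl hP
  · exact natDegree_X_sub_C x

theorem Point.natDegree_linearFactor_zero : (0 : W.Point).linearFactor.natDegree = 0 :=
  natDegree_one

/-- A point in which a regular function vanishes occurs in its divisor. -/
theorem Point.mem_of_mem_ideal {s : Multiset W.Point} {P : W.Point} (hP : P ≠ 0)
    (h : (s.map Point.ideal).prod ≤ P.ideal) : P ∈ s := by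
  obtain ⟨Q, hQ, hle⟩ := (Point.isPrime_ideal hP).multiset_prod_map_le Point.ideal |>.1 h
  rwa [← Point.eq_of_ideal_le hP hle]

/-- Points with the sum zero are the zeros of a regular function, since the group of points embeds
into the class group of the coordinate ring. -/
theorem Point.exists_span_eq [DecidableEq F] {s : Multiset W.Point} (hs : s.sum = 0) :
    ∃ f, f ≠ 0 ∧ (s.map Point.ideal).prod = Ideal.span {f} := by
  have h1 : ∀ P : W.Point, ∃ u : (FractionalIdeal W.CoordinateRing⁰ W.FunctionField)ˣ,
      (u : FractionalIdeal W.CoordinateRing⁰ W.FunctionField) = P.ideal ∧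
      ClassGroup.mk W.FunctionField u = (toClass P).toMul := by
    rintro (_ | ⟨x, y, h⟩)
    · refine ⟨1, by simp [Point.ideal], ?_⟩
      rw [map_one]; rfl
    · exact ⟨XYIdeal' h, rfl, rfl⟩
  choose u hu huc using h1
  have h2 : ((s.map u).prod : FractionalIdeal W.CoordinateRing⁰ W.FunctionField) =
      ((s.map Point.ideal).prod : Ideal W.CoordinateRing) := by
    clear hs
    induction s using Multiset.induction with
    | empty => simp
    | cons P s ih => simp [ih, hu]
  refine (ClassGroup.mk_eq_one_of_coe_ideal h2).1 ?_
  rw [map_multiset_prod, Multiset.map_map]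
  simp only [Function.comp_def, huc]
  have h3 := congrArg toClass hs
  rw [map_multiset_sum] at h3
  refine Eq.trans ?_ (congrArg Additive.toMul (h3.trans toClass_zero))
  clear hs h2 h3
  induction s using Multiset.induction with
  | empty => rfl
  | cons P s ih =>
    simp only [Multiset.map_cons, Multiset.prod_cons, Multiset.sum_cons, toMul_add, ih]

/-- The degree of the norm of a regular function is the order of its pole at infinity. The functions
`X` and `Y` have poles of the orders two and three, so the terms of `p + q Y` have poles of
different orders. -/
theorem CoordinateRing.natDegree_le_of_natDegree_norm_le {p q : F[X]} {n : ℕ}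
    (h : (Algebra.norm F[X] (mk W (C p + C q * Y))).natDegree ≤ n) :
    2 * p.natDegree ≤ n ∧ (q ≠ 0 → 2 * q.natDegree + 3 ≤ n) := by
  have h1 := degree_norm_smul_basis (W' := W) p q
  rw [smul_basis_eq_mk] at h1
  have h2 := h1 ▸ (natDegree_le_iff_degree_le.1 h)
  rw [max_le_iff] at h2
  refine ⟨?_, fun hq => ?_⟩
  · by_cases hp : p = 0
    · simp [hp]
    · have h3 := h2.1
      rw [degree_eq_natDegree hp] at h3
      rw [two_nsmul] at h3; rw [two_mul]; exact_mod_cast h3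
  · have h3 := h2.2
    rw [degree_eq_natDegree hq, two_nsmul] at h3; rw [two_mul]
    exact_mod_cast h3

theorem CoordinateRing.natDegree_norm_le {p q : F[X]} {n : ℕ} (hp : 2 * p.natDegree ≤ n)
    (hq : q ≠ 0 → 2 * q.natDegree + 3 ≤ n) :
    (Algebra.norm F[X] (mk W (C p + C q * Y))).natDegree ≤ n := by
  have h1 := degree_norm_smul_basis (W' := W) p q
  rw [smul_basis_eq_mk] at h1
  rw [natDegree_le_iff_degree_le, h1, max_le_iff]
  constructor
  · by_cases h0 : p = 0
    · simp [h0]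
    · rw [degree_eq_natDegree h0, two_nsmul]; rw [two_mul] at hp
      exact_mod_cast hp
  · by_cases h0 : q = 0
    · simp [h0]
    · rw [degree_eq_natDegree h0, two_nsmul]; rw [two_mul] at hq
      exact_mod_cast hq h0

end WeierstrassCurve.Affine

end WeierstrassDivisors

/-! ### Curves which are parametrised by a group -/

section Parametrization

variable {U : Type*} [AddCommGroup U] [Module ℝ U] {Q F G : QuadraticForm ℝ U}
  {O O' : Fin 4 → Bool → U} {i l : Fin 4}

theorem PencilSmooth.exists_polar_ne {p : U} (h : PencilSmooth F G p) {α β : ℝ}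
    (hαβ : α ≠ 0 ∨ β ≠ 0) (hQ : Q = α • F + β • G) : ∃ u, polar Q p u ≠ 0 := by
  by_contra! hu
  have := h α β fun u => by
    rw [← hu u, hQ]
    simp only [polar, _root_.add_apply, _root_.smul_apply, smul_eq_mul]; ring
  rcases hαβ with h1 | h1
  · exact h1 this.1
  · exact h1 this.2

theorem PencilSmooth.ne_zero {p : U} (h : PencilSmooth F G p) : p ≠ 0 := by
  rintro rfl
  have := h 1 0 (fun u => by simp)
  exact one_ne_zero this.1

theorem exists_smul_of_mem_span {x y : U} (hx : x ≠ 0) (h : x ∈ span ℝ {y}) :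
    ∃ c : ℝ, c ≠ 0 ∧ x = c • y := by
  obtain ⟨c, rfl⟩ := mem_span_singleton.1 h
  exact ⟨c, fun h0 => hx (by rw [h0, zero_smul]), rfl⟩

theorem IsCircuit.smul {x y : Fin 4 → U} (hx : IsCircuit x) {c : Fin 4 → ℝ} (hc : ∀ k, c k ≠ 0)
    (hy : ∀ k, y k = c k • x k) : IsCircuit y := by
  constructor
  · obtain ⟨d, hd, hs⟩ := hx.exists_rel_ne
    refine ⟨fun k => d k * (c k)⁻¹, fun h0 => ?_, ?_⟩
    · have := congrFun h0 0
      simp [hd 0, hc 0] at this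
    · rw [← hs]
      refine Finset.sum_congr rfl fun k _ => ?_
      rw [hy, smul_smul, mul_assoc, inv_mul_cancel₀ (hc k), mul_one]
  · intro d hs k hk
    have := hx.eq_zero (fun k => d k * c k) (by
      rw [← hs]
      refine Finset.sum_congr rfl fun k _ => ?_
      rw [hy, smul_smul]) k (by simp [hk])
    funext j
    have h2 := congrFun this j
    simpa [hc j] using h2

theorem PencilSmooth.of_smul {p : U} {c : ℝ} (h : PencilSmooth F G p) (hc : c ≠ 0) :
    PencilSmooth F G (c • p) := by
  intro α β h1
  refine h α β fun u => ?_
  have := h1 u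
  rw [polar_smul_left, polar_smul_left, smul_eq_mul, smul_eq_mul] at this
  have h2 : c * (α * polar F p u + β * polar G p u) = 0 := by linear_combination this
  exact (mul_eq_zero.1 h2).resolve_left hc

/-- If the smooth points of the curve `F = G = 0` are parametrised by an abelian group in such a
way that four points are coplanar if the sum of their parameters is `κ`, and conversely for
circuits, then neighbouring cubes on the curve are contained in a grid. -/
theorem CubePair.hasGrid_of_parametrization (h : CubePair F G O O' i l) {α β : ℝ}
    (hαβ : α ≠ 0 ∨ β ≠ 0) (hQ : Q = α • F + β • G) {A : Type*} [AddCommGroup A] (Φ : A → U) (κ : A)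
    (hF : ∀ g, F (Φ g) = 0) (hG : ∀ g, G (Φ g) = 0) (hs : ∀ g, PencilSmooth F G (Φ g))
    (hsurj : ∀ x, F x = 0 → G x = 0 → PencilSmooth F G x → ∃ g, Φ g ∈ span ℝ {x})
    (hdep : ∀ g : Fin 4 → A, ∑ k, g k = κ → ¬ LinearIndependent ℝ fun k => Φ (g k))
    (hcirc : ∀ g : Fin 4 → A, IsCircuit (fun k => Φ (g k)) → ∑ k, g k = κ) :
    HasGrid Q O O' i l := by
  classical
  -- the parameters of the smooth points
  obtain ⟨γ, hγ⟩ : ∃ γ : U → A, ∀ x, F x = 0 → G x = 0 → PencilSmooth F G x →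
      Φ (γ x) ∈ span ℝ {x} := by
    refine ⟨fun x => if h : F x = 0 ∧ G x = 0 ∧ PencilSmooth F G x then
      (hsurj x h.1 h.2.1 h.2.2).choose else κ, fun x h1 h2 h3 => ?_⟩
    simp only [h1, h2, h3, and_self, dite_true]
    exact (hsurj x h1 h2 h3).choose_spec
  have hO : ∀ k b, Φ (γ (O k b)) ∈ span ℝ {O k b} := fun k b =>
    hγ _ (h.Q_left k b) (h.R_left k b) (h.smooth_left k b)
  have hO' : ∀ k b, Φ (γ (O' k b)) ∈ span ℝ {O' k b} := fun k b =>
    hγ _ (h.Q_right k b) (h.R_right k b) (h.smooth_right k b)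
  have hrel : ∀ x : Fin 4 → U, IsCircuit x → (∀ k, Φ (γ (x k)) ∈ span ℝ {x k}) →
      ∑ k, γ (x k) = κ := by
    intro x hx hmem
    choose c hc hy using fun k => exists_smul_of_mem_span (hs _).ne_zero (hmem k)
    exact hcirc _ (hx.smul hc hy)
  obtain ⟨a, hai, hal⟩ := exists_ne_ne i l
  refine hasGrid_of_group h.ne h.eq_i h.eq_l h.eq_of_ne (fun _ _ => Φ) (fun _ => False) κ
    (fun _ => γ) (fun _ _ g => ⟨?_, (hs g).exists_polar_ne hαβ hQ⟩)
    (fun _ _ g hg => hdep g (hg id)) hO (fun k s => hO' k (s k))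
    (fun s hs _ => hrel _ (h.left.circuit s hs) fun k => hO k (s k))
    (fun s hs _ => hrel _ (h.right.circuit s hs) fun k => hO' k (s k)) ⟨a, hai, hal, id⟩
  rw [hQ, _root_.add_apply, _root_.smul_apply, _root_.smul_apply, hF, hG]; simp

theorem IsCircuit.eq_zero_of_forall_ne {V : Type*} [AddCommGroup V] [Module ℝ V] {x : Fin 4 → V}
    (hx : IsCircuit x) (φ : V →ₗ[ℝ] ℝ) (k : Fin 4) (h : ∀ j, j ≠ k → φ (x j) = 0) :
    φ (x k) = 0 := by
  obtain ⟨c, hc, hs⟩ := hx.exists_rel_ne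
  have h1 := congrArg φ hs
  rw [map_sum, map_zero, Finset.sum_eq_single k (fun j _ hj => by rw [map_smul, h j hj, smul_zero])
    (by simp), map_smul] at h1
  exact (smul_eq_zero.1 h1).resolve_left (hc k)

theorem IsCircuit.injective {V : Type*} [AddCommGroup V] [Module ℝ V] {x : Fin 4 → V}
    (hx : IsCircuit x) : Function.Injective x := by
  intro j k hjk
  by_contra hne
  exact hx.not_mem_span_singleton hne (by rw [hjk]; exact mem_span_singleton_self _)

/-- Vectors which are orthogonal to a vector different from zero are linearly dependent. -/
theorem not_linearIndependent_of_dotProduct {x : Fin 4 → Fin 4 → ℝ} {a : Fin 4 → ℝ} (ha : a ≠ 0)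
    (h : ∀ k, a ⬝ᵥ x k = 0) : ¬ LinearIndependent ℝ x := by
  intro hx
  have h1 := hx.span_eq_top_of_card_eq_finrank (by simp)
  have h2 : dotProductBilin ℝ ℝ a = 0 := by
    refine LinearMap.ext_on_range h1 fun k => ?_
    exact h k
  exact ha (dotProduct_self_eq_zero.1 (by simpa using congrArg (fun f => f a) h2))

end Parametrization

/-! ### Weierstrass curves as space curves of degree four -/

section WeierstrassCurves

open Polynomial WeierstrassCurve.Affine WeierstrassCurve.Affine.CoordinateRing
open scoped Polynomial.Bivariate

variable {U : Type*} [AddCommGroup U] [Module ℝ U]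

theorem polar_equiv {V : Type*} [AddCommGroup V] [Module ℝ V] {F : QuadraticForm ℝ U}
    (e : V ≃ₗ[ℝ] U) {f : V → ℝ} (hF : ∀ c, F (e c) = f c) (c d : V) :
    polar F (e c) (e d) = f (c + d) - f c - f d := by
  rw [polar, ← map_add, hF, hF, hF]

theorem eq_of_natDegree_le {p : ℝ[X]} {n : ℕ} (h : p.natDegree ≤ n) (hn : n ≤ 2) :
    p = C (p.coeff 0) + C (p.coeff 1) * X + C (p.coeff 2) * X ^ 2 := by
  conv_lhs => rw [p.as_sum_range_C_mul_X_pow' (n := 3) (by omega)]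
  simp [Finset.sum_range_succ]

/-- The embedding of a Weierstrass curve as a space curve of degree four by the functions
`1, X, Y, X²`. -/
def pointVector {W : WeierstrassCurve.Affine ℝ} : W.Point → Fin 4 → ℝ
  | .zero => ![0, 0, 0, 1]
  | .some x y _ => ![1, x, y, x ^ 2]

/-- Four points with the sum zero are the zeros of a regular function with a pole of order at most
four, that is, of a combination of `1`, `X`, `Y` and `X²`. In other words, they are the intersection
of the space curve with a plane. -/
theorem exists_dotProduct_pointVector {W : WeierstrassCurve.Affine ℝ} (g : Fin 4 → W.Point)
    (hg : ∑ k, g k = 0) : ∃ a : Fin 4 → ℝ, a ≠ 0 ∧ (∀ k, a ⬝ᵥ pointVector (g k) = 0) ∧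
      ∀ P, a ⬝ᵥ pointVector P = 0 → ∃ k, P = g k := by
  set s : Multiset W.Point := Finset.univ.val.map g
  have hs : s.sum = 0 := hg
  obtain ⟨f, hf0, hf⟩ := Point.exists_span_eq hs
  have hdeg := Point.natDegree_norm hf
  obtain ⟨p, q, rfl⟩ := exists_smul_basis_eq f
  rw [smul_basis_eq_mk] at hf hdeg hf0
  rw [Multiset.map_map] at hdeg
  change _ = ∑ k, (g k).linearFactor.natDegree at hdeg
  have hle : ∀ P : W.Point, P.linearFactor.natDegree ≤ 1 := by
    intro P
    by_cases hP : P = 0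
    · rw [hP, Point.natDegree_linearFactor_zero]; exact zero_le_one
    · rw [Point.natDegree_linearFactor hP]
  have h4 := natDegree_le_of_natDegree_norm_le (n := 4) (p := p) (q := q) (by
    rw [hdeg]
    refine (Finset.sum_le_sum fun k _ => hle (g k)).trans (by simp))
  have hq : q = C (q.coeff 0) := by
    by_cases h0 : q = 0
    · simp [h0]
    · exact eq_C_of_natDegree_eq_zero (by have := h4.2 h0; omega)
  have hp := eq_of_natDegree_le (p := p) (n := 2) (by omega) le_rfl
  have hmem : ∀ x y (h : W.Nonsingular x y), ![p.coeff 0, p.coeff 1, q.coeff 0, p.coeff 2] ⬝ᵥ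
      pointVector (Point.some x y h) = 0 ↔
        mk W (C p + C q * Y) ∈ (Point.some x y h).ideal := by
    intro x y h
    change _ ↔ _ ∈ XYIdeal W x (C y)
    rw [mem_XYIdeal_iff h.1, evalHom_apply]
    conv_rhs => rw [hp, hq]
    simp [pointVector, dotProduct, Fin.sum_univ_four]
    constructor <;> intro h <;> linear_combination h
  have hzero : ∀ P : W.Point, P = 0 → ![p.coeff 0, p.coeff 1, q.coeff 0, p.coeff 2] ⬝ᵥ
      pointVector P = p.coeff 2 := by
    rintro _ rfl
    change _ ⬝ᵥ ![0, 0, 0, 1] = _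
    simp [dotProduct, Fin.sum_univ_four]
  refine ⟨![p.coeff 0, p.coeff 1, q.coeff 0, p.coeff 2], fun h0 => hf0 ?_, fun k => ?_,
    fun P hP => ?_⟩
  · have h1 := congrFun h0 0
    have h2 := congrFun h0 1
    have h3 := congrFun h0 2
    have h4 := congrFun h0 3
    simp at h1 h2 h3 h4
    rw [hp, hq, h1, h2, h3, h4]; simp
  · by_cases hk : g k = 0
    · rw [hzero _ hk]
      have h3 := natDegree_le_of_natDegree_norm_le (n := 3) (p := p) (q := q) (by
        rw [hdeg, ← Finset.add_sum_erase _ _ (Finset.mem_univ k), hk,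
          Point.natDegree_linearFactor_zero, zero_add]
        refine (Finset.sum_le_sum fun k _ => hle (g k)).trans (by simp))
      exact coeff_eq_zero_of_natDegree_lt (by omega)
    · have h1 : mk W (C p + C q * Y) ∈ (g k).ideal := by
        have : mk W (C p + C q * Y) ∈ (s.map Point.ideal).prod := by
          rw [hf]; exact Ideal.mem_span_singleton_self _
        refine Ideal.le_of_dvd (Multiset.dvd_prod ?_) this
        rw [Multiset.map_map]
        exact Multiset.mem_map_of_mem _ (Finset.mem_univ k)
      generalize hgk : g k = P at *
      rcases P with _ | ⟨x, y, h⟩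
      · exact absurd rfl hk
      · exact (hmem x y h).2 h1
  · by_cases hP0 : P = 0
    · rw [hzero P hP0] at hP
      by_contra! hne
      have h1 : ∀ k, (g k).linearFactor.natDegree = 1 := fun k =>
        Point.natDegree_linearFactor fun h0 => hne k (hP0.trans h0.symm)
      have h2 : p.natDegree ≤ 1 := by
        refine natDegree_le_iff_coeff_eq_zero.2 fun m hm => ?_
        by_cases hm2 : m = 2
        · rw [hm2, hP]
        · exact coeff_eq_zero_of_natDegree_lt (by omega)
      have h3 := natDegree_norm_le (W := W) (n := 3) (p := p) (q := q) (by omega) (fun h0 => by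
        have := h4.2 h0; omega)
      rw [hdeg] at h3
      simp [h1] at h3
    · have h1 : mk W (C p + C q * Y) ∈ P.ideal := by
        rcases P with _ | ⟨x, y, h⟩
        · exact absurd rfl hP0
        · exact (hmem x y h).1 hP
      have h2 := Point.mem_of_mem_ideal (s := s) hP0 (by
        rw [hf, Ideal.span_singleton_le_iff_mem]; exact h1)
      obtain ⟨k, -, hk⟩ := Multiset.mem_map.1 h2
      exact ⟨k, hk.symm⟩

/-- Grids on the curve `TW = X²`, `Y² + a₁XY + a₃YW = TX + a₂X² + a₄XW + a₆W²`, which has four-point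
contact with the plane `W = 0` at `X = Y = W = 0`. The points are those of a Weierstrass curve, and
the sum of four coplanar points is zero. -/
theorem CubePair.hasGrid_of_flex {Q F G : QuadraticForm ℝ U} {O O' : Fin 4 → Bool → U}
    {i l : Fin 4} (h : CubePair F G O O' i l) {α β : ℝ}
    (hαβ : α ≠ 0 ∨ β ≠ 0) (hQ : Q = α • F + β • G) (e : (Fin 4 → ℝ) ≃ₗ[ℝ] U)
    (a₁ a₂ a₃ a₄ a₆ : ℝ) (hF : ∀ c, F (e c) = c 3 * c 0 - c 1 ^ 2)
    (hG : ∀ c, G (e c) = c 2 ^ 2 + a₁ * c 1 * c 2 + a₃ * c 2 * c 0 -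
      (c 3 * c 1 + a₂ * c 1 ^ 2 + a₄ * c 1 * c 0 + a₆ * c 0 ^ 2)) : HasGrid Q O O' i l := by
  set W : WeierstrassCurve.Affine ℝ := ⟨a₁, a₂, a₃, a₄, a₆⟩ with hW
  have hns : ∀ x y, W.Nonsingular x y ↔ y ^ 2 + a₁ * x * y + a₃ * y =
      x ^ 3 + a₂ * x ^ 2 + a₄ * x + a₆ ∧ (a₁ * y - (3 * x ^ 2 + 2 * a₂ * x + a₄) ≠ 0 ∨
        2 * y + a₁ * x + a₃ ≠ 0) := by
    intro x y
    rw [nonsingular_iff', equation_iff]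
  -- the plane of three points of a circuit meets the curve in a fourth point with the sum zero,
  -- which can only be the last point of the circuit
  have hinj : ∀ g : Fin 4 → W.Point, (∀ k j, k ≠ j → g k ≠ g j) →
      (∀ a : Fin 4 → ℝ, a ⬝ᵥ pointVector (g 0) = 0 → a ⬝ᵥ pointVector (g 1) = 0 →
        a ⬝ᵥ pointVector (g 2) = 0 → a ⬝ᵥ pointVector (g 3) = 0) → ∑ k, g k = 0 := by
    intro g hne hg
    obtain ⟨a, -, h1, h2⟩ := exists_dotProduct_pointVector ![g 0, g 1, g 2, -(g 0 + g 1 + g 2)]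
      (by simp [Fin.sum_univ_four])
    obtain ⟨k, hk⟩ := h2 (g 3) (hg a (h1 0) (h1 1) (h1 2))
    fin_cases k
    · exact absurd hk (hne 3 0 (by decide))
    · exact absurd hk (hne 3 1 (by decide))
    · exact absurd hk (hne 3 2 (by decide))
    · rw [Fin.sum_univ_four, hk]; simp
  have hsm : ∀ x y, y ^ 2 + a₁ * x * y + a₃ * y = x ^ 3 + a₂ * x ^ 2 + a₄ * x + a₆ →
      (PencilSmooth F G (e ![1, x, y, x ^ 2]) ↔ W.Nonsingular x y) := by
    intro x y hxy
    rw [hns]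
    constructor
    · intro hs
      refine ⟨hxy, ?_⟩
      by_contra! h0
      have := hs x 1 fun u => by
        obtain ⟨d, rfl⟩ := e.surjective u
        rw [polar_equiv e hF, polar_equiv e hG]
        simp
        linear_combination (2 * d 0) * hxy + (d 1 - x * d 0) * h0.1 + (d 2 - y * d 0) * h0.2
      exact one_ne_zero this.2
    · rintro ⟨-, h0⟩ α β hs
      have hb : β = 0 := by
        have h1 := hs (e ![0, 0, 0, 1])
        have h2 := hs (e ![0, 1, 0, 0])
        have h3 := hs (e ![0, 0, 1, 0])
        rw [polar_equiv e hF, polar_equiv e hG] at h1 h2 h3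
        simp [-mul_eq_zero] at h1 h2 h3
        rcases h0 with h0 | h0
        · refine (mul_eq_zero.1 (?_ : β * _ = 0)).resolve_right h0
          linear_combination h2 + 2 * x * h1
        · refine (mul_eq_zero.1 (?_ : β * _ = 0)).resolve_right h0
          linear_combination h3
      refine ⟨?_, hb⟩
      have h1 := hs (e ![0, 0, 0, 1])
      rw [polar_equiv e hF, polar_equiv e hG] at h1
      simp [hb] at h1
      exact h1
  refine h.hasGrid_of_parametrization hαβ hQ (fun P : W.Point => e (pointVector P)) 0
    ?_ ?_ ?_ ?_ ?_ ?_
  · rintro (_ | ⟨x, y, hxy⟩)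
    · simp [hF, pointVector]
    · simp [hF, pointVector]
  · rintro (_ | ⟨x, y, hxy⟩)
    · simp [hG, pointVector]
    · have := ((hns x y).1 hxy).1
      simp [hG, pointVector]
      linear_combination this
  · rintro (_ | ⟨x, y, hxy⟩)
    · intro α β hs
      have h1 := hs (e ![1, 0, 0, 0])
      have h2 := hs (e ![0, 1, 0, 0])
      rw [polar_equiv e hF, polar_equiv e hG] at h1 h2
      simp [pointVector] at h1 h2
      exact ⟨h1, h2⟩
    · exact (hsm x y ((hns x y).1 hxy).1).2 hxy
  · intro v hFv hGv hs
    obtain ⟨c, rfl⟩ := e.surjective v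
    have hc0 : c ≠ 0 := fun h0 => hs.ne_zero (by rw [h0, map_zero])
    rw [hF] at hFv
    rw [hG] at hGv
    by_cases hc : c 0 = 0
    · have h1 : c 1 = 0 := by
        rw [hc, mul_zero, zero_sub, neg_eq_zero] at hFv
        exact pow_eq_zero_iff two_ne_zero |>.1 hFv
      have h2 : c 2 = 0 := by
        refine pow_eq_zero_iff two_ne_zero |>.1 (?_ : c 2 ^ 2 = 0)
        rw [hc, h1] at hGv
        linear_combination hGv
      have h3 : c = c 3 • ![0, 0, 0, 1] := by
        ext k; fin_cases k <;> simp [hc, h1, h2]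
      have h4 : c 3 ≠ 0 := by
        intro h0; rw [h0, zero_smul] at h3; exact hc0 h3
      refine ⟨0, ?_⟩
      change e ![0, 0, 0, 1] ∈ _
      rw [mem_span_singleton]
      refine ⟨(c 3)⁻¹, ?_⟩
      rw [h3, ← map_smul, smul_smul]
      simp [h4]
    · set x := (c 0)⁻¹ * c 1 with hx
      set y := (c 0)⁻¹ * c 2 with hy
      have h1 : ![1, x, y, x ^ 2] = (c 0)⁻¹ • c := by
        ext k; fin_cases k
        · simp [hc]
        · simp [hx]
        · simp [hy]
        · simp [hx]; field_simp; linear_combination -hFv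
      have hxy : y ^ 2 + a₁ * x * y + a₃ * y = x ^ 3 + a₂ * x ^ 2 + a₄ * x + a₆ := by
        have h2 := hG ((c 0)⁻¹ • c)
        rw [map_smul, QuadraticMap.map_smul, hG, hGv, smul_zero, ← h1] at h2
        simp at h2
        linear_combination -h2
      have h2 : PencilSmooth F G (e ![1, x, y, x ^ 2]) := by
        rw [h1, map_smul]; exact hs.of_smul (inv_ne_zero hc)
      refine ⟨Point.some x y ((hsm x y hxy).1 h2), ?_⟩
      change e ![1, x, y, x ^ 2] ∈ _
      rw [h1, map_smul]
      exact smul_mem _ _ (mem_span_singleton_self _)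
  · intro g hg hli
    obtain ⟨a, ha, h1, -⟩ := exists_dotProduct_pointVector g hg
    exact not_linearIndependent_of_dotProduct ha h1 (LinearIndependent.of_comp e.toLinearMap hli)
  · intro g hg
    have hg' : IsCircuit fun k => pointVector (g k) := IsCircuit.of_map e.toLinearMap e.injective hg
    refine hinj g (fun k j hkj h0 => hkj (hg'.injective (congrArg pointVector h0)))
      fun a h0 h1 h2 => ?_
    refine hg'.eq_zero_of_forall_ne (dotProductBilin ℝ ℝ a) 3 fun j hj => ?_
    fin_cases j
    · exact h0
    · exact h1
    · exact h2
    · exact absurd rfl hj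

theorem a₆_eq_zero_of_nonsingular {W : WeierstrassCurve.Affine ℝ} (h0 : W.Nonsingular 0 0) :
    W.a₆ = 0 := by
  have h1 := ((nonsingular_iff' _ _).1 h0).1
  rw [equation_iff] at h1
  simpa using h1.symm

theorem eq_divX_add (p : ℝ[X]) : p = (p.divX.divX * X + C (p.coeff 1)) * X + C (p.coeff 0) := by
  have h1 := divX_mul_X_add p
  have h2 := divX_mul_X_add p.divX
  rw [coeff_divX] at h2
  rw [h2, h1]

/-- A regular function which vanishes of second order in the origin of the plane has a vanishing
derivative along the tangent of the curve. -/
theorem derivative_eq_zero_of_mem_sq {W : WeierstrassCurve.Affine ℝ} (h0 : W.Nonsingular 0 0)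
    {p q : ℝ[X]}
    (h : mk W (C p + C q * Y) ∈ (Point.some 0 0 h0).ideal * (Point.some 0 0 h0).ideal) :
    W.a₃ * p.coeff 1 + W.a₄ * q.coeff 0 = 0 := by
  have h6 := a₆_eq_zero_of_nonsingular h0
  have hε : (DualNumber.eps : DualNumber ℝ) * DualNumber.eps = 0 := DualNumber.eps_mul_eps
  obtain ⟨x, hx⟩ : ∃ x : DualNumber ℝ, x = W.a₃ • DualNumber.eps := ⟨_, rfl⟩
  obtain ⟨y, hy⟩ : ∃ y : DualNumber ℝ, y = W.a₄ • DualNumber.eps := ⟨_, rfl⟩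
  have hxx : x * x = 0 := by rw [hx, smul_mul_smul_comm, hε, smul_zero]
  have hxy : x * y = 0 := by rw [hx, hy, smul_mul_smul_comm, hε, smul_zero]
  have hyy : y * y = 0 := by rw [hy, smul_mul_smul_comm, hε, smul_zero]
  have h34 : algebraMap ℝ (DualNumber ℝ) W.a₃ * y = algebraMap ℝ (DualNumber ℝ) W.a₄ * x := by
    rw [hx, hy, ← Algebra.smul_def, ← Algebra.smul_def, smul_comm]
  -- the tangent vector is a point of the curve over the dual numbers
  obtain ⟨D, hD⟩ : ∃ D : W.CoordinateRing →+* DualNumber ℝ,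
      ∀ p q : ℝ[X], D (mk W (C p + C q * Y)) = aeval x p + aeval x q * y := by
    refine ⟨AdjoinRoot.lift (aeval x : ℝ[X] →ₐ[ℝ] DualNumber ℝ).toRingHom y ?_, fun p q => ?_⟩
    · rw [polynomial]
      simp only [eval₂_add, eval₂_sub, eval₂_mul, eval₂_pow, eval₂_X, eval₂_C,
        AlgHom.toRingHom_eq_coe, RingHom.coe_coe, map_add, map_mul, map_pow, aeval_X, aeval_C, h6,
        map_zero, eval₂_zero]
      linear_combination hyy + algebraMap ℝ (DualNumber ℝ) W.a₁ * hxy + h34 -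
        (x + algebraMap ℝ (DualNumber ℝ) W.a₂) * hxx
    · simp
  have hker : ∀ f ∈ (Point.some 0 0 h0).ideal, (D f).fst = 0 := by
    have : (Point.some 0 0 h0).ideal ≤
        RingHom.ker ((TrivSqZeroExt.fstHom ℝ ℝ ℝ).toRingHom.comp D) := by
      change XYIdeal W 0 (C 0) ≤ _
      rw [XYIdeal, Ideal.span_le]
      rintro g (rfl | rfl)
      · have := hD X 0
        simp at this
        simp [XClass, this, hx]
      · have := hD 0 1
        simp at this
        simp [YClass, this, hy]
    exact fun f hf => this hf
  have h1 : D (mk W (C p + C q * Y)) = 0 := by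
    have : (Point.some 0 0 h0).ideal * (Point.some 0 0 h0).ideal ≤ RingHom.ker D := by
      refine Ideal.mul_le.2 fun f hf g hg => ?_
      rw [RingHom.mem_ker, map_mul]
      ext
      · simp [hker f hf]
      · simp [hker f hf, hker g hg]
    exact this h
  have h2 : D (mk W (C p + C q * Y)) = p.coeff 1 • x + q.coeff 0 • y + p.coeff 0 • 1 := by
    rw [hD]
    conv_lhs => rw [eq_divX_add p, eq_divX_add q]
    simp only [map_add, map_mul, aeval_X, aeval_C, Algebra.smul_def, mul_one]
    linear_combination (aeval x p.divX.divX) * hxx +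
      ((aeval x q.divX.divX) * x + algebraMap ℝ (DualNumber ℝ) (q.coeff 1)) * hxy
  rw [h2] at h1
  have h3 := congrArg TrivSqZeroExt.snd h1
  simp [hx, hy] at h3
  linear_combination h3

/-- The converse of `derivative_eq_zero_of_mem_sq`: a regular function with the value zero and a
vanishing derivative in the origin vanishes of second order there. -/
theorem mem_sq_of_derivative_eq_zero {W : WeierstrassCurve.Affine ℝ} (h0 : W.Nonsingular 0 0)
    {p q : ℝ[X]} (hp0 : p.coeff 0 = 0) (h : W.a₃ * p.coeff 1 + W.a₄ * q.coeff 0 = 0) :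
    mk W (C p + C q * Y) ∈ (Point.some 0 0 h0).ideal * (Point.some 0 0 h0).ideal := by
  have h6 := a₆_eq_zero_of_nonsingular h0
  set I := (Point.some 0 0 h0).ideal
  have hX : mk W (C X) ∈ I := Ideal.subset_span (by simp [XClass])
  have hY : mk W Y ∈ I := Ideal.subset_span (by simp [YClass])
  have h34 : W.a₃ ≠ 0 ∨ W.a₄ ≠ 0 := by
    have := ((nonsingular_iff' _ _).1 h0).2
    rcases this with h | h
    · right; simpa using h
    · left; simpa using h
  obtain ⟨t, ht4, ht3⟩ : ∃ t : ℝ, p.coeff 1 = -t * W.a₄ ∧ q.coeff 0 = t * W.a₃ := by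
    rcases h34 with h3 | h4
    · refine ⟨q.coeff 0 / W.a₃, ?_, ?_⟩ <;> field_simp
      linear_combination h
    · refine ⟨-p.coeff 1 / W.a₄, ?_, ?_⟩ <;> field_simp
      linear_combination h
  obtain ⟨p₂, hp⟩ : ∃ p₂, p = (p₂ * X + C (p.coeff 1)) * X := by
    refine ⟨p.divX.divX, ?_⟩
    conv_lhs => rw [eq_divX_add p, hp0]
    simp
  obtain ⟨q₁, hq⟩ : ∃ q₁, q = q₁ * X + C (q.coeff 0) := ⟨q.divX, (divX_mul_X_add q).symm⟩
  rw [ht4] at hp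
  rw [ht3] at hq
  have h1 : mk W (C p + C q * Y) =
      (mk W (C X) * mk W (C X)) * mk W (C (p₂ + C t * (X + C W.a₂))) +
      (mk W (C X) * mk W Y) * mk W (C (q₁ - C t * C W.a₁)) -
      (mk W Y * mk W Y) * mk W (C (C t)) := by
    rw [← sub_eq_zero]
    simp only [← map_mul, ← map_add, ← map_sub]
    refine AdjoinRoot.mk_eq_zero.2 ⟨C (C t), ?_⟩
    rw [hp, hq, polynomial, h6]
    simp
    ring
  rw [h1]
  exact sub_mem (add_mem (Ideal.mul_mem_right _ _ (Ideal.mul_mem_mul hX hX))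
    (Ideal.mul_mem_right _ _ (Ideal.mul_mem_mul hX hY)))
    (Ideal.mul_mem_right _ _ (Ideal.mul_mem_mul hY hY))

/-- The embedding of a Weierstrass curve through the origin as a space curve of degree four by the
functions `1`, `X`, `Y`, `Y / X`. The function `Y / X` has a simple pole in the second point with
`X = 0`, if this is different from the origin; in the origin the values follow from
`Y (Y + a₁ X + a₃) = X (X² + a₂ X + a₄)`. -/
noncomputable def pointVectorOrigin {W : WeierstrassCurve.Affine ℝ} : W.Point → Fin 4 → ℝ
  | .zero => ![0, 0, 1, 0]
  | .some x y _ => if x = 0 then if y = 0 then ![W.a₃, 0, 0, W.a₄] else ![0, 0, 0, 1]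
      else ![1, x, y, y / x]

/-- Points whose sum is the negative of the origin `T` are, together with `T`, the zeros of a
combination of `X`, `X²`, `XY` and `Y`. Division by `X` shows that they are the intersection of the
space curve with a plane. If `T` is one of the four points, the function vanishes of second order in
`T`. -/
theorem exists_dotProduct_pointVectorOrigin {W : WeierstrassCurve.Affine ℝ} (h0 : W.Nonsingular 0 0)
    (g : Fin 4 → W.Point) (hg : Point.some 0 0 h0 + ∑ k, g k = 0) :
    ∃ a : Fin 4 → ℝ, a ≠ 0 ∧ (∀ k, a ⬝ᵥ pointVectorOrigin (g k) = 0) ∧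
      ∀ P, a ⬝ᵥ pointVectorOrigin P = 0 → ∃ k, P = g k := by
  set s : Multiset W.Point := Finset.univ.val.map g with hsdef
  obtain ⟨T, hT⟩ : ∃ T, T = Point.some 0 0 h0 := ⟨_, rfl⟩
  have hs : (T ::ₘ s).sum = 0 := by rw [Multiset.sum_cons, hT]; exact hg
  have hT0 : T ≠ 0 := hT ▸ Point.some_ne_zero h0
  obtain ⟨f, hf0, hf⟩ := Point.exists_span_eq hs
  have hdeg := Point.natDegree_norm hf
  obtain ⟨p, q, rfl⟩ := exists_smul_basis_eq f
  rw [smul_basis_eq_mk] at hf hdeg hf0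
  rw [Multiset.map_cons, Multiset.sum_cons, Multiset.map_map,
    Point.natDegree_linearFactor hT0] at hdeg
  change _ = 1 + ∑ k, (g k).linearFactor.natDegree at hdeg
  rw [Multiset.map_cons, Multiset.prod_cons] at hf
  have hle : ∀ P : W.Point, P.linearFactor.natDegree ≤ 1 := by
    intro P
    by_cases hP : P = 0
    · rw [hP, Point.natDegree_linearFactor_zero]; exact zero_le_one
    · rw [Point.natDegree_linearFactor hP]
  have h6 := a₆_eq_zero_of_nonsingular h0
  have hfT : mk W (C p + C q * Y) ∈ T.ideal * (s.map Point.ideal).prod := by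
    rw [hf]; exact Ideal.mem_span_singleton_self _
  have hdvd : ∀ k, (s.map Point.ideal).prod ≤ (g k).ideal := by
    intro k
    refine Ideal.le_of_dvd (Multiset.dvd_prod ?_)
    rw [Multiset.map_map]
    exact Multiset.mem_map_of_mem _ (Finset.mem_univ k)
  have h5 := natDegree_le_of_natDegree_norm_le (n := 5) (p := p) (q := q) (by
    rw [hdeg]
    have := Finset.sum_le_sum fun k (_ : k ∈ Finset.univ) => hle (g k)
    simp at this
    omega)
  have hq := eq_of_natDegree_le (p := q) (n := 1) (by
    by_cases hq0 : q = 0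
    · simp [hq0]
    · have := h5.2 hq0; omega) (by norm_num)
  have hq2 : q.coeff 2 = 0 := coeff_eq_zero_of_natDegree_lt (by
    by_cases hq0 : q = 0
    · simp [hq0]
    · have := h5.2 hq0; omega)
  have hp := eq_of_natDegree_le (p := p) (n := 2) (by omega) le_rfl
  have hval : ∀ x y (h : W.Nonsingular x y), mk W (C p + C q * Y) ∈ (Point.some x y h).ideal ↔
      p.coeff 0 + p.coeff 1 * x + p.coeff 2 * x ^ 2 + (q.coeff 0 + q.coeff 1 * x) * y = 0 := by
    intro x y h
    change _ ∈ XYIdeal W x (C y) ↔ _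
    rw [mem_XYIdeal_iff h.1, evalHom_apply]
    conv_lhs => rw [hp, hq, hq2]
    simp
  have hp0 : p.coeff 0 = 0 := by
    have h1 : mk W (C p + C q * Y) ∈ T.ideal :=
      (Ideal.mul_le_left : T.ideal * (s.map Point.ideal).prod ≤ T.ideal) hfT
    rw [hT, hval] at h1
    simpa using h1
  set a : Fin 4 → ℝ := ![p.coeff 1, p.coeff 2, q.coeff 1, q.coeff 0] with ha
  have hmem : ∀ x y (h : W.Nonsingular x y), (x ≠ 0 ∨ y ≠ 0) →
      (a ⬝ᵥ pointVectorOrigin (Point.some x y h) = 0 ↔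
        mk W (C p + C q * Y) ∈ (Point.some x y h).ideal) := by
    intro x y h hxy
    rw [hval]
    by_cases hx : x = 0
    · have hy := hxy.resolve_left (not_not.2 hx)
      simp [pointVectorOrigin, hx, hy, hp0, ha, dotProduct, Fin.sum_univ_four]
    · simp only [pointVectorOrigin, hx, if_false, hp0, ha, dotProduct, Fin.sum_univ_four]
      simp [-mul_eq_zero]
      rw [← mul_eq_zero_iff_left hx]
      field_simp
      constructor <;> intro h <;> linear_combination h
  have hmemT : a ⬝ᵥ pointVectorOrigin T = 0 ↔
      mk W (C p + C q * Y) ∈ T.ideal * T.ideal := by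
    have h1 : a ⬝ᵥ pointVectorOrigin T = W.a₃ * p.coeff 1 + W.a₄ * q.coeff 0 := by
      simp [pointVectorOrigin, hT, ha, dotProduct, Fin.sum_univ_four, mul_comm]
    rw [h1, hT]
    exact ⟨mem_sq_of_derivative_eq_zero h0 hp0, derivative_eq_zero_of_mem_sq h0⟩
  have hzero : a ⬝ᵥ pointVectorOrigin (0 : W.Point) = q.coeff 1 := by
    change _ ⬝ᵥ ![0, 0, 1, 0] = _
    simp [ha, dotProduct, Fin.sum_univ_four]
  refine ⟨a, fun h0 => hf0 ?_, fun k => ?_, fun P hP => ?_⟩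
  · have h1 := congrFun h0 0
    have h2 := congrFun h0 1
    have h3 := congrFun h0 2
    have h4 := congrFun h0 3
    simp [ha] at h1 h2 h3 h4
    rw [hp, hq, hq2, hp0, h1, h2, h3, h4]; simp
  · by_cases hk : g k = 0
    · rw [hk, hzero]
      have h4 := natDegree_le_of_natDegree_norm_le (n := 4) (p := p) (q := q) (by
        rw [hdeg, ← Finset.add_sum_erase _ _ (Finset.mem_univ k), hk,
          Point.natDegree_linearFactor_zero, zero_add]
        have : ∑ j ∈ Finset.univ.erase k, (g j).linearFactor.natDegree ≤ 3 :=
          (Finset.sum_le_sum fun j _ => hle (g j)).trans (by simp)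
        omega)
      exact coeff_eq_zero_of_natDegree_lt (by
        by_cases hq0 : q = 0
        · simp [hq0]
        · have := h4.2 hq0; omega)
    · by_cases hkT : g k = T
      · rw [hkT, hmemT]
        have h1 := hdvd k
        rw [hkT] at h1
        exact Ideal.mul_mono_right h1 hfT
      · have h1 : mk W (C p + C q * Y) ∈ (g k).ideal := hdvd k
          ((Ideal.mul_le_right : T.ideal * (s.map Point.ideal).prod ≤ _) hfT)
        generalize hgk : g k = P at *
        rcases P with _ | ⟨x, y, h⟩
        · exact absurd rfl hk
        · refine (hmem x y h ?_).2 h1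
          by_contra! hxy
          obtain ⟨rfl, rfl⟩ := hxy
          exact hkT hT.symm
  · by_cases hP0 : P = 0
    · rw [hP0, hzero] at hP
      by_contra! hne
      have h1 : ∀ k, (g k).linearFactor.natDegree = 1 := fun k =>
        Point.natDegree_linearFactor fun h0 => hne k (hP0.trans h0.symm)
      rw [hq2, hP] at hq
      simp only [map_zero, zero_mul, add_zero] at hq
      have h3 := natDegree_norm_le (W := W) (n := 4) (p := p) (q := q) (by omega) (fun h0 => by
        rw [hq, natDegree_C]; norm_num)
      rw [hdeg] at h3
      simp [h1] at h3
    by_cases hPT : P = T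
    · rw [hPT, hmemT] at hP
      have h1 : (s.map Point.ideal).prod ≤ T.ideal := by
        have h2 : Ideal.span {algebraMap ℝ[X] W.CoordinateRing T.linearFactor} *
            (s.map Point.ideal).prod ≤
              Ideal.span {algebraMap ℝ[X] W.CoordinateRing T.linearFactor} * T.ideal := by
          rw [← Point.ideal_mul_map_conj, mul_right_comm, hf, mul_right_comm]
          exact Ideal.mul_mono_left ((Ideal.span_singleton_le_iff_mem _).2 hP)
        have h3 : algebraMap ℝ[X] W.CoordinateRing T.linearFactor ≠ 0 := by
          rw [hT]; exact XClass_ne_zero 0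
        exact (Ideal.span_singleton_mul_right_mono h3).1 h2
      obtain ⟨k, -, hk⟩ := Multiset.mem_map.1 (Point.mem_of_mem_ideal hT0 h1)
      exact ⟨k, hPT.trans hk.symm⟩
    · have h1 : mk W (C p + C q * Y) ∈ P.ideal := by
        rcases P with _ | ⟨x, y, h⟩
        · exact absurd rfl hP0
        · refine (hmem x y h ?_).1 hP
          by_contra! hxy
          obtain ⟨rfl, rfl⟩ := hxy
          exact hPT hT.symm
      have h2 : ((T ::ₘ s).map Point.ideal).prod ≤ P.ideal := by
        rw [Multiset.map_cons, Multiset.prod_cons, hf]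
        exact (Ideal.span_singleton_le_iff_mem _).2 h1
      have h3 := Point.mem_of_mem_ideal hP0 h2
      rw [Multiset.mem_cons] at h3
      obtain ⟨k, -, hk⟩ := Multiset.mem_map.1 (h3.resolve_left hPT)
      exact ⟨k, hk.symm⟩

/-- Grids on the curve `YW = ZX`, `ZY + a₁YW + a₃ZW = X² + a₂XW + a₄W²`. The points are those of a
Weierstrass curve, and the sum of four coplanar points is the negative of the point with
`X = Y = 0`. -/
theorem CubePair.hasGrid_of_weierstrass {Q F G : QuadraticForm ℝ U} {O O' : Fin 4 → Bool → U}
    {i l : Fin 4} (h : CubePair F G O O' i l) {α β : ℝ}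
    (hαβ : α ≠ 0 ∨ β ≠ 0) (hQ : Q = α • F + β • G) (e : (Fin 4 → ℝ) ≃ₗ[ℝ] U)
    (a₁ a₂ a₃ a₄ : ℝ) (h34 : a₃ ≠ 0 ∨ a₄ ≠ 0) (hF : ∀ c, F (e c) = c 2 * c 0 - c 3 * c 1)
    (hG : ∀ c, G (e c) = c 3 * c 2 + a₁ * c 2 * c 0 + a₃ * c 3 * c 0 -
      (c 1 ^ 2 + a₂ * c 1 * c 0 + a₄ * c 0 ^ 2)) : HasGrid Q O O' i l := by
  set W : WeierstrassCurve.Affine ℝ := ⟨a₁, a₂, a₃, a₄, 0⟩ with hW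
  have hns : ∀ x y, W.Nonsingular x y ↔ y ^ 2 + a₁ * x * y + a₃ * y =
      x ^ 3 + a₂ * x ^ 2 + a₄ * x ∧ (a₁ * y - (3 * x ^ 2 + 2 * a₂ * x + a₄) ≠ 0 ∨
        2 * y + a₁ * x + a₃ ≠ 0) := by
    intro x y
    rw [nonsingular_iff', equation_iff, hW]
    simp only [add_zero]
  have h0 : W.Nonsingular 0 0 := by
    rw [hns]
    simpa [or_comm] using h34
  obtain ⟨T, hT⟩ : ∃ T, T = Point.some 0 0 h0 := ⟨_, rfl⟩
  have hcurve : ∀ x y : ℝ, x ≠ 0 → (G (e ![1, x, y, y / x]) = 0 ↔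
      y ^ 2 + a₁ * x * y + a₃ * y = x ^ 3 + a₂ * x ^ 2 + a₄ * x) := by
    intro x y hx
    rw [hG]
    simp [-mul_eq_zero]
    rw [← mul_eq_zero_iff_left hx]
    field_simp
    constructor <;> intro h <;> linear_combination h
  have hsm : ∀ x y, x ≠ 0 → y ^ 2 + a₁ * x * y + a₃ * y = x ^ 3 + a₂ * x ^ 2 + a₄ * x →
      (PencilSmooth F G (e ![1, x, y, y / x]) ↔ W.Nonsingular x y) := by
    intro x y hx hxy
    rw [hns]
    obtain ⟨z, hz⟩ : ∃ z, z = y / x := ⟨_, rfl⟩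
    have hzx : z * x = y := by rw [hz]; field_simp
    rw [← hz]
    have hz2 : z * y + a₁ * y + a₃ * z = x ^ 2 + a₂ * x + a₄ := by
      refine mul_right_cancel₀ hx ?_
      linear_combination hxy + (y + a₃) * hzx
    constructor
    · intro hs
      refine ⟨hxy, ?_⟩
      by_contra! h0
      have h1 : 2 * z * x + a₁ * x + a₃ = 0 := by linear_combination h0.2 + 2 * hzx
      have h2 : z * (z + a₁) - 2 * x - a₂ = 0 := by
        refine (mul_eq_zero.1 (?_ : _ * x = 0)).resolve_right hx
        linear_combination z * h1 - hz2 + h0.1 - z * hzx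
      have := hs (-(z + a₁)) 1 fun u => by
        obtain ⟨d, rfl⟩ := e.surjective u
        rw [polar_equiv e hF, polar_equiv e hG]
        simp
        linear_combination d 1 * h2 + d 3 * (h1 - hzx) +
          d 0 * (2 * (z + a₁) * hzx + 2 * hz2 - x * h2 - z * (h1 - hzx))
      exact one_ne_zero this.2
    · rintro ⟨-, h0⟩ α β hs
      have h1 := hs (e ![0, 0, 0, 1])
      have h2 := hs (e ![0, 1, 0, 0])
      have h3 := hs (e ![0, 0, 1, 0])
      rw [polar_equiv e hF, polar_equiv e hG] at h1 h2 h3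
      simp [-mul_eq_zero] at h1 h2 h3
      have hb : β = 0 := by
        rcases h0 with h0 | h0
        · refine (mul_eq_zero.1 (?_ : β * _ = 0)).resolve_right h0
          linear_combination x * h2 - z * h1 + β * hz2
        · refine (mul_eq_zero.1 (?_ : β * _ = 0)).resolve_right h0
          linear_combination h1 + x * h3 - β * hzx
      refine ⟨?_, hb⟩
      rw [hb] at h3
      linear_combination h3
  refine h.hasGrid_of_parametrization hαβ hQ (fun P : W.Point => e (pointVectorOrigin P)) (-T)
    ?_ ?_ ?_ ?_ ?_ ?_
  · rintro (_ | ⟨x, y, hxy⟩)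
    · simp [hF, pointVectorOrigin]
    · by_cases hx : x = 0
      · by_cases hy : y = 0 <;> simp [hF, pointVectorOrigin, hx, hy]
      · simp [hF, pointVectorOrigin, hx]
  · rintro (_ | ⟨x, y, hxy⟩)
    · simp [hG, pointVectorOrigin]
    · by_cases hx : x = 0
      · by_cases hy : y = 0
        · simp [hG, pointVectorOrigin, hx, hy, hW]; ring
        · simp [hG, pointVectorOrigin, hx, hy]
      · simp only [pointVectorOrigin, hx, if_false]
        exact (hcurve x y hx).2 ((hns x y).1 hxy).1
  · rintro (_ | ⟨x, y, hxy⟩)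
    · intro α β hs
      have h1 := hs (e ![1, 0, 0, 0])
      have h2 := hs (e ![0, 0, 0, 1])
      rw [polar_equiv e hF, polar_equiv e hG] at h1 h2
      simp [pointVectorOrigin] at h1 h2
      rw [h2] at h1
      exact ⟨by linear_combination h1, h2⟩
    · by_cases hx : x = 0
      · by_cases hy : y = 0
        · intro α β hs
          have h1 := hs (e ![0, 0, 0, 1])
          have h2 := hs (e ![0, 1, 0, 0])
          have h3 := hs (e ![0, 0, 1, 0])
          rw [polar_equiv e hF, polar_equiv e hG] at h1 h2 h3
          simp [pointVectorOrigin, hx, hy, hW, -mul_eq_zero] at h1 h2 h3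
          by_cases h3' : a₃ = 0
          · have h4' : a₄ ≠ 0 := h34.resolve_left (not_not.2 h3')
            rw [h3'] at h1 h2 h3
            exact ⟨(mul_eq_zero.1 (by linear_combination -h2 : α * a₄ = 0)).resolve_right h4',
              (mul_eq_zero.1 (by linear_combination h3 : β * a₄ = 0)).resolve_right h4'⟩
          · have hb : β = 0 :=
              (mul_eq_zero.1 (by linear_combination h1 : β * a₃ ^ 2 = 0)).resolve_right
                (pow_ne_zero 2 h3')
            rw [hb] at h3
            exact ⟨(mul_eq_zero.1 (by linear_combination h3 : α * a₃ = 0)).resolve_right h3', hb⟩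
        · intro α β hs
          have h1 := hs (e ![0, 1, 0, 0])
          have h2 := hs (e ![0, 0, 1, 0])
          rw [polar_equiv e hF, polar_equiv e hG] at h1 h2
          simp [pointVectorOrigin, hx, hy] at h1 h2
          exact ⟨h1, h2⟩
      · have := (hsm x y hx ((hns x y).1 hxy).1).2 hxy
        simpa only [pointVectorOrigin, hx, if_false] using this
  · intro v hFv hGv hs
    obtain ⟨c, rfl⟩ := e.surjective v
    have hc0 : c ≠ 0 := fun h0 => hs.ne_zero (by rw [h0, map_zero])
    rw [hF] at hFv
    have hmem : ∀ (d : Fin 4 → ℝ) (t : ℝ), t ≠ 0 → c = t • d → e d ∈ span ℝ {e c} := by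
      intro d t ht hcd
      rw [mem_span_singleton]
      refine ⟨t⁻¹, ?_⟩
      rw [hcd, ← map_smul, smul_smul, inv_mul_cancel₀ ht, one_smul]
    by_cases hc : c 0 = 0
    · rw [hG] at hGv
      have h31 : c 3 * c 1 = 0 := by rw [hc] at hFv; linear_combination -hFv
      have h1 : c 1 = 0 := by
        rcases mul_eq_zero.1 h31 with h3 | h1
        · refine pow_eq_zero_iff two_ne_zero |>.1 (?_ : c 1 ^ 2 = 0)
          rw [hc, h3] at hGv
          linear_combination -hGv
        · exact h1
      have h32 : c 3 * c 2 = 0 := by rw [hc, h1] at hGv; linear_combination hGv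
      rcases mul_eq_zero.1 h32 with h3 | h2
      · have h4 : c = c 2 • ![0, 0, 1, 0] := by
          ext k; fin_cases k <;> simp [hc, h1, h3]
        have h5 : c 2 ≠ 0 := fun h0 => hc0 (by rw [h4, h0, zero_smul])
        exact ⟨0, hmem _ _ h5 h4⟩
      · have h4 : c = c 3 • ![0, 0, 0, 1] := by
          ext k; fin_cases k <;> simp [hc, h1, h2]
        have h5 : c 3 ≠ 0 := fun h0 => hc0 (by rw [h4, h0, zero_smul])
        have hns' : W.Nonsingular 0 (-a₃) := by
          rw [hns]
          refine ⟨by ring, ?_⟩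
          by_cases h3 : a₃ = 0
          · left
            simpa [h3] using h34
          · right
            intro h6
            apply h3
            linear_combination -h6
        refine ⟨Point.some 0 (-a₃) hns', ?_⟩
        by_cases h3 : a₃ = 0
        · have h4' : a₄ ≠ 0 := h34.resolve_left (not_not.2 h3)
          refine hmem _ (c 3 / a₄) (div_ne_zero h5 h4') ?_
          rw [h4]
          simp [pointVectorOrigin, h3, hW, h4']
        · refine hmem _ (c 3) h5 ?_
          simpa [pointVectorOrigin, h3] using h4
    · set x := (c 0)⁻¹ * c 1 with hx
      set y := (c 0)⁻¹ * c 2 with hy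
      set z := (c 0)⁻¹ * c 3 with hz
      have h1 : ![1, x, y, z] = (c 0)⁻¹ • c := by
        ext k; fin_cases k
        · simp [hc]
        · simp [hx]
        · simp [hy]
        · simp [hz]
      have hc1 : c = c 0 • ![1, x, y, z] := by
        rw [h1, smul_smul, mul_inv_cancel₀ hc, one_smul]
      have hzx : y = z * x := by
        have h2 := hF ((c 0)⁻¹ • c)
        rw [map_smul, QuadraticMap.map_smul, hF, hFv, smul_zero, ← h1] at h2
        simp [-mul_eq_zero] at h2
        linear_combination -h2
      have hGv' : G (e ![1, x, y, z]) = 0 := by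
        rw [h1, map_smul, QuadraticMap.map_smul, hGv, smul_zero]
      have h2 : PencilSmooth F G (e ![1, x, y, z]) := by
        rw [h1, map_smul]; exact hs.of_smul (inv_ne_zero hc)
      by_cases hx0 : x = 0
      · refine ⟨Point.some 0 0 h0, ?_⟩
        have hy0 : y = 0 := by rw [hzx, hx0, mul_zero]
        rw [hG] at hGv'
        have h34' : a₃ * z = a₄ := by
          simp [hx0, hy0, -mul_eq_zero] at hGv'
          linear_combination hGv'
        have h3 : a₃ ≠ 0 := by
          intro h3
          rw [h3, zero_mul] at h34'
          rcases h34 with h | h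
          · exact h h3
          · exact h h34'.symm
        refine hmem _ (c 0 / a₃) (div_ne_zero hc h3) ?_
        rw [hc1]
        simp [pointVectorOrigin, hx0, hy0, hW, ← h34', h3]
        field_simp
      · have hz' : z = y / x := by rw [hzx]; field_simp
        rw [hz'] at hGv' h2 hc1
        have hxy := (hcurve x y hx0).1 hGv'
        refine ⟨Point.some x y ((hsm x y hx0 hxy).1 h2), hmem _ (c 0) hc ?_⟩
        simp only [pointVectorOrigin, hx0, if_false]
        exact hc1
  · intro g hg hli
    obtain ⟨a, ha, h1, -⟩ := exists_dotProduct_pointVectorOrigin h0 g (by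
      rw [hg, hT]; exact add_neg_cancel _)
    exact not_linearIndependent_of_dotProduct ha h1 (LinearIndependent.of_comp e.toLinearMap hli)
  · intro g hg
    have hg' : IsCircuit fun k => pointVectorOrigin (g k) :=
      IsCircuit.of_map e.toLinearMap e.injective hg
    obtain ⟨a, -, h1, h2⟩ := exists_dotProduct_pointVectorOrigin h0
      ![g 0, g 1, g 2, -(T + g 0 + g 1 + g 2)] (by rw [← hT]; simp [Fin.sum_univ_four])
    have hne : ∀ j, 3 ≠ j → g 3 ≠ g j := fun j hj h0 =>
      hj (hg'.injective (congrArg pointVectorOrigin h0))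
    obtain ⟨k, hk⟩ := h2 (g 3) (by
      refine hg'.eq_zero_of_forall_ne (dotProductBilin ℝ ℝ a) 3 fun j hj => ?_
      fin_cases j
      · exact h1 0
      · exact h1 1
      · exact h1 2
      · exact absurd rfl hj)
    fin_cases k
    · exact absurd hk (hne 0 (by decide))
    · exact absurd hk (hne 1 (by decide))
    · exact absurd hk (hne 2 (by decide))
    · rw [Fin.sum_univ_four, hk]; simp

end WeierstrassCurves

/-! ### The group law on a conic -/

section Conics

variable {a : ℝ}

/-- The second point of intersection of the conic `norm m = p * m.re + q * m.im` with the line which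
joins the origin to `δ`. -/
noncomputable def conicPoint (p q : ℝ) (δ : QuadraticAlgebra ℝ a 0) : QuadraticAlgebra ℝ a 0 :=
  ((p * δ.re + q * δ.im) / QuadraticAlgebra.norm δ) • δ

theorem norm_eq (δ : QuadraticAlgebra ℝ a 0) :
    QuadraticAlgebra.norm δ = δ.re ^ 2 - a * δ.im ^ 2 := by
  rw [QuadraticAlgebra.norm_def]; ring

theorem norm_conicPoint (p q : ℝ) {δ : QuadraticAlgebra ℝ a 0} (hδ : QuadraticAlgebra.norm δ ≠ 0) :
    QuadraticAlgebra.norm (conicPoint p q δ) =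
      p * (conicPoint p q δ).re + q * (conicPoint p q δ).im := by
  rw [norm_eq]
  simp only [conicPoint, QuadraticAlgebra.re_smul, QuadraticAlgebra.im_smul, smul_eq_mul]
  field_simp
  rw [norm_eq]
  ring

theorem conicPoint_smul (p q : ℝ) (δ : QuadraticAlgebra ℝ a 0) {c : ℝ} (hc : c ≠ 0) :
    conicPoint p q (c • δ) = conicPoint p q δ := by
  have h : QuadraticAlgebra.norm (c • δ) = c ^ 2 * QuadraticAlgebra.norm δ := by
    simp [norm_eq]; ring
  simp only [conicPoint, h, QuadraticAlgebra.re_smul, QuadraticAlgebra.im_smul, smul_eq_mul,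
    smul_smul]
  congr 1
  by_cases h0 : QuadraticAlgebra.norm δ = 0
  · simp [h0]
  · field_simp

/-- The direction of the chord which joins the points in the directions `δ` and `ε` is the product
`δ ε (q + p √a)`, up to a scalar factor. -/
theorem conicPoint_sub (p q : ℝ) {δ ε : QuadraticAlgebra ℝ a 0}
    (hδ : QuadraticAlgebra.norm δ ≠ 0) (hε : QuadraticAlgebra.norm ε ≠ 0) :
    conicPoint p q δ - conicPoint p q ε = ((δ.im * ε.re - ε.im * δ.re) /
      (QuadraticAlgebra.norm δ * QuadraticAlgebra.norm ε)) • (δ * ε * ⟨q, p⟩) := by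
  ext
  · simp [conicPoint]
    field_simp
    simp only [norm_eq]
    ring
  · simp [conicPoint]
    field_simp
    simp only [norm_eq]
    ring

/-- If the conic is not degenerate, all its points lie on lines through the origin whose directions
have a norm different from zero; the origin itself belongs to the direction of the tangent. -/
theorem exists_conicPoint {p q : ℝ}
    (h : QuadraticAlgebra.norm (⟨q, p⟩ : QuadraticAlgebra ℝ a 0) ≠ 0)
    {m : QuadraticAlgebra ℝ a 0} (hm : QuadraticAlgebra.norm m = p * m.re + q * m.im) :
    ∃ δ, QuadraticAlgebra.norm δ ≠ 0 ∧ conicPoint p q δ = m := by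
  by_cases hN : QuadraticAlgebra.norm m = 0
  · have hm0 : m = 0 := by
      rw [hN] at hm
      rw [norm_eq] at h hN
      simp only at h
      ext
      · refine pow_eq_zero_iff two_ne_zero |>.1 ((mul_eq_zero.1
          (?_ : (q ^ 2 - a * p ^ 2) * m.re ^ 2 = 0)).resolve_left h)
        linear_combination q ^ 2 * hN + a * (p * m.re - q * m.im) * hm
      · refine pow_eq_zero_iff two_ne_zero |>.1 ((mul_eq_zero.1
          (?_ : (q ^ 2 - a * p ^ 2) * m.im ^ 2 = 0)).resolve_left h)
        linear_combination p ^ 2 * hN + (p * m.re - q * m.im) * hm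
    refine ⟨⟨q, -p⟩, ?_, ?_⟩
    · rw [norm_eq] at h ⊢
      simpa using h
    · rw [hm0, conicPoint]
      simp only
      rw [show p * q + q * -p = 0 by ring, zero_div, zero_smul]
  · refine ⟨m, hN, ?_⟩
    rw [conicPoint, ← hm, div_self hN, one_smul]

/-- The group of the directions of lines through the origin of a conic: the units of the algebra
`ℝ[√a]`, which are its elements with norm different from zero, modulo the real numbers. -/
abbrev DirectionGroup (a : ℝ) : Type :=
  (QuadraticAlgebra ℝ a 0)ˣ ⧸
    (Units.map (algebraMap ℝ (QuadraticAlgebra ℝ a 0)).toMonoidHom).range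

theorem directionGroup_mk_eq {u v : (QuadraticAlgebra ℝ a 0)ˣ} :
    (u : DirectionGroup a) = v ↔ ∃ c : ℝ, c ≠ 0 ∧ (v : QuadraticAlgebra ℝ a 0) = c • u := by
  rw [QuotientGroup.eq, MonoidHom.mem_range]
  constructor
  · rintro ⟨c, hc⟩
    refine ⟨c, c.ne_zero, ?_⟩
    have : v = u * Units.map (algebraMap ℝ (QuadraticAlgebra ℝ a 0)).toMonoidHom c := by
      rw [hc, mul_inv_cancel_left]
    rw [this, Units.val_mul, Units.coe_map, Algebra.smul_def, mul_comm]
    rfl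
  · rintro ⟨c, hc, h⟩
    refine ⟨Units.mk0 c hc, ?_⟩
    rw [eq_inv_mul_iff_mul_eq]
    ext1
    rw [h, Units.val_mul, Units.coe_map, Algebra.smul_def, mul_comm]
    rfl

theorem norm_unit_ne_zero (u : (QuadraticAlgebra ℝ a 0)ˣ) :
    QuadraticAlgebra.norm (u : QuadraticAlgebra ℝ a 0) ≠ 0 :=
  (QuadraticAlgebra.isUnit_iff_norm_isUnit.1 u.isUnit).ne_zero

theorem exists_unit_of_norm_ne_zero {δ : QuadraticAlgebra ℝ a 0} (h : QuadraticAlgebra.norm δ ≠ 0) :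
    ∃ u : (QuadraticAlgebra ℝ a 0)ˣ, (u : QuadraticAlgebra ℝ a 0) = δ :=
  QuadraticAlgebra.isUnit_iff_norm_isUnit.2 (isUnit_iff_ne_zero.2 h)

/-- The vector of a point in one of the planes `x₀ = 0` and `x₃ = 0`. -/
def planeVector (t : Bool) (m : QuadraticAlgebra ℝ a 0) : Fin 4 → ℝ :=
  ![if t then 0 else 1, m.re, m.im, if t then 1 else 0]

/-- The parametrisation of the two conics `x₃ = 0`, `x₁² - a x₂² = x₂` and `x₀ = 0`,
`x₁² - a x₂² = p x₁ + q x₂`. The sign of the parameter is reversed in the second plane. Then the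
condition that two chords in different planes have the same direction, so that they meet on the line
`x₀ = x₃ = 0`, becomes a condition for the sum of the four parameters. -/
noncomputable def conicVector (p q : ℝ) (t : Bool) (g : Additive (DirectionGroup a)) :
    Fin 4 → ℝ :=
  planeVector t (conicPoint (if t then p else 0) (if t then q else 1)
    ((if t then -g else g).toMul.out : QuadraticAlgebra ℝ a 0))

/-- The equality of the directions of two chords, one of each conic, in terms of the parameters. -/
theorem sum_eq_ofMul_iff {u : (QuadraticAlgebra ℝ a 0)ˣ}
    {g : Fin 4 → Additive (DirectionGroup a)} {i j k l : Fin 4} (hij : i ≠ j) (hik : i ≠ k)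
    (hil : i ≠ l) (hjk : j ≠ k) (hjl : j ≠ l) (hkl : k ≠ l) :
    ∑ k, g k = Additive.ofMul (u : DirectionGroup a) ↔ ∃ c : ℝ, c ≠ 0 ∧
      ((-g k).toMul.out * (-g l).toMul.out * u : QuadraticAlgebra ℝ a 0) =
        c • ((g i).toMul.out * (g j).toMul.out : QuadraticAlgebra ℝ a 0) := by
  have hmk : ∀ g : Additive (DirectionGroup a),
    Additive.ofMul (g.toMul.out : DirectionGroup a) = g :=
    fun g => congrArg Additive.ofMul (QuotientGroup.out_eq' g.toMul)
  have h1 : ∀ x y z w : (QuadraticAlgebra ℝ a 0)ˣ,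
      ((x * y : (QuadraticAlgebra ℝ a 0)ˣ) : DirectionGroup a) =
        (z * w * u : (QuadraticAlgebra ℝ a 0)ˣ) ↔
      Additive.ofMul (x : DirectionGroup a) + Additive.ofMul (y : DirectionGroup a) =
        Additive.ofMul (z : DirectionGroup a) + Additive.ofMul (w : DirectionGroup a) +
          Additive.ofMul (u : DirectionGroup a) := fun x y z w => Iff.rfl
  rw [sum_four hij hik hil hjk hjl hkl, ← Units.val_mul, ← Units.val_mul, ← Units.val_mul,
    ← directionGroup_mk_eq, h1, hmk, hmk, hmk, hmk]
  constructor <;> intro h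
  · rw [← h]; abel
  · rw [← sub_eq_zero] at h ⊢
    rw [← h]; abel

/-- Two points of each conic are coplanar if the chords in the two planes have the same direction.
-/
theorem not_linearIndependent_conicVector {p q : ℝ} (u : (QuadraticAlgebra ℝ a 0)ˣ)
    (hu : (u : QuadraticAlgebra ℝ a 0) = ⟨q, p⟩) {σ : Fin 4 → Bool}
    {g : Fin 4 → Additive (DirectionGroup a)} {i j k l : Fin 4} (hij : i ≠ j) (hik : i ≠ k)
    (hil : i ≠ l) (hjk : j ≠ k) (hjl : j ≠ l) (hkl : k ≠ l) (hi : σ i = false) (hj : σ j = false)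
    (hk : σ k = true) (hl : σ l = true) (hg : ∑ k, g k = Additive.ofMul (u : DirectionGroup a)) :
    ¬ LinearIndependent ℝ fun k => conicVector p q (σ k) (g k) := by
  obtain ⟨c, hc, huc⟩ := (sum_eq_ofMul_iff hij hik hil hjk hjl hkl).1 hg
  set δi := (g i).toMul.out
  set δj := (g j).toMul.out
  set δk := (-g k).toMul.out
  set δl := (-g l).toMul.out
  -- the common direction of the chords in the two planes
  obtain ⟨v, hv⟩ : ∃ v : QuadraticAlgebra ℝ a 0, v = δi * δj := ⟨_, rfl⟩
  have hv0 : v ≠ 0 := by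
    intro h0
    have := norm_unit_ne_zero (δi * δj)
    rw [Units.val_mul, ← hv, h0, QuadraticAlgebra.norm_zero] at this
    exact this rfl
  obtain ⟨s, hs⟩ : ∃ s : ℝ, conicPoint 0 1 (δi : QuadraticAlgebra ℝ a 0) -
      conicPoint 0 1 (δj : QuadraticAlgebra ℝ a 0) = s • v := by
    have h1 := conicPoint_sub 0 1 (norm_unit_ne_zero δi) (norm_unit_ne_zero δj)
    rw [show (⟨1, 0⟩ : QuadraticAlgebra ℝ a 0) = 1 from rfl, mul_one, ← hv] at h1
    exact ⟨_, h1⟩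
  obtain ⟨t, ht⟩ : ∃ t : ℝ, conicPoint p q (δk : QuadraticAlgebra ℝ a 0) -
      conicPoint p q (δl : QuadraticAlgebra ℝ a 0) = t • v := by
    have h1 := conicPoint_sub p q (norm_unit_ne_zero δk) (norm_unit_ne_zero δl)
    rw [← hu, huc, smul_smul, ← hv] at h1
    exact ⟨_, h1⟩
  set mi := conicPoint 0 1 (δi : QuadraticAlgebra ℝ a 0) with hmi
  set mj := conicPoint 0 1 (δj : QuadraticAlgebra ℝ a 0) with hmj
  set mk := conicPoint p q (δk : QuadraticAlgebra ℝ a 0) with hmk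
  set ml := conicPoint p q (δl : QuadraticAlgebra ℝ a 0) with hml
  have hs1 := congrArg QuadraticAlgebra.re hs
  have hs2 := congrArg QuadraticAlgebra.im hs
  have ht1 := congrArg QuadraticAlgebra.re ht
  have ht2 := congrArg QuadraticAlgebra.im ht
  simp only [QuadraticAlgebra.re_sub, QuadraticAlgebra.im_sub, QuadraticAlgebra.re_smul,
    QuadraticAlgebra.im_smul, smul_eq_mul] at hs1 hs2 ht1 ht2
  refine not_linearIndependent_of_dotProduct
    (a := ![v.im * mi.re - v.re * mi.im, -v.im, v.re, v.im * mk.re - v.re * mk.im])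
    (fun h0 => hv0 ?_) fun m => ?_
  · have h1 := congrFun h0 1
    have h2 := congrFun h0 2
    ext
    · simpa using h2
    · simpa using h1
  · have hcov : m = i ∨ m = j ∨ m = k ∨ m = l := by
      clear * - hij hik hil hjk hjl hkl
      revert i j k l m; decide
    rcases hcov with rfl | rfl | rfl | rfl
    · simp only [conicVector, planeVector, hi, Bool.false_eq_true, if_false, dotProduct,
        Fin.sum_univ_four]
      simp; ring
    · simp only [conicVector, planeVector, hj, Bool.false_eq_true, if_false, dotProduct,
        Fin.sum_univ_four]
      simp
      linear_combination v.im * hs1 - v.re * hs2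
    · simp only [conicVector, planeVector, hk, if_true, dotProduct,
        Fin.sum_univ_four]
      simp [-toMul_neg]; ring
    · simp only [conicVector, planeVector, hl, if_true, dotProduct,
        Fin.sum_univ_four]
      simp [-toMul_neg]
      linear_combination v.im * ht1 - v.re * ht2

/-- If two points of each conic form a circuit, the chords in the two planes meet on the line
`x₀ = x₃ = 0`, that is, they have the same direction. -/
theorem sum_eq_of_isCircuit_conicVector {p q : ℝ} (u : (QuadraticAlgebra ℝ a 0)ˣ)
    (hu : (u : QuadraticAlgebra ℝ a 0) = ⟨q, p⟩) {σ : Fin 4 → Bool}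
    {g : Fin 4 → Additive (DirectionGroup a)} {i j k l : Fin 4} (hij : i ≠ j) (hik : i ≠ k)
    (hil : i ≠ l) (hjk : j ≠ k) (hjl : j ≠ l) (hkl : k ≠ l) (hi : σ i = false) (hj : σ j = false)
    (hk : σ k = true) (hl : σ l = true)
    (hc : IsCircuit fun k => conicVector p q (σ k) (g k)) :
    ∑ k, g k = Additive.ofMul (u : DirectionGroup a) := by
  obtain ⟨c, hc0, hsum⟩ := hc.exists_rel_ne
  refine (sum_eq_ofMul_iff hij hik hil hjk hjl hkl).2 ?_
  have hne1 : conicVector p q (σ i) (g i) ≠ conicVector p q (σ j) (g j) := fun h =>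
    hij (hc.injective h)
  have hne2 : conicVector p q (σ k) (g k) ≠ conicVector p q (σ l) (g l) := fun h =>
    hkl (hc.injective h)
  rw [sum_four hij hik hil hjk hjl hkl] at hsum
  simp only [conicVector, hi, hj, hk, hl, Bool.false_eq_true, if_false, if_true] at hsum hne1 hne2
  set δi := (g i).toMul.out
  set δj := (g j).toMul.out
  set δk := (-g k).toMul.out
  set δl := (-g l).toMul.out
  have h1 := conicPoint_sub 0 1 (norm_unit_ne_zero δi) (norm_unit_ne_zero δj)
  have h2 := conicPoint_sub p q (norm_unit_ne_zero δk) (norm_unit_ne_zero δl)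
  set mi := conicPoint 0 1 (δi : QuadraticAlgebra ℝ a 0) with hmi
  set mj := conicPoint 0 1 (δj : QuadraticAlgebra ℝ a 0) with hmj
  set mk := conicPoint p q (δk : QuadraticAlgebra ℝ a 0) with hmk
  set ml := conicPoint p q (δl : QuadraticAlgebra ℝ a 0) with hml
  rw [show (⟨1, 0⟩ : QuadraticAlgebra ℝ a 0) = 1 from rfl, mul_one] at h1
  rw [← hu] at h2
  obtain ⟨s, hs⟩ : ∃ s : ℝ, s = (δi.1.im * δj.1.re - δj.1.im * δi.1.re) /
    (QuadraticAlgebra.norm δi.1 * QuadraticAlgebra.norm δj.1) := ⟨_, rfl⟩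
  obtain ⟨t, ht⟩ : ∃ t : ℝ, t = (δk.1.im * δl.1.re - δl.1.im * δk.1.re) /
    (QuadraticAlgebra.norm δk.1 * QuadraticAlgebra.norm δl.1) := ⟨_, rfl⟩
  rw [← hs] at h1
  rw [← ht] at h2
  have hs0 : s ≠ 0 := by
    rintro rfl
    rw [zero_smul, sub_eq_zero] at h1
    exact hne1 (by rw [h1])
  have ht0 : t ≠ 0 := by
    rintro rfl
    rw [zero_smul, sub_eq_zero] at h2
    exact hne2 (by rw [h2])
  have e0 := congrFun hsum 0
  have e1 := congrFun hsum 1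
  have e2 := congrFun hsum 2
  have e3 := congrFun hsum 3
  simp [planeVector] at e0 e1 e2 e3
  have key : c i • (mi - mj) + c k • (mk - ml) = 0 := by
    ext
    · simp
      linear_combination e1 - mj.re * e0 - ml.re * e3
    · simp
      linear_combination e2 - mj.im * e0 - ml.im * e3
  rw [h1, h2, smul_smul, smul_smul] at key
  have hcs : c k * t ≠ 0 := mul_ne_zero (hc0 k) ht0
  refine ⟨-(c i * s) / (c k * t), div_ne_zero (neg_ne_zero.2 (mul_ne_zero (hc0 i) hs0)) hcs, ?_⟩
  rw [div_eq_inv_mul, ← smul_smul, neg_smul, eq_inv_smul_iff₀ hcs, eq_neg_iff_add_eq_zero, add_comm]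
  exact key

end Conics

/-! ### Pairs of conics -/

section ConicPairs

variable {U : Type*} [AddCommGroup U] [Module ℝ U]

/-- No index has a label which is different from all other labels: the labels are all equal, or
there are two of each kind. -/
def IsBalanced (σ : Fin 4 → Bool) : Prop := ∀ k, ∃ j, j ≠ k ∧ σ j = σ k

instance : DecidablePred IsBalanced := fun σ => by unfold IsBalanced; infer_instance

theorem isBalanced_iff (σ : Fin 4 → Bool) :
    IsBalanced σ ↔ (σ 0 ^^ σ 1 ^^ σ 2 ^^ σ 3) = false := by
  revert σ; decide

theorem even_card_iff (σ : Fin 4 → Bool) :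
    Even (Finset.univ.filter fun k => σ k = true).card ↔ (σ 0 ^^ σ 1 ^^ σ 2 ^^ σ 3) = false := by
  revert σ; decide

theorem IsBalanced.exists_pairs {σ : Fin 4 → Bool} (h : IsBalanced σ)
    (h' : ¬ ∀ k j, σ k = σ j) : ∃ i j k l, i ≠ j ∧ i ≠ k ∧ i ≠ l ∧ j ≠ k ∧ j ≠ l ∧ k ≠ l ∧
      σ i = false ∧ σ j = false ∧ σ k = true ∧ σ l = true := by
  revert σ; decide

/-- If every circuit of a cube has an even number of points with `S = true`, then the value of `S`
either changes or does not change between opposite vertices, for all four pairs of opposite vertices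
in the same way; moreover, an even number of the vertices `(k, false)` satisfy `S = true`. -/
theorem exists_xor {S : Fin 4 → Bool → Bool}
    (h : ∀ s, IsVertexLabel s → IsBalanced fun k => S k (s k)) :
    (∃ d, ∀ k, S k true = (S k false ^^ d)) ∧ IsBalanced fun k => S k false := by
  have h01 := (isBalanced_iff _).1 (h ![true, true, false, false] (by decide))
  have h02 := (isBalanced_iff _).1 (h ![true, false, true, false] (by decide))
  have h03 := (isBalanced_iff _).1 (h ![true, false, false, true] (by decide))
  have h12 := (isBalanced_iff _).1 (h ![false, true, true, false] (by decide))
  have h13 := (isBalanced_iff _).1 (h ![false, true, false, true] (by decide))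
  rw [isBalanced_iff]
  simp only [Matrix.cons_val] at h01 h02 h03 h12 h13
  have key : ∀ f0 f1 f2 f3 t0 t1 t2 t3 : Bool, (t0 ^^ t1 ^^ f2 ^^ f3) = false →
      (t0 ^^ f1 ^^ t2 ^^ f3) = false → (t0 ^^ f1 ^^ f2 ^^ t3) = false →
      (f0 ^^ t1 ^^ t2 ^^ f3) = false → (f0 ^^ t1 ^^ f2 ^^ t3) = false →
      (t1 = (f1 ^^ (f0 ^^ t0)) ∧ t2 = (f2 ^^ (f0 ^^ t0)) ∧ t3 = (f3 ^^ (f0 ^^ t0))) ∧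
        (f0 ^^ f1 ^^ f2 ^^ f3) = false := by
    intro f0 f1 f2 f3
    cases f0 <;> cases f1 <;> cases f2 <;> cases f3 <;> decide
  obtain ⟨⟨h1, h2, h3⟩, h4⟩ := key _ _ _ _ _ _ _ _ h01 h02 h03 h12 h13
  refine ⟨⟨S 0 false ^^ S 0 true, fun k => ?_⟩, h4⟩
  fin_cases k
  · simp
  · exact h1
  · exact h2
  · exact h3

/-- The converse of `exists_xor`. For points on two conics and indices of any parities which belong
to a vertex of the grid, it says that the four points lie in one plane, or two of them in each of
the planes. -/
theorem isBalanced_of_even {S : Fin 4 → Bool → Bool} {d : Bool}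
    (hd : ∀ k, S k true = (S k false ^^ d)) (h : IsBalanced fun k => S k false) (e : Fin 4 → Bool)
    (he : Even (Finset.univ.filter fun k => e k = true).card) : IsBalanced fun k => S k (e k) := by
  rw [even_card_iff] at he
  rw [isBalanced_iff] at h ⊢
  have h1 : ∀ k, S k (e k) = (S k false ^^ (d && e k)) := by
    intro k
    cases hk : e k <;> simp [hd]
  simp only [h1]
  have key : ∀ f0 f1 f2 f3 e0 e1 e2 e3 d : Bool, (e0 ^^ e1 ^^ e2 ^^ e3) = false →
      (f0 ^^ f1 ^^ f2 ^^ f3) = false →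
      ((f0 ^^ (d && e0)) ^^ (f1 ^^ (d && e1)) ^^ (f2 ^^ (d && e2)) ^^ (f3 ^^ (d && e3))) =
        false := by
    intro f0 f1 f2 f3
    cases f0 <;> cases f1 <;> cases f2 <;> cases f3 <;> decide
  exact key _ _ _ _ _ _ _ _ _ he h

/-- Grids on a curve which consists of two conics in different planes: one quadric of the pencil is
the pair of the planes `c₀ = 0` and `c₃ = 0`. Four points in the same plane are coplanar for all
values of the parameters. -/
theorem CubePair.hasGrid_of_conics {Q F G : QuadraticForm ℝ U} {O O' : Fin 4 → Bool → U}
    {i l : Fin 4} (h : CubePair F G O O' i l) {α β : ℝ}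
    (hαβ : α ≠ 0 ∨ β ≠ 0) (hQ : Q = α • F + β • G) (e : (Fin 4 → ℝ) ≃ₗ[ℝ] U)
    (a p q : ℝ) (hη : q ^ 2 - a * p ^ 2 ≠ 0) (hF : ∀ c, F (e c) = c 0 * c 3)
    (hG : ∀ c, G (e c) = c 0 * c 2 + c 3 * (p * c 1 + q * c 2) - (c 1 ^ 2 - a * c 2 ^ 2)) :
    HasGrid Q O O' i l := by
  classical
  set side : U → Bool := fun x => decide (e.symm x 0 = 0) with hside
  have hη' : QuadraticAlgebra.norm (⟨q, p⟩ : QuadraticAlgebra ℝ a 0) ≠ 0 := by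
    rw [norm_eq]; exact hη
  obtain ⟨u, hu⟩ := exists_unit_of_norm_ne_zero hη'
  -- a smooth point lies in exactly one of the two planes
  have hplane : ∀ x, F x = 0 → PencilSmooth F G x → ∀ t, side x = t →
      (e.symm x (if t then 0 else 3) = 0 ∧ e.symm x (if t then 3 else 0) ≠ 0) := by
    intro x hx hs t ht
    obtain ⟨c, rfl⟩ := e.surjective x
    rw [e.symm_apply_apply]
    rw [hF] at hx
    have h1 : ¬ (c 0 = 0 ∧ c 3 = 0) := by
      rintro ⟨h0, h3⟩
      have := hs 1 0 fun u => by
        obtain ⟨d, rfl⟩ := e.surjective u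
        rw [polar_equiv e hF]
        simp [h0, h3]
      exact one_ne_zero this.1
    by_cases h0 : c 0 = 0
    · obtain rfl : t = true := by rw [← ht]; simp [hside, h0]
      simpa [h0] using h1
    · obtain rfl : t = false := by rw [← ht]; simp [hside, h0]
      simpa [h0] using hx
  have hvec : ∀ t (m : QuadraticAlgebra ℝ a 0), QuadraticAlgebra.norm m =
      (if t then p else 0) * m.re + (if t then q else 1) * m.im →
      F (e (planeVector t m)) = 0 ∧ G (e (planeVector t m)) = 0 ∧
        PencilSmooth F G (e (planeVector t m)) := by
    intro t m hm
    rw [norm_eq] at hm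
    refine ⟨?_, ?_, fun α β hs => ?_⟩
    · cases t <;> simp [hF, planeVector]
    · rw [hG]
      cases t
      · simp [planeVector] at hm ⊢
        linear_combination -hm
      · simp [planeVector] at hm ⊢
        linear_combination -hm
    · have h0 := hs (e ![1, 0, 0, 0])
      have h1 := hs (e ![0, 1, 0, 0])
      have h2 := hs (e ![0, 0, 1, 0])
      have h3 := hs (e ![0, 0, 0, 1])
      rw [polar_equiv e hF, polar_equiv e hG] at h0 h1 h2 h3
      have hb : β = 0 := by
        cases t
        · simp [planeVector, -mul_eq_zero] at h0 h1 h2 h3 hm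
          linear_combination h2 - 2 * a * h0
        · simp [planeVector, -mul_eq_zero] at h0 h1 h2 h3 hm
          refine (mul_eq_zero.1 (?_ : β * _ = 0)).resolve_right hη
          linear_combination q * h2 - a * p * h1 - 2 * a * h3
      refine ⟨?_, hb⟩
      cases t
      · simp [planeVector, hb] at h3
        exact h3
      · simp [planeVector, hb] at h0
        exact h0
  have hψ : ∀ t g, F (e (conicVector p q t g)) = 0 ∧ G (e (conicVector p q t g)) = 0 ∧
      PencilSmooth F G (e (conicVector p q t g)) := fun t g =>
    hvec t _ (norm_conicPoint _ _ (norm_unit_ne_zero _))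
  have hsurj : ∀ x, ∃ g : Additive (DirectionGroup a), F x = 0 → G x = 0 → PencilSmooth F G x →
      e (conicVector p q (side x) g) ∈ span ℝ {x} := by
    intro x
    by_cases hx : F x = 0 ∧ G x = 0 ∧ PencilSmooth F G x
    swap
    · exact ⟨0, fun h1 h2 h3 => absurd ⟨h1, h2, h3⟩ hx⟩
    obtain ⟨h1, h2, h3⟩ := hx
    obtain ⟨t, ht⟩ : ∃ t, side x = t := ⟨_, rfl⟩
    obtain ⟨h4, h5⟩ := hplane x h1 h3 t ht
    obtain ⟨c, rfl⟩ := e.surjective x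
    rw [e.symm_apply_apply] at h4 h5
    set r := c (if t then 3 else 0) with hr
    set m : QuadraticAlgebra ℝ a 0 := ⟨r⁻¹ * c 1, r⁻¹ * c 2⟩ with hm
    have hcm : planeVector t m = r⁻¹ • c := by
      have hr0 : r⁻¹ * r = 1 := inv_mul_cancel₀ h5
      cases t
      · have h4' : c 3 = 0 := h4
        ext k
        fin_cases k
        · exact hr0.symm
        all_goals simp [planeVector, hm, h4']
      · have h4' : c 0 = 0 := h4
        ext k
        fin_cases k
        pick_goal 4
        · exact hr0.symm
        all_goals simp [planeVector, hm, h4']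
    have hGm : G (e (planeVector t m)) = 0 := by
      rw [hcm, map_smul, QuadraticMap.map_smul, h2, smul_zero]
    have hmN : QuadraticAlgebra.norm m =
        (if t then p else 0) * m.re + (if t then q else 1) * m.im := by
      rw [hG] at hGm
      rw [norm_eq]
      cases t
      · simp [planeVector] at hGm ⊢
        linear_combination -hGm
      · simp [planeVector] at hGm ⊢
        linear_combination -hGm
    obtain ⟨δ, hδ, hδm⟩ := exists_conicPoint (by cases t <;> simp [norm_eq, hη]) hmN
    obtain ⟨v, rfl⟩ := exists_unit_of_norm_ne_zero hδ
    refine ⟨if t then -Additive.ofMul (v : DirectionGroup a) else Additive.ofMul (v : DirectionGroup a),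
      fun _ _ _ => ?_⟩
    rw [ht]
    have h6 : conicVector p q t (if t then -Additive.ofMul (v : DirectionGroup a) else
        Additive.ofMul (v : DirectionGroup a)) = planeVector t m := by
      have h7 : (if t then -(if t then -Additive.ofMul (v : DirectionGroup a) else
        Additive.ofMul (v : DirectionGroup a)) else (if t then -Additive.ofMul (v : DirectionGroup a) else
        Additive.ofMul (v : DirectionGroup a))) = Additive.ofMul (v : DirectionGroup a) := by
        cases t
        · rfl
        · exact neg_neg (Additive.ofMul (v : DirectionGroup a))
      rw [conicVector, h7]
      obtain ⟨c, hc, hcv⟩ := directionGroup_mk_eq.1 (QuotientGroup.out_eq' (v : DirectionGroup a))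
      rw [← hδm, hcv, conicPoint_smul _ _ _ hc]
      rfl
    rw [h6, hcm, map_smul]
    exact smul_mem _ _ (mem_span_singleton_self _)
  choose γ hγ using hsurj
  -- the points of a circuit cannot lie in one of the planes with one exception
  have hbal : ∀ x : Fin 4 → U, IsCircuit x → (∀ k, F (x k) = 0 ∧ PencilSmooth F G (x k)) →
      IsBalanced fun k => side (x k) := by
    intro x hx hs k
    by_contra! hk
    obtain ⟨c, hc, hsum⟩ := hx.exists_rel_ne
    obtain ⟨t, ht⟩ : ∃ t, side (x k) = t := ⟨_, rfl⟩
    have h1 := hplane (x k) (hs k).1 (hs k).2 t ht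
    have h2 := congrArg (fun v => e.symm v (if t then 3 else 0)) hsum
    simp only [map_sum, map_smul, Finset.sum_apply, map_zero, Pi.zero_apply, Pi.smul_apply] at h2
    rw [Finset.sum_eq_single k (fun j _ hj => ?_) (by simp)] at h2
    · exact (mul_ne_zero (hc k) h1.2) h2
    · have h3 : side (x j) = !t := Bool.eq_not_of_ne (by rw [← ht]; exact hk j hj)
      have h4 := (hplane (x j) (hs j).1 (hs j).2 _ h3).1
      rw [smul_eq_mul]
      cases t <;> simpa using Or.inr h4
  have hrel : ∀ x : Fin 4 → U, IsCircuit x → (∀ k, F (x k) = 0 ∧ G (x k) = 0 ∧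
      PencilSmooth F G (x k)) → (¬ ∀ k j, side (x k) = side (x j)) →
      ∑ k, γ (x k) = Additive.ofMul (u : DirectionGroup a) := by
    intro x hx hs hne
    obtain ⟨a, b, c, d, hab, hac, had, hbc, hbd, hcd, ha, hb, hc, hd⟩ :=
      (hbal x hx fun k => ⟨(hs k).1, (hs k).2.2⟩).exists_pairs hne
    have hmem := fun k => hγ (x k) (hs k).1 (hs k).2.1 (hs k).2.2
    choose r hr hy using fun k => exists_smul_of_mem_span (hψ _ _).2.2.ne_zero (hmem k)
    exact sum_eq_of_isCircuit_conicVector (σ := fun k => side (x k)) u hu hab hac had hbc hbd hcd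
      ha hb hc hd (IsCircuit.of_map e.toLinearMap e.injective (hx.smul hr hy))
  have hLs := fun k b => And.intro (h.Q_left k b) (And.intro (h.R_left k b) (h.smooth_left k b))
  have hRs := fun k b => And.intro (h.Q_right k b) (And.intro (h.R_right k b) (h.smooth_right k b))
  obtain ⟨⟨d, hd⟩, hd0⟩ := exists_xor (S := fun k b => side (O k b)) fun s hs =>
    hbal _ (h.left.circuit s hs) fun k => ⟨(hLs k _).1, (hLs k _).2.2⟩
  obtain ⟨⟨d', hd'⟩, -⟩ := exists_xor (S := fun k b => side (O' k b)) fun s hs =>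
    hbal _ (h.right.circuit s hs) fun k => ⟨(hRs k _).1, (hRs k _).2.2⟩
  obtain ⟨c₀, hci, hcl⟩ := exists_ne_ne i l
  have hdd : d' = d := by
    have h1 := hd c₀
    have h2 := hd' c₀
    rw [h.eq_of_ne c₀ hci hcl, h.eq_of_ne c₀ hci hcl, h1] at h2
    simpa using h2.symm
  subst hdd
  -- the distribution of the points to the two planes has period two in the grid
  have hshift : ∀ k (s : Fin 4 → Bool), side (O k (shiftLabel i l s k)) = side (O' k (s k)) := by
    intro k s
    by_cases hk : k = i ∨ k = l
    · have h1 := hd k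
      have h2 := hd' k
      simp only [shiftLabel, hk, if_true]
      rcases hk with rfl | rfl
      · rw [h.eq_i] at h2
        cases hs : s k
        · rw [Bool.not_false, h.eq_i]
        · rw [Bool.not_true, h2, h1]; simp
      · rw [h.eq_l] at h2
        cases hs : s k
        · rw [Bool.not_false, h1, h2]; simp
        · rw [Bool.not_true, h.eq_l]
    · simp only [shiftLabel, hk, if_false]
      rw [not_or] at hk
      rw [h.eq_of_ne k hk.1 hk.2]
  refine hasGrid_of_group h.ne h.eq_i h.eq_l h.eq_of_ne
    (fun k b g => e (conicVector p q (side (O k b)) g))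
    (fun b => ∀ k j, side (O k (b k)) = side (O j (b j))) (Additive.ofMul (u : DirectionGroup a))
    (fun _ => γ) (fun k b g => ⟨?_, (hψ _ _).2.2.exists_polar_ne hαβ hQ⟩) (fun b hb g hg hli => ?_)
    (fun k b => hγ _ (hLs k b).1 (hLs k b).2.1 (hLs k b).2.2)
    (fun k s => ?_)
    (fun s hs hf => hrel _ (h.left.circuit s hs) (fun k => hLs k _) hf)
    (fun s hs hf => hrel _ (h.right.circuit s hs) (fun k => hRs k _) ?_) ?_
  · rw [hQ, _root_.add_apply, _root_.smul_apply, _root_.smul_apply, (hψ _ _).1, (hψ _ _).2.1]; simp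
  · have hli' := LinearIndependent.of_comp e.toLinearMap hli
    have hbal' := isBalanced_of_even (S := fun k b => side (O k b)) hd hd0 b hb
    by_cases hf : ∀ k j, side (O k (b k)) = side (O j (b j))
    · obtain ⟨t, ht⟩ : ∃ t, side (O 0 (b 0)) = t := ⟨_, rfl⟩
      refine not_linearIndependent_of_dotProduct (a := Pi.single (if t then 0 else 3) 1) ?_ ?_ hli'
      · intro h0
        have := congrFun h0 (if t then 0 else 3)
        simp at this
      · intro k
        rw [hf k 0, ht]
        cases t <;> simp [conicVector, planeVector]
    · obtain ⟨a, b, c, d, hab, hac, had, hbc, hbd, hcd, ha, hb, hc, hd⟩ := hbal'.exists_pairs hf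
      exact not_linearIndependent_conicVector u hu hab hac had hbc hbd hcd ha hb hc hd (hg hf) hli'
  · have := hγ _ (hRs k (s k)).1 (hRs k (s k)).2.1 (hRs k (s k)).2.2
    rwa [← hshift k s] at this
  · intro h1
    exact hf fun k j => by rw [hshift, hshift]; exact h1 k j
  · by_contra! hcon
    obtain ⟨c₁, h1i, h1l, h10⟩ := exists_ne_ne_ne i l c₀
    have e1 := fun k j => hcon c₀ hci hcl k j
    have e2 := fun k j => hcon c₁ h1i h1l k j
    have a1 := e1 c₀ i
    have a2 := e2 c₀ i
    have a3 := e1 c₁ i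
    have a4 := e1 l i
    simp only [hcl, h1l, h10, h10.symm, h.ne, hci.symm, h1i.symm, or_self, or_true, true_or,
      decide_true, decide_false, hd] at a1 a2 a3 a4
    have hd0 : d' = false := by
      rw [a2] at a1
      revert a1
      cases side (O i false) <;> cases d' <;> simp
    rw [hd0] at a4 hd
    simp only [Bool.xor_false] at a4 hd
    have hall : ∀ k b, side (O k b) = side (O i false) := by
      intro k b
      have hk : side (O k false) = side (O i false) := by
        have : k = i ∨ k = l ∨ k = c₀ ∨ k = c₁ := by
          have := h.ne
          clear * - this hci hcl h1i h1l h10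
          revert i l c₀ c₁ k; decide
        rcases this with rfl | rfl | rfl | rfl
        · rfl
        · exact a4
        · exact a2
        · exact a3
      cases b
      · exact hk
      · rw [hd, hk]
    -- all points would lie in one of the two planes
    obtain ⟨t, ht⟩ : ∃ t, side (O i false) = t := ⟨_, rfl⟩
    have hφ : (LinearMap.proj (R := ℝ) (φ := fun _ : Fin 4 => ℝ) (if t then 0 else 3)) ∘ₗ
        e.symm.toLinearMap = 0 := by
      refine (h.left.basis h.finrank_eq 0 true).ext fun m => ?_
      rw [h.left.basis_apply]
      exact (hplane _ (hLs m _).1 (hLs m _).2.2 t ((hall m _).trans ht)).1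
    have h5 := congrArg (fun f => f (e (Pi.single (if t then 0 else 3) 1))) hφ
    simp at h5

end ConicPairs

/-! ### Normal forms of curves without lines -/

section NormalForm

variable {U : Type*} [AddCommGroup U] [Module ℝ U] {Q R F G : QuadraticForm ℝ U}
  {O O' : Fin 4 → Bool → U} {i l : Fin 4}

/-- The curve `Q = R = 0` in projective space does not contain a line. -/
def NoLine (Q R : QuadraticForm ℝ U) : Prop :=
  ∀ x y : U, LinearIndependent ℝ ![x, y] →
    ∃ s t : ℝ, ¬ (Q (s • x + t • y) = 0 ∧ R (s • x + t • y) = 0)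

theorem NoLine.change (h : NoLine Q R) {a b c d : ℝ} (hdet : a * d - b * c ≠ 0)
    (hF : F = a • Q + b • R) (hG : G = c • Q + d • R) : NoLine F G := by
  intro x y hxy
  obtain ⟨s, t, hst⟩ := h x y hxy
  refine ⟨s, t, fun h0 => hst ?_⟩
  rw [hF, hG] at h0
  simp only [_root_.add_apply, _root_.smul_apply, smul_eq_mul] at h0
  constructor
  · refine (mul_eq_zero.1 (?_ : (a * d - b * c) * _ = 0)).resolve_left hdet
    linear_combination d * h0.1 - b * h0.2
  · refine (mul_eq_zero.1 (?_ : (a * d - b * c) * _ = 0)).resolve_left hdet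
    linear_combination a * h0.2 - c * h0.1

theorem PencilSmooth.change {x : U} (h : PencilSmooth Q R x) {a b c d : ℝ}
    (hdet : a * d - b * c ≠ 0) (hF : F = a • Q + b • R) (hG : G = c • Q + d • R) :
    PencilSmooth F G x := by
  intro α β h0
  obtain ⟨h1, h2⟩ := h (α * a + β * c) (α * b + β * d) fun u => by
    rw [← h0 u, hF, hG]
    simp only [polar, _root_.add_apply, _root_.smul_apply, smul_eq_mul]; ring
  constructor
  · refine (mul_eq_zero.1 (?_ : (a * d - b * c) * _ = 0)).resolve_left hdet
    linear_combination d * h1 - c * h2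
  · refine (mul_eq_zero.1 (?_ : (a * d - b * c) * _ = 0)).resolve_left hdet
    linear_combination a * h2 - b * h1

theorem CubePair.change (h : CubePair Q R O O' i l) {a b c d : ℝ} (hdet : a * d - b * c ≠ 0)
    (hF : F = a • Q + b • R) (hG : G = c • Q + d • R) : CubePair F G O O' i l where
  finrank_eq := h.finrank_eq
  left := h.left
  right := h.right
  ne := h.ne
  eq_i := h.eq_i
  eq_l := h.eq_l
  eq_of_ne := h.eq_of_ne
  Q_left m b := by simp [hF, h.Q_left, h.R_left]
  Q_right m b := by simp [hF, h.Q_right, h.R_right]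
  R_left m b := by simp [hG, h.Q_left, h.R_left]
  R_right m b := by simp [hG, h.Q_right, h.R_right]
  smooth_left m b := (h.smooth_left m b).change hdet hF hG
  smooth_right m b := (h.smooth_right m b).change hdet hF hG

/-- A combination of two quadratic forms is a combination of any two forms that span the same
pencil. -/
theorem exists_combination {S : QuadraticForm ℝ U} {α β : ℝ} (hαβ : α ≠ 0 ∨ β ≠ 0)
    (hS : S = α • Q + β • R) {a b c d : ℝ} (hdet : a * d - b * c ≠ 0)
    (hF : F = a • Q + b • R) (hG : G = c • Q + d • R) :
    ∃ α' β' : ℝ, (α' ≠ 0 ∨ β' ≠ 0) ∧ S = α' • F + β' • G := by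
  refine ⟨(d * α - c * β) / (a * d - b * c), (a * β - b * α) / (a * d - b * c), ?_, ?_⟩
  · by_contra! h0
    rw [div_eq_zero_iff, div_eq_zero_iff] at h0
    have h1 := h0.1.resolve_right hdet
    have h2 := h0.2.resolve_right hdet
    rcases hαβ with h | h
    · exact h ((mul_eq_zero.1 (by linear_combination a * h1 + c * h2 :
        (a * d - b * c) * α = 0)).resolve_left hdet)
    · exact h ((mul_eq_zero.1 (by linear_combination b * h1 + d * h2 :
        (a * d - b * c) * β = 0)).resolve_left hdet)
  · ext x
    rw [hS, hF, hG]
    simp only [_root_.add_apply, _root_.smul_apply, smul_eq_mul]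
    obtain ⟨n, hn⟩ : ∃ n, n = (a * d - b * c)⁻¹ := ⟨_, rfl⟩
    have h1 : n * (a * d - b * c) = 1 := by rw [hn]; exact inv_mul_cancel₀ hdet
    rw [div_eq_mul_inv, div_eq_mul_inv, ← hn]
    linear_combination (-(α * Q x) - β * R x) * h1

theorem quadraticForm_sum_four (F : QuadraticForm ℝ U) (v : Fin 4 → U) (c : Fin 4 → ℝ) :
    F (∑ k, c k • v k) = c 0 ^ 2 * F (v 0) + c 1 ^ 2 * F (v 1) + c 2 ^ 2 * F (v 2) +
      c 3 ^ 2 * F (v 3) + c 0 * c 1 * polar F (v 0) (v 1) + c 0 * c 2 * polar F (v 0) (v 2) +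
      c 0 * c 3 * polar F (v 0) (v 3) + c 1 * c 2 * polar F (v 1) (v 2) +
      c 1 * c 3 * polar F (v 1) (v 3) + c 2 * c 3 * polar F (v 2) (v 3) := by
  rw [Fin.sum_univ_four, QuadraticMap.map_add F, QuadraticMap.map_add F, QuadraticMap.map_add F]
  simp only [QuadraticMap.map_smul, polar_add_left, polar_smul_left, polar_smul_right, smul_eq_mul]
  ring

/-- A matrix with a right inverse gives a change of coordinates. -/
theorem exists_equiv_mulVec (M N : Matrix (Fin 4) (Fin 4) ℝ) (h : M * N = 1) :
    ∃ T : (Fin 4 → ℝ) ≃ₗ[ℝ] (Fin 4 → ℝ), ∀ c, T c = M.mulVec c :=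
  ⟨Matrix.toLin'OfInv (mul_eq_one_comm.1 h) h, fun _ => rfl⟩

/-- Coordinates in which a smooth point of the curve is the first unit vector and the tangent of the
curve is spanned by the first two unit vectors. -/
theorem CubePair.exists_coordinates (h : CubePair Q R O O' i l) (hnl : NoLine Q R) :
    ∃ (F G : QuadraticForm ℝ U) (α β : ℝ), CubePair F G O O' i l ∧ NoLine F G ∧
      (α ≠ 0 ∨ β ≠ 0) ∧ Q = α • F + β • G ∧
      ∃ (e : (Fin 4 → ℝ) ≃ₗ[ℝ] U) (a b g₁₂ g₁₃ g₂₂ g₂₃ g₃₃ : ℝ),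
        (∀ c, F (e c) = c 0 * c 3 + a * c 1 * c 2 + b * c 2 ^ 2) ∧
        ∀ c, G (e c) = c 0 * c 2 - c 1 ^ 2 + g₁₂ * c 1 * c 2 + g₁₃ * c 1 * c 3 + g₂₂ * c 2 ^ 2 +
          g₂₃ * c 2 * c 3 + g₃₃ * c 3 ^ 2 := by
  have : FiniteDimensional ℝ U := Module.finite_of_finrank_pos (by rw [h.finrank_eq]; norm_num)
  set o := O 0 true with ho
  have hsm := h.smooth_left 0 true
  have hQo := h.Q_left 0 true
  have hRo := h.R_left 0 true
  rw [← ho] at hsm hQo hRo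
  -- a second point of the tangent
  obtain ⟨v, hvQ, hvR, hvo⟩ : ∃ v, polar Q o v = 0 ∧ polar R o v = 0 ∧ v ∉ span ℝ {o} := by
    by_contra! hcon
    set T : U →ₗ[ℝ] ℝ × ℝ := (polarBilin Q o).prod (polarBilin R o) with hT
    have h1 : LinearMap.ker T ≤ span ℝ {o} := by
      intro v hv
      have hv' : (polar Q o v, polar R o v) = (0, 0) := hv
      rw [Prod.mk.injEq] at hv'
      exact hcon v hv'.1 hv'.2
    have h2 := Submodule.finrank_mono h1
    have h3 := finrank_span_le_card (R := ℝ) ({o} : Set U)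
    have h4 := T.finrank_range_add_finrank_ker
    have h5 := (LinearMap.range T).finrank_le
    rw [Module.finrank_prod, Module.finrank_self] at h5
    rw [h.finrank_eq] at h4
    have h6 := h2.trans h3
    rw [Set.toFinset_card, Set.card_singleton] at h6
    omega
  have ho0 : o ≠ 0 := hsm.ne_zero
  have hov : LinearIndependent ℝ ![o, v] := by
    rw [LinearIndependent.pair_iff' ho0]
    intro c hc
    exact hvo (mem_span_singleton.2 ⟨c, hc⟩)
  have hv0 : 0 < Q v ^ 2 + R v ^ 2 := by
    obtain ⟨s, t, hst⟩ := hnl o v hov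
    by_contra! hle
    apply hst
    have h1 : Q v = 0 := by nlinarith [sq_nonneg (Q v), sq_nonneg (R v)]
    have h2 : R v = 0 := by nlinarith [sq_nonneg (Q v), sq_nonneg (R v)]
    rw [QuadraticMap.map_add Q, QuadraticMap.map_add R]
    simp [QuadraticMap.map_smul, polar_smul_left, polar_smul_right, hQo, hRo, hvQ, hvR, h1, h2]
  obtain ⟨n, hn⟩ : ∃ n, n = Q v ^ 2 + R v ^ 2 := ⟨_, rfl⟩
  rw [← hn] at hv0
  -- The quadric `F` of the pencil contains the tangent; `G` is normalised by `G v = -1`.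
  obtain ⟨F, hF⟩ : ∃ F : QuadraticForm ℝ U, F = R v • Q + (-Q v) • R := ⟨_, rfl⟩
  obtain ⟨G, hG⟩ : ∃ G : QuadraticForm ℝ U, G = (-Q v / n) • Q + (-R v / n) • R := ⟨_, rfl⟩
  have hdet : R v * (-R v / n) - -Q v * (-Q v / n) ≠ 0 := by
    have : R v * (-R v / n) - -Q v * (-Q v / n) = -1 := by
      field_simp; linear_combination hn
    rw [this]; norm_num
  obtain ⟨α, β, hαβ, hQ⟩ := exists_combination (S := Q) (α := 1) (β := 0) (Or.inl one_ne_zero)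
    (by simp) hdet hF hG
  have h' := h.change hdet hF hG
  have hsm' := h'.smooth_left 0 true
  rw [← ho] at hsm'
  have hFo : F o = 0 := h'.Q_left 0 true
  have hGo : G o = 0 := h'.R_left 0 true
  have hFv : F v = 0 := by rw [hF]; simp; ring
  have hGv : G v = -1 := by rw [hG]; simp; field_simp; linear_combination hn
  have hpF : polar F o v = 0 := by
    have : polar F o v = R v * polar Q o v + (-Q v) * polar R o v := by
      rw [hF]; simp only [polar, _root_.add_apply, _root_.smul_apply, smul_eq_mul]; ring
    rw [this, hvQ, hvR]; ring
  have hpG : polar G o v = 0 := by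
    have : polar G o v = (-Q v / n) * polar Q o v + (-R v / n) * polar R o v := by
      rw [hG]; simp only [polar, _root_.add_apply, _root_.smul_apply, smul_eq_mul]; ring
    rw [this, hvQ, hvR]; ring
  -- the two tangent planes of the quadrics in `o` are different
  obtain ⟨e₂, e₃, h21, h22, h31, h32⟩ : ∃ e₂ e₃, polar F o e₂ = 0 ∧ polar G o e₂ = 1 ∧
      polar F o e₃ = 1 ∧ polar G o e₃ = 0 := by
    obtain ⟨y, hy⟩ : ∃ y, polar G o y ≠ 0 := by
      by_contra! h0
      exact one_ne_zero (hsm' 0 1 fun u => by simp [h0]).2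
    obtain ⟨x, hx⟩ : ∃ x, polar G o y * polar F o x - polar F o y * polar G o x ≠ 0 := by
      by_contra! h0
      exact hy (hsm' (polar G o y) (-polar F o y) fun u => by
        rw [← h0 u]; ring).1
    obtain ⟨D, hD⟩ : ∃ D, D = polar G o y * polar F o x - polar F o y * polar G o x := ⟨_, rfl⟩
    rw [← hD] at hx
    have hDi : D⁻¹ * D = 1 := inv_mul_cancel₀ hx
    refine ⟨(D⁻¹ * polar F o x) • y - (D⁻¹ * polar F o y) • x,
      (D⁻¹ * polar G o y) • x - (D⁻¹ * polar G o x) • y, ?_, ?_, ?_, ?_⟩ <;>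
    simp only [polar_sub_right, polar_smul_right, smul_eq_mul]
    · ring
    · rw [← hDi, hD]; ring
    · rw [← hDi, hD]; ring
    · ring
  set w : Fin 4 → U := ![o, v, e₂, e₃] with hw
  have hwli : LinearIndependent ℝ w := by
    rw [Fintype.linearIndependent_iff]
    intro c hc
    rw [Fin.sum_univ_four] at hc
    simp only [hw, Matrix.cons_val] at hc
    have h3 : c 3 = 0 := by
      have := congrArg (polarBilin F o) hc
      simp only [map_add, map_smul, map_zero, polarBilin_apply_apply, polar_self, hFo, hpF, h21,
        h31,
        smul_eq_mul] at this
      linear_combination this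
    have h2 : c 2 = 0 := by
      have := congrArg (polarBilin G o) hc
      simp only [map_add, map_smul, map_zero, polarBilin_apply_apply, polar_self, hGo, hpG, h22,
        h32,
        smul_eq_mul] at this
      linear_combination this
    rw [h2, h3, zero_smul, zero_smul, add_zero, add_zero] at hc
    have h01 := LinearIndependent.pair_iff.1 hov _ _ hc
    intro k
    fin_cases k
    · exact h01.1
    · exact h01.2
    · exact h2
    · exact h3
  set b := basisOfLinearIndependentOfCardEqFinrank hwli (by simp [h.finrank_eq]) with hb
  have hbe : ∀ c, b.equivFun.symm c = ∑ k, c k • w k := by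
    intro c
    rw [Module.Basis.equivFun_symm_apply]
    simp [hb]
  obtain ⟨T, hT⟩ := exists_equiv_mulVec
    !![1, -polar F v e₃, -polar F e₂ e₃, -F e₃; 0, 1, 0, 0; 0, 0, 1, 0; 0, 0, 0, 1]
    !![1, polar F v e₃, polar F e₂ e₃, F e₃; 0, 1, 0, 0; 0, 0, 1, 0; 0, 0, 0, 1] (by
      ext i j; fin_cases i <;> fin_cases j <;> simp [Matrix.mul_apply, Fin.sum_univ_four])
  refine ⟨F, G, α, β, h', hnl.change hdet hF hG, hαβ, hQ, T.trans b.equivFun.symm, polar F v e₂,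
    F e₂,
    polar G v e₂ - polar F v e₃, polar G v e₃, G e₂ - polar F e₂ e₃, polar G e₂ e₃ - F e₃, G e₃,
    fun c => ?_, fun c => ?_⟩
  · rw [LinearEquiv.trans_apply, hbe, quadraticForm_sum_four, hT]
    simp [hw, Matrix.mulVec, dotProduct, Fin.sum_univ_four, hFo, hFv, hpF, h21, h31]
    ring
  · rw [LinearEquiv.trans_apply, hbe, quadraticForm_sum_four, hT]
    simp [hw, Matrix.mulVec, dotProduct, Fin.sum_univ_four, hGo, hGv, hpG, h22, h32]
    ring

/-- If the curve does not contain a line, the normal form of `CubePair.exists_coordinates` leads to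
three cases. For `a ≠ 0` the osculating plane in the chosen point meets the curve in another point,
and the curve is a Weierstrass curve embedded by `1, X, Y, Y / X`. For `a = 0`, `b ≠ 0` it has
four-point contact, and the embedding is `1, X, Y, X²`. For `a = b = 0` one of the quadrics is a
pair of planes. -/
theorem CubePair.hasGrid_of_noLine (h : CubePair Q R O O' i l) (hnl : NoLine Q R) :
    HasGrid Q O O' i l := by
  obtain ⟨F, G, α, β, h', hnl', hαβ, hQ, e, a, b, g₁₂, g₁₃, g₂₂, g₂₃, g₃₃, hF, hG⟩ :=
    h.exists_coordinates hnl
  by_cases ha : a = 0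
  · by_cases hb : b = 0
    · -- a point of the curve in the second plane
      obtain ⟨m, ε, hm⟩ : ∃ m ε, e.symm (O m ε) 3 ≠ 0 := by
        by_contra! hcon
        have hφ : (LinearMap.proj (R := ℝ) (φ := fun _ : Fin 4 => ℝ) 3) ∘ₗ
            e.symm.toLinearMap = 0 := by
          refine (h.left.basis h.finrank_eq 0 true).ext fun m => ?_
          rw [h.left.basis_apply]
          exact hcon m _
        have h5 := congrArg (fun f => f (e (Pi.single 3 1))) hφ
        simp at h5
      have hQm := h'.Q_left m ε
      have hRm := h'.R_left m ε
      have hsm := h'.smooth_left m ε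
      obtain ⟨x, hx⟩ := e.surjective (O m ε)
      rw [← hx, e.symm_apply_apply] at hm
      rw [← hx] at hQm hRm hsm
      subst ha hb
      have hx0 : x 0 = 0 := by
        rw [hF] at hQm
        simpa [hm] using hQm
      obtain ⟨m₁, hm₁⟩ : ∃ m₁, m₁ = x 1 / x 3 := ⟨_, rfl⟩
      obtain ⟨m₂, hm₂⟩ : ∃ m₂, m₂ = x 2 / x 3 := ⟨_, rfl⟩
      have hx1 : x 1 = m₁ * x 3 := by rw [hm₁]; field_simp
      have hx2 : x 2 = m₂ * x 3 := by rw [hm₂]; field_simp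
      have h33 : -m₁ ^ 2 + g₁₂ * m₁ * m₂ + g₁₃ * m₁ + g₂₂ * m₂ ^ 2 + g₂₃ * m₂ + g₃₃ = 0 := by
        rw [hG, hx0, hx1, hx2] at hRm
        refine (mul_eq_zero.1 (?_ : x 3 ^ 2 * _ = 0)).resolve_left (pow_ne_zero 2 hm)
        linear_combination hRm
      obtain ⟨p, hp⟩ : ∃ p, p = -2 * m₁ + g₁₂ * m₂ + g₁₃ := ⟨_, rfl⟩
      obtain ⟨q, hq⟩ : ∃ q, q = g₁₂ * m₁ + 2 * g₂₂ * m₂ + g₂₃ + p * g₁₂ / 2 := ⟨_, rfl⟩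
      -- Coordinates in which `x` is a multiple of the last unit vector, and the mixed term in
      -- `c 1` and `c 2` vanishes.
      obtain ⟨T, hT⟩ := exists_equiv_mulVec
        !![1, 0, 0, 0; 0, 1, g₁₂ / 2, m₁; 0, 0, 1, m₂; 0, 0, 0, 1]
        !![1, 0, 0, 0; 0, 1, -g₁₂ / 2, m₂ * g₁₂ / 2 - m₁; 0, 0, 1, -m₂; 0, 0, 0, 1] (by
          ext i j; fin_cases i <;> fin_cases j <;> simp [Matrix.mul_apply,
            Fin.sum_univ_four] <;> ring)
      have hdet : (1 : ℝ) * 1 - 0 * -m₂ ≠ 0 := by simp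
      obtain ⟨α', β', hαβ', hQ'⟩ := exists_combination (F := (1 : ℝ) • F + (0 : ℝ) • G)
        (G := (-m₂) • F + (1 : ℝ) • G) hαβ hQ hdet rfl rfl
      have hF' : ∀ c, ((1 : ℝ) • F + (0 : ℝ) • G) ((T.trans e) c) = c 0 * c 3 := by
        intro c
        rw [LinearEquiv.trans_apply, _root_.add_apply, _root_.smul_apply, _root_.smul_apply, hF, hT]
        simp [Matrix.mulVec, dotProduct, Fin.sum_univ_four]
      have hG' : ∀ c, ((-m₂) • F + (1 : ℝ) • G) ((T.trans e) c) =
          c 0 * c 2 + c 3 * (p * c 1 + q * c 2) - (c 1 ^ 2 - (g₁₂ ^ 2 / 4 + g₂₂) * c 2 ^ 2) := by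
        intro c
        rw [LinearEquiv.trans_apply, _root_.add_apply, _root_.smul_apply, _root_.smul_apply, hF,
          hG, hT]
        simp [Matrix.mulVec, dotProduct, Fin.sum_univ_four]
        rw [hq, hp]
        linear_combination c 3 ^ 2 * h33
      refine (h'.change hdet rfl rfl).hasGrid_of_conics hαβ' hQ' (T.trans e) _ p q ?_ hF' hG'
      -- a degenerate conic contains a line through `x`
      intro hη
      have hp0 : p ≠ 0 ∨ q ≠ 0 := by
        by_contra! h0
        -- the point `x` would be a singular point of the curve
        obtain ⟨c, hc⟩ := (T.trans e).surjective (e x)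
        have hTx : c = ![0, 0, 0, x 3] := by
          apply T.injective
          have : T c = x := e.injective hc
          rw [this, hT]
          ext k; fin_cases k <;> simp [Matrix.mulVec, dotProduct, Fin.sum_univ_four, hx0, hx1, hx2]
        have := (hsm.change hdet rfl rfl) 0 1 fun u => by
          obtain ⟨d, rfl⟩ := (T.trans e).surjective u
          rw [← hc, polar_equiv (T.trans e) hG', hTx, h0.1, h0.2]
          simp
        exact one_ne_zero this.2
      have hli : LinearIndependent ℝ ![(T.trans e) ![0, q, -p, 0], (T.trans e) ![0, 0, 0, 1]] := by
        rw [LinearIndependent.pair_iff]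
        intro x y hxy
        rw [← map_smul, ← map_smul, ← map_add, LinearEquiv.map_eq_zero_iff] at hxy
        have h1 := congrFun hxy 1
        have h2 := congrFun hxy 2
        have h3 := congrFun hxy 3
        simp at h1 h2 h3
        refine ⟨?_, h3⟩
        rcases hp0 with h | h
        · exact h2.resolve_right h
        · exact h1.resolve_right h
      obtain ⟨x, y, hxy⟩ := hnl'.change hdet rfl rfl _ _ hli
      apply hxy
      rw [← map_smul, ← map_smul, ← map_add, hF', hG']
      refine ⟨by simp, ?_⟩
      simp
      linear_combination (-x ^ 2) * hη
    -- the chosen point becomes the point at infinity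
    · obtain ⟨T, hT⟩ := exists_equiv_mulVec
        !![0, 0, 0, 1; 0, 0, 1, 0; 0, 1, 0, 0; -b, 0, 0, 0]
        !![0, 0, 0, -b⁻¹; 0, 0, 1, 0; 0, 1, 0, 0; 1, 0, 0, 0] (by
          ext i j; fin_cases i <;> fin_cases j <;> simp [Matrix.mul_apply, Fin.sum_univ_four, hb])
      have hdet : -b⁻¹ * -1 - 0 * 0 ≠ 0 := by simpa using hb
      obtain ⟨α', β', hαβ', hQ'⟩ := exists_combination (F := (-b⁻¹) • F + (0 : ℝ) • G)
        (G := (0 : ℝ) • F + (-1 : ℝ) • G) hαβ hQ hdet rfl rfl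
      refine (h'.change hdet rfl rfl).hasGrid_of_flex hαβ' hQ' (T.trans e) (-g₁₂) g₂₂ (b * g₁₃)
        (-b * g₂₃) (b ^ 2 * g₃₃) (fun c => ?_) (fun c => ?_)
      · rw [LinearEquiv.trans_apply, _root_.add_apply, _root_.smul_apply, _root_.smul_apply, hF, hT]
        simp [Matrix.mulVec, dotProduct, Fin.sum_univ_four, ha]
        field_simp
        ring
      · rw [LinearEquiv.trans_apply, _root_.add_apply, _root_.smul_apply, _root_.smul_apply, hG, hT]
        simp [Matrix.mulVec, dotProduct, Fin.sum_univ_four]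
        ring
  -- The chosen point becomes the point at infinity, the plane `c 3 = 0` becomes `W = 0`, and
  -- the first quadric is `YW = ZX`.
  · obtain ⟨t, ht⟩ : ∃ t, t = b / a := ⟨_, rfl⟩
    have hta : t * a = b := by rw [ht]; field_simp
    obtain ⟨s, hs⟩ : ∃ s, s = 2 * t + g₁₂ := ⟨_, rfl⟩
    obtain ⟨k, hk⟩ : ∃ k, k = g₂₂ - t ^ 2 - g₁₂ * t := ⟨_, rfl⟩
    obtain ⟨T, hT⟩ := exists_equiv_mulVec
      !![0, 0, 1, -k; k, -1, 0, -t; 0, 0, 0, 1; a, 0, 0, 0]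
      !![0, 0, 0, a⁻¹; 0, -1, -t, k * a⁻¹; 1, 0, k, 0; 0, 0, 1, 0] (by
        ext i j; fin_cases i <;> fin_cases j <;> simp [Matrix.mul_apply, Fin.sum_univ_four, ha])
    have hdet : a⁻¹ * 1 - 0 * (-s / a) ≠ 0 := by simpa using ha
    obtain ⟨α', β', hαβ', hQ'⟩ := exists_combination (F := a⁻¹ • F + (0 : ℝ) • G)
      (G := (-s / a) • F + (1 : ℝ) • G) hαβ hQ hdet rfl rfl
    have hF' : ∀ c, (a⁻¹ • F + (0 : ℝ) • G) ((T.trans e) c) = c 2 * c 0 - c 3 * c 1 := by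
      intro c
      rw [LinearEquiv.trans_apply, _root_.add_apply, _root_.smul_apply, _root_.smul_apply, hF, hT]
      simp [Matrix.mulVec, dotProduct, Fin.sum_univ_four, ← hta]
      field_simp
      ring
    have hG' : ∀ c, ((-s / a) • F + (1 : ℝ) • G) ((T.trans e) c) = c 3 * c 2 + (-s) * c 2 * c 0 +
        (s * k + a * (g₂₃ - t * g₁₃)) * c 3 * c 0 - (c 1 ^ 2 + (-2 * k + a * g₁₃) * c 1 * c 0 +
          (k ^ 2 - a * g₁₃ * k - a ^ 2 * g₃₃) * c 0 ^ 2) := by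
      intro c
      rw [LinearEquiv.trans_apply, _root_.add_apply, _root_.smul_apply, _root_.smul_apply, hF, hG,
        hT]
      simp [Matrix.mulVec, dotProduct, Fin.sum_univ_four, ← hta]
      field_simp
      rw [hs, hk]
      ring
    refine (h'.change hdet rfl rfl).hasGrid_of_weierstrass hαβ' hQ' (T.trans e) _ _ _ _ ?_ hF' hG'
    by_contra! h34
    -- the line `X = Y = 0`
    have hli : LinearIndependent ℝ ![(T.trans e) ![1, 0, 0, 0], (T.trans e) ![0, 0, 0, 1]] := by
      rw [LinearIndependent.pair_iff]
      intro x y hxy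
      rw [← map_smul, ← map_smul, ← map_add, LinearEquiv.map_eq_zero_iff] at hxy
      have h0 := congrFun hxy 0
      have h3 := congrFun hxy 3
      simp at h0 h3
      exact ⟨h0, h3⟩
    obtain ⟨x, y, hxy⟩ := hnl'.change hdet rfl rfl _ _ hli
    apply hxy
    rw [← map_smul, ← map_smul, ← map_add, hF', hG', h34.1, h34.2]
    simp

end NormalForm

/-! ### Curves which contain a line -/

section CurvesWithLine

variable {U : Type*} [AddCommGroup U] [Module ℝ U] {Q R F G : QuadraticForm ℝ U}
  {O O' : Fin 4 → Bool → U} {i l : Fin 4}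

/-- The point with the parameter `y` on the line that joins `(1, 0, 0, 0)` to the vertex
`(0, 0, 0, 1)` of the cone `c₁² = c₀ c₂`. -/
def linePoint (y : ℝ) : Fin 4 → ℝ := ![1, 0, 0, y]

/-- The points of the cone `c₁² = c₀ c₂` outside the plane `c₂ = 0`. -/
def conePoint (u y : ℝ) : Fin 4 → ℝ := ![u ^ 2, u, 1, y]

theorem IsCircuit.mem_span_of_smul_eq {x : Fin 4 → U} (hx : IsCircuit x) {j k : Fin 4}
    (hjk : j ≠ k) {N : U} {a b c : ℝ} (ha : a ≠ 0) (h : a • x j = b • x k + c • N) :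
    N ∈ span ℝ (Set.range x) := by
  have hc : c ≠ 0 := by
    rintro rfl
    refine hx.not_mem_span_singleton hjk (mem_span_singleton.2 ⟨a⁻¹ * b, ?_⟩)
    rw [zero_smul, add_zero] at h
    rw [mul_smul, ← h, smul_smul, inv_mul_cancel₀ ha, one_smul]
  have h1 : N = c⁻¹ • (a • x j - b • x k) := by
    rw [h, add_sub_cancel_left, smul_smul, inv_mul_cancel₀ hc, one_smul]
  rw [h1]
  exact smul_mem _ _ (sub_mem (smul_mem _ _ (subset_span ⟨j, rfl⟩))
    (smul_mem _ _ (subset_span ⟨k, rfl⟩)))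

/-- A circuit whose plane does not contain the vertex of the cone has at most one point on the
generator `c₁ = c₂ = 0`. -/
theorem IsCircuit.eq_of_mem_line {x : Fin 4 → U} (hx : IsCircuit x) (e : (Fin 4 → ℝ) ≃ₗ[ℝ] U)
    (hF : ∀ c, F (e c) = c 1 ^ 2 - c 0 * c 2) (hx0 : ∀ k, F (x k) = 0)
    (hN : e ![0, 0, 0, 1] ∉ span ℝ (Set.range x)) {j k : Fin 4} (hj : e.symm (x j) 2 = 0)
    (hk : e.symm (x k) 2 = 0) : j = k := by
  by_contra hjk
  have h1 : ∀ m, e.symm (x m) 2 = 0 → e.symm (x m) 1 = 0 := by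
    intro m hm
    have := hx0 m
    rw [← e.apply_symm_apply (x m), hF, hm] at this
    simpa using this
  have hk0 : e.symm (x k) 0 ≠ 0 := by
    intro h0
    refine hN (hx.mem_span_of_smul_eq (Ne.symm hjk) one_ne_zero (b := 0)
      (c := e.symm (x k) 3) ?_)
    apply e.symm.injective
    ext m
    fin_cases m <;> simp [h0, h1 k hk, hk]
  refine hN (hx.mem_span_of_smul_eq hjk hk0 (b := e.symm (x j) 0)
    (c := e.symm (x k) 0 * e.symm (x j) 3 - e.symm (x j) 0 * e.symm (x k) 3) ?_)
  apply e.symm.injective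
  ext m
  fin_cases m <;> simp [h1 k hk, hk, h1 j hj, hj, mul_comm]

/-- A circuit whose plane does not contain the vertex of the cone has at most one point on each
generator. -/
theorem IsCircuit.eq_of_slope_eq {x : Fin 4 → U} (hx : IsCircuit x) (e : (Fin 4 → ℝ) ≃ₗ[ℝ] U)
    (hF : ∀ c, F (e c) = c 1 ^ 2 - c 0 * c 2) (hx0 : ∀ k, F (x k) = 0)
    (hN : e ![0, 0, 0, 1] ∉ span ℝ (Set.range x)) {j k : Fin 4} (hj : e.symm (x j) 2 ≠ 0)
    (hk : e.symm (x k) 2 ≠ 0)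
    (h : e.symm (x j) 1 / e.symm (x j) 2 = e.symm (x k) 1 / e.symm (x k) 2) : j = k := by
  by_contra hjk
  have h0 : ∀ m, e.symm (x m) 1 ^ 2 = e.symm (x m) 0 * e.symm (x m) 2 := by
    intro m
    have := hx0 m
    rw [← e.apply_symm_apply (x m), hF] at this
    linear_combination this
  rw [div_eq_div_iff hj hk] at h
  refine hN (hx.mem_span_of_smul_eq hjk hk (b := e.symm (x j) 2)
    (c := e.symm (x k) 2 * e.symm (x j) 3 - e.symm (x j) 2 * e.symm (x k) 3) ?_)
  apply e.symm.injective
  ext m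
  fin_cases m
  · simp
    refine mul_left_cancel₀ (mul_ne_zero hj hk) ?_
    have hj' := h0 j
    have hk' := h0 k
    linear_combination (-e.symm (x k) 2 ^ 2) * hj' + e.symm (x j) 2 ^ 2 * hk' +
      (e.symm (x j) 1 * e.symm (x k) 2 + e.symm (x k) 1 * e.symm (x j) 2) * h
  · simp
    linear_combination h
  · simp [mul_comm]
  · simp

/-- If the curve contains the generator `c₁ = c₂ = 0` of the cone `F = 0`, then each circuit of a
cube has a point on this line. Otherwise the projections of the four points from the vertex of the
cone are four roots of a polynomial of degree three, which therefore vanishes. It follows that the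
curve lies in the plane of the four points and a second plane through the vertex of the cone. The
second plane contains the opposite circuit, although it meets the cone only in two generators, each
of which contains at most one point of this circuit. -/
theorem IsCube.exists_mem_line (hO : IsCube O) (hU : Module.finrank ℝ U = 4)
    (e : (Fin 4 → ℝ) ≃ₗ[ℝ] U) (hF : ∀ c, F (e c) = c 1 ^ 2 - c 0 * c 2)
    {l₁ l₂ α β γ δ : ℝ} (hG : ∀ c, G (e c) = c 3 * (l₁ * c 1 + l₂ * c 2) + α * c 0 * c 1 +
      β * c 0 * c 2 + γ * c 1 * c 2 + δ * c 2 ^ 2)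
    (hFO : ∀ k b, F (O k b) = 0) (hGO : ∀ k b, G (O k b) = 0)
    (hs : ∀ k b, PencilSmooth F G (O k b))
    (hN : ∀ s, IsVertexLabel s → e ![0, 0, 0, 1] ∉ span ℝ (Set.range fun k => O k (s k)))
    {s : Fin 4 → Bool} (hsv : IsVertexLabel s) : ∃ k, e.symm (O k (s k)) 2 = 0 := by
  by_contra! hfin
  have hc := hO.circuit s hsv
  obtain ⟨f, hfN, hf⟩ := Submodule.exists_le_ker_of_notMem (hN s hsv)
  have hf0 : ∀ k, f (O k (s k)) = 0 := fun k => hf (subset_span ⟨k, rfl⟩)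
  obtain ⟨κ, hκ⟩ : ∃ κ : Fin 4 → ℝ, κ = fun k => -f (e (Pi.single k 1)) / f (e ![0, 0, 0, 1]) :=
    ⟨_, rfl⟩
  have hfe : ∀ c, f (e c) = f (e ![0, 0, 0, 1]) * (c 3 - κ 0 * c 0 - κ 1 * c 1 - κ 2 * c 2) := by
    intro c
    have h1 : c = c 0 • Pi.single 0 1 + c 1 • Pi.single 1 1 + c 2 • Pi.single 2 1 +
        c 3 • ![0, 0, 0, 1] := by
      ext k; fin_cases k <;> simp
    have h2 : f (e c) = c 0 * f (e (Pi.single 0 1)) + c 1 * f (e (Pi.single 1 1)) +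
        c 2 * f (e (Pi.single 2 1)) + c 3 * f (e ![0, 0, 0, 1]) := by
      conv_lhs => rw [h1]
      simp only [map_add, map_smul, smul_eq_mul]
    rw [h2, hκ]
    field_simp
    ring
  -- four roots of a cubic polynomial
  have hroots : (![κ 2 * l₂ + δ, κ 2 * l₁ + κ 1 * l₂ + γ, κ 1 * l₁ + κ 0 * l₂ + β, κ 0 * l₁ + α] :
      Fin 4 → ℝ) = 0 := by
    refine Matrix.eq_zero_of_forall_index_sum_pow_mul_eq_zero
      (f := fun k => e.symm (O k (s k)) 1 / e.symm (O k (s k)) 2) (fun j k hjk => ?_) fun k => ?_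
    · exact hc.eq_of_slope_eq e hF (fun k => hFO k (s k)) (hN s hsv) (hfin j) (hfin k) hjk
    · have h1 := hFO k (s k)
      have h2 := hGO k (s k)
      have h3 := hf0 k
      have h4 := hfin k
      obtain ⟨c, hc⟩ := e.surjective (O k (s k))
      rw [← hc] at h1 h2 h3 h4 ⊢
      rw [hF] at h1
      rw [hG] at h2
      rw [hfe] at h3
      have h3 := (mul_eq_zero.1 h3).resolve_left hfN
      simp only [e.symm_apply_apply] at h4 ⊢
      obtain ⟨u, hu⟩ : ∃ u, u = c 1 / c 2 := ⟨_, rfl⟩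
      have h5 : c 1 = u * c 2 := by rw [hu]; field_simp
      have h6 : c 0 = u ^ 2 * c 2 := by
        refine mul_right_cancel₀ h4 ?_
        rw [h5] at h1
        linear_combination -h1
      rw [← hu]
      simp [Fin.sum_univ_four]
      refine mul_left_cancel₀ (pow_ne_zero 2 h4) ?_
      rw [h5, h6] at h2 h3
      linear_combination h2 - c 2 * (l₁ * u + l₂) * h3
  have v0 := congrFun hroots 0
  have v1 := congrFun hroots 1
  have v2 := congrFun hroots 2
  have v3 := congrFun hroots 3
  simp only [Matrix.cons_val, Pi.zero_apply] at v0 v1 v2 v3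
  have hG' : ∀ c, G (e c) = (l₁ * c 1 + l₂ * c 2) * (c 3 - κ 0 * c 0 - κ 1 * c 1 - κ 2 * c 2) +
      κ 1 * l₁ * F (e c) := by
    intro c
    rw [hG, hF]
    linear_combination c 2 ^ 2 * v0 + c 1 * c 2 * v1 + c 0 * c 2 * v2 + c 0 * c 1 * v3
  -- the points of the opposite circuit do not lie in the plane of the first circuit
  have hopp : ∀ k, l₁ * e.symm (O k (!s k)) 1 + l₂ * e.symm (O k (!s k)) 2 = 0 := by
    intro k
    have h1 := hG' (e.symm (O k (!s k)))
    rw [e.apply_symm_apply, hFO, hGO, mul_zero, add_zero] at h1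
    refine (mul_eq_zero.1 h1.symm).resolve_right fun h0 => ?_
    obtain ⟨a, hak, ha⟩ : ∃ a, a ≠ k ∧ ∀ m, m ≠ k → starLabel a (s a) m = s m ∧
        starLabel a (s a) k = !s k := by
      clear * - hsv
      revert s k; decide
    have hfz : f = 0 := by
      refine (hO.basis hU a (s a)).ext fun m => ?_
      rw [hO.basis_apply]
      by_cases hm : m = k
      · subst hm
        obtain ⟨m', hm', -⟩ := exists_ne_ne m m
        rw [(ha m' hm').2, ← e.apply_symm_apply (O m (!s m)), hfe, h0, mul_zero]
        rfl
      · rw [(ha m hm).1, hf0]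
        rfl
    exact hfN (by rw [hfz]; rfl)
  have hsv' : IsVertexLabel fun k => !s k := by
    clear * - hsv
    revert s; decide
  have hc' := hO.circuit _ hsv'
  have hN' := hN _ hsv'
  -- two of three points in the second plane have the same projection from the vertex of the cone
  by_cases hl : l₁ = 0
  · by_cases hl' : l₂ = 0
    · have := hs 0 true (κ 1 * l₁) (-1) fun u => by
        obtain ⟨c, hc⟩ := e.surjective (O 0 true)
        obtain ⟨d, rfl⟩ := e.surjective u
        have hG'' : ∀ c, G (e c) = κ 1 * l₁ * F (e c) := by
          intro c; rw [hG', hl, hl']; ring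
        rw [← hc, polar, polar, ← map_add, hG'', hG'', hG'']
        ring
      simp at this
    · have h2 : ∀ k, e.symm (O k (!s k)) 2 = 0 := by
        intro k
        have := hopp k
        simpa [hl, hl'] using this
      exact absurd (hc'.eq_of_mem_line e hF (fun k => hFO k _) hN' (h2 0) (h2 1)) (by decide)
  · have h2 : ∀ j k, j ≠ k → e.symm (O j (!s j)) 2 ≠ 0 → e.symm (O k (!s k)) 2 = 0 := by
      intro j k hjk hj
      by_contra hk
      refine hjk (hc'.eq_of_slope_eq e hF (fun k => hFO k _) hN' hj hk ?_)
      rw [div_eq_div_iff hj hk]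
      refine mul_left_cancel₀ hl ?_
      linear_combination e.symm (O k (!s k)) 2 * hopp j - e.symm (O j (!s j)) 2 * hopp k
    have h3 : ∀ j k, j ≠ k → e.symm (O j (!s j)) 2 = 0 → e.symm (O k (!s k)) 2 ≠ 0 := by
      intro j k hjk hj hk
      exact hjk (hc'.eq_of_mem_line e hF (fun k => hFO k _) hN' hj hk)
    by_cases h0 : e.symm (O 0 (!s 0)) 2 = 0
    · exact h3 0 2 (by decide) h0 (h2 1 2 (by decide) (h3 0 1 (by decide) h0))
    · exact h3 1 2 (by decide) (h2 0 1 (by decide) h0) (h2 0 2 (by decide) h0)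

/-- A set of vertices of a cube which contains exactly one vertex of each face is a pair of opposite
vertices. -/
theorem exists_family {f : Fin 4 → Bool → Prop} (h1 : ∀ s, IsVertexLabel s → ∃ k, f k (s k))
    (h2 : ∀ s, IsVertexLabel s → ∀ j k, f j (s j) → f k (s k) → j = k) :
    ∃ k₀, ∀ k b, f k b ↔ k = k₀ := by
  have key : ∀ k b, f k b → ∀ m c, m ≠ k → ¬ f m c := by
    intro k b hk m c hm hmc
    obtain ⟨s, hs, hsk, hsm⟩ : ∃ s, IsVertexLabel s ∧ s k = b ∧ s m = c := by
      clear * - hm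
      revert k m b c; decide
    exact hm (h2 s hs m k (by rwa [hsm]) (by rwa [hsk]))
  obtain ⟨k₀, hk₀⟩ := h1 ![true, true, false, false] (by decide)
  refine ⟨k₀, fun k b => ⟨fun h => ?_, ?_⟩⟩
  · by_contra hk
    exact key _ _ hk₀ k b hk h
  · rintro rfl
    obtain ⟨s, hs, hsk⟩ : ∃ s, IsVertexLabel s ∧ s k = b := by
      clear * -
      revert k b; decide
    obtain ⟨j, hj⟩ := h1 s hs
    by_cases hjk : j = k
    · rw [hjk, hsk] at hj; exact hj
    · exact absurd hj (key _ _ hk₀ j _ hjk)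

/-- The points on a line of the curve through the vertex of the cone belong to one family. -/
theorem CubePair.exists_mem_line_iff (h : CubePair F G O O' i l)
    (e : (Fin 4 → ℝ) ≃ₗ[ℝ] U) (hF : ∀ c, F (e c) = c 1 ^ 2 - c 0 * c 2)
    {l₁ l₂ α β γ δ : ℝ} (hG : ∀ c, G (e c) = c 3 * (l₁ * c 1 + l₂ * c 2) + α * c 0 * c 1 +
      β * c 0 * c 2 + γ * c 1 * c 2 + δ * c 2 ^ 2)
    (hN : ∀ s, IsVertexLabel s → e ![0, 0, 0, 1] ∉ span ℝ (Set.range fun k => O k (s k)))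
    (hN' : ∀ s, IsVertexLabel s → e ![0, 0, 0, 1] ∉ span ℝ (Set.range fun k => O' k (s k))) :
    ∃ k₀, ∀ k b, (e.symm (O k b) 2 = 0 ↔ k = k₀) ∧ (e.symm (O' k b) 2 = 0 ↔ k = k₀) := by
  obtain ⟨k₀, hk₀⟩ := exists_family (f := fun k b => e.symm (O k b) 2 = 0)
    (fun s hs => h.left.exists_mem_line h.finrank_eq e hF hG h.Q_left h.R_left h.smooth_left hN hs)
    (fun s hs j k => (h.left.circuit s hs).eq_of_mem_line e hF (fun k => h.Q_left k _) (hN s hs))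
  obtain ⟨k₁, hk₁⟩ := exists_family (f := fun k b => e.symm (O' k b) 2 = 0)
    (fun s hs => h.right.exists_mem_line h.finrank_eq e hF hG h.Q_right h.R_right h.smooth_right
      hN' hs)
    (fun s hs j k => (h.right.circuit s hs).eq_of_mem_line e hF (fun k => h.Q_right k _) (hN' s hs))
  have h01 : k₁ = k₀ := by
    by_cases hi : k₁ = i
    · have := (hk₁ k₁ false).2 rfl
      rw [hi, h.eq_i, hk₀, ← hi] at this
      exact this
    by_cases hl : k₁ = l
    · have := (hk₁ k₁ true).2 rfl
      rw [hl, h.eq_l, hk₀, ← hl] at this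
      exact this
    · have := (hk₁ k₁ true).2 rfl
      rwa [h.eq_of_ne k₁ hi hl, hk₀] at this
  rw [h01] at hk₁
  exact ⟨k₀, fun k b => ⟨hk₀ k b, hk₁ k b⟩⟩

/-- A point of the line and three points of the cone are coplanar if and only if the parameter on
the line is the second divided difference of the coordinates `y` with respect to the nodes `u`. This
is the first implication, together with the fact that the nodes of a circuit are different. -/
theorem IsCircuit.dividedDifference {x : Fin 4 → Fin 4 → ℝ} (hx : IsCircuit x) {k a b c : Fin 4}
    (hka : k ≠ a) (hkb : k ≠ b) (hkc : k ≠ c) (hab : a ≠ b) (hac : a ≠ c) (hbc : b ≠ c)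
    {A u₁ u₂ u₃ y₁ y₂ y₃ : ℝ} (hk : x k = linePoint A) (h1 : x a = conePoint u₁ y₁)
    (h2 : x b = conePoint u₂ y₂) (h3 : x c = conePoint u₃ y₃) :
    u₁ ≠ u₂ ∧ u₁ ≠ u₃ ∧ u₂ ≠ u₃ ∧ y₁ * (u₂ - u₃) + y₂ * (u₃ - u₁) + y₃ * (u₁ - u₂) =
      A * ((u₁ - u₂) * (u₁ - u₃) * (u₂ - u₃)) := by
  obtain ⟨d, hd, hs⟩ := hx.exists_rel_ne
  rw [sum_four hka hkb hkc hab hac hbc, hk, h1, h2, h3] at hs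
  have e0 := congrFun hs 0
  have e1 := congrFun hs 1
  have e2 := congrFun hs 2
  have e3 := congrFun hs 3
  simp [linePoint, conePoint] at e0 e1 e2 e3
  have h12 : u₁ ≠ u₂ := by
    rintro rfl
    have h13 : u₁ = u₃ := by
      refine sub_eq_zero.1 ((mul_eq_zero.1 (?_ : d c * _ = 0)).resolve_left (hd c))
      linear_combination u₁ * e2 - e1
    subst h13
    exact hd k (by linear_combination e0 - u₁ ^ 2 * e2)
  have h13 : u₁ ≠ u₃ := by
    rintro rfl
    refine h12 (sub_eq_zero.1 ((mul_eq_zero.1 (?_ : d b * _ = 0)).resolve_left (hd b)))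
    linear_combination u₁ * e2 - e1
  have h23 : u₂ ≠ u₃ := by
    rintro rfl
    refine h12 (sub_eq_zero.1 ((mul_eq_zero.1 (?_ : d a * _ = 0)).resolve_left (hd a)))
    linear_combination e1 - u₂ * e2
  refine ⟨h12, h13, h23, sub_eq_zero.1 ((mul_eq_zero.1 (?_ : d a * _ = 0)).resolve_left (hd a))⟩
  have hb' : d b * (u₂ - u₃) = -d a * (u₁ - u₃) := by linear_combination e1 - u₃ * e2
  have hc' : d c * (u₂ - u₃) = d a * (u₁ - u₂) := by linear_combination u₂ * e2 - e1
  linear_combination (u₂ - u₃) * (e3 - A * e0) - (y₂ - A * u₂ ^ 2) * hb' - (y₃ - A * u₃ ^ 2) * hc'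

/-- The converse of `IsCircuit.dividedDifference`, which is also true for nodes that coincide. -/
theorem not_linearIndependent_of_dividedDifference {x : Fin 4 → Fin 4 → ℝ} {k a b c : Fin 4}
    (hka : k ≠ a) (hkb : k ≠ b) (hkc : k ≠ c) (hab : a ≠ b) (hac : a ≠ c) (hbc : b ≠ c)
    {A u₁ u₂ u₃ y₁ y₂ y₃ : ℝ} (hk : x k = linePoint A) (h1 : x a = conePoint u₁ y₁)
    (h2 : x b = conePoint u₂ y₂) (h3 : x c = conePoint u₃ y₃)
    (h : y₁ * (u₂ - u₃) + y₂ * (u₃ - u₁) + y₃ * (u₁ - u₂) =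
      A * ((u₁ - u₂) * (u₁ - u₃) * (u₂ - u₃))) : ¬ LinearIndependent ℝ x := by
  intro hx
  have key : ∀ d₀ d₁ d₂ d₃ : ℝ, d₀ • linePoint A + (d₁ • conePoint u₁ y₁ + (d₂ • conePoint u₂ y₂ +
      d₃ • conePoint u₃ y₃)) = 0 → d₁ = 0 ∧ d₂ = 0 ∧ d₃ = 0 := by
    intro d₀ d₁ d₂ d₃ hd
    have h0 := Fintype.linearIndependent_iff.1 hx
      (fun m => if m = k then d₀ else if m = a then d₁ else if m = b then d₂ else d₃) (by
        rw [sum_four hka hkb hkc hab hac hbc, hk, h1, h2, h3]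
        simpa [hka.symm, hkb.symm, hkc.symm, hab.symm, hac.symm, hbc.symm] using hd)
    have ha := h0 a
    have hb := h0 b
    have hc := h0 c
    simp [hka.symm, hkb.symm, hkc.symm, hab.symm, hac.symm, hbc.symm] at ha hb hc
    exact ⟨ha, hb, hc⟩
  obtain ⟨h23, h31, -⟩ := key (-((u₁ - u₂) * (u₁ - u₃) * (u₂ - u₃))) (u₂ - u₃) (u₃ - u₁) (u₁ - u₂)
    (by
      ext m
      fin_cases m <;> simp [linePoint, conePoint]
      · ring
      · ring
      · linear_combination h)
  obtain rfl := sub_eq_zero.1 h23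
  obtain rfl := sub_eq_zero.1 h31
  obtain ⟨h23, -, -⟩ := key 0 (y₂ - y₃) (y₃ - y₁) (y₁ - y₂) (by
    ext m
    fin_cases m <;> simp [linePoint, conePoint] <;> ring)
  obtain rfl := sub_eq_zero.1 h23
  obtain ⟨-, h0, -⟩ := key 0 0 1 (-1) (by
    ext m
    fin_cases m <;> simp [linePoint, conePoint])
  exact one_ne_zero h0

/-- Grids on a cone, with one family of points on a generator of the cone. The group `A`
parametrises the points on the generator by `y₀` and the points of the other families by their
coordinates `u k` and `y k`; the points are coplanar if the sum of their parameters is `κ`. -/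
theorem CubePair.hasGrid_of_mem_line (h : CubePair F G O O' i l) {q : ℝ} (hq : q ≠ 0)
    (hQF : Q = q • F) (e : (Fin 4 → ℝ) ≃ₗ[ℝ] U) (hF : ∀ c, F (e c) = c 1 ^ 2 - c 0 * c 2)
    {k₀ : Fin 4}
    (hk₀ : ∀ k b, (e.symm (O k b) 2 = 0 ↔ k = k₀) ∧ (e.symm (O' k b) 2 = 0 ↔ k = k₀))
    {A : Type*} [AddCommGroup A] (κ : A) (y₀ : A → ℝ) (u y : Fin 4 → A → ℝ)
    (hy₀ : ∀ t, G (e (linePoint t)) = 0 → PencilSmooth F G (e (linePoint t)) → ∃ g, y₀ g = t)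
    (huy : ∀ k, k ≠ k₀ → ∀ b a t, (e (conePoint a t) ∈ span ℝ {O k b} ∨
      e (conePoint a t) ∈ span ℝ {O' k b}) → G (e (conePoint a t)) = 0 →
      PencilSmooth F G (e (conePoint a t)) → ∃ g, u k g = a ∧ y k g = t)
    (hrel : ∀ a b c, k₀ ≠ a → k₀ ≠ b → k₀ ≠ c → a ≠ b → a ≠ c → b ≠ c → ∀ g₀ g₁ g₂ g₃,
      u a g₁ ≠ u b g₂ → u a g₁ ≠ u c g₃ → u b g₂ ≠ u c g₃ →
      y a g₁ * (u b g₂ - u c g₃) + y b g₂ * (u c g₃ - u a g₁) + y c g₃ * (u a g₁ - u b g₂) =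
        y₀ g₀ * ((u a g₁ - u b g₂) * (u a g₁ - u c g₃) * (u b g₂ - u c g₃)) →
      g₀ + (g₁ + (g₂ + g₃)) = κ)
    (hcop : ∀ a b c, k₀ ≠ a → k₀ ≠ b → k₀ ≠ c → a ≠ b → a ≠ c → b ≠ c → ∀ g₀ g₁ g₂ g₃,
      g₀ + (g₁ + (g₂ + g₃)) = κ →
      y a g₁ * (u b g₂ - u c g₃) + y b g₂ * (u c g₃ - u a g₁) + y c g₃ * (u a g₁ - u b g₂) =
        y₀ g₀ * ((u a g₁ - u b g₂) * (u a g₁ - u c g₃) * (u b g₂ - u c g₃))) :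
    HasGrid Q O O' i l := by
  classical
  obtain ⟨φ, hφ⟩ : ∃ φ : Fin 4 → A → Fin 4 → ℝ,
      φ = fun k g => if k = k₀ then linePoint (y₀ g) else conePoint (u k g) (y k g) := ⟨_, rfl⟩
  have hφ₀ : ∀ g, φ k₀ g = linePoint (y₀ g) := fun g => by simp [hφ]
  have hφk : ∀ k g, k₀ ≠ k → φ k g = conePoint (u k g) (y k g) := fun k g hk => by
    simp [hφ, hk.symm]
  have hφF : ∀ k g, F (e (φ k g)) = 0 ∧ ∃ v, polar F (e (φ k g)) v ≠ 0 := by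
    intro k g
    rw [hφ]
    dsimp only
    split_ifs
    · refine ⟨by simp [hF, linePoint], e ![0, 0, 1, 0], ?_⟩
      rw [polar_equiv e hF]
      simp [linePoint]
    · refine ⟨by simp [hF, conePoint], e ![1, 0, 0, 0], ?_⟩
      rw [polar_equiv e hF]
      simp [conePoint]
  -- the parameters of the given points
  have hsurj : ∀ k b x, (x = O k b ∨ x = O' k b) → ∃ g, e (φ k g) ∈ span ℝ {x} := by
    intro k b x hx
    have hxF : F x = 0 := by
      rcases hx with rfl | rfl
      · exact h.Q_left k b
      · exact h.Q_right k b
    have hxG : G x = 0 := by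
      rcases hx with rfl | rfl
      · exact h.R_left k b
      · exact h.R_right k b
    have hxs : PencilSmooth F G x := by
      rcases hx with rfl | rfl
      · exact h.smooth_left k b
      · exact h.smooth_right k b
    have hx2 : e.symm x 2 = 0 ↔ k = k₀ := by
      rcases hx with rfl | rfl
      · exact (hk₀ k b).1
      · exact (hk₀ k b).2
    have hx' : ∀ r : ℝ, r ≠ 0 → ∀ c, e c = r⁻¹ • x → e c ∈ span ℝ {x} ∧ G (e c) = 0 ∧
        PencilSmooth F G (e c) := by
      intro r hr c hc
      rw [hc]
      exact ⟨smul_mem _ _ (mem_span_singleton_self _), by rw [QuadraticMap.map_smul, hxG,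
        smul_zero],
        hxs.of_smul (inv_ne_zero hr)⟩
    obtain ⟨c, hc⟩ := e.surjective x
    rw [← hc, e.symm_apply_apply] at hx2
    rw [← hc, hF] at hxF
    by_cases hk : k = k₀
    · have h2 := hx2.2 hk
      have h1 : c 1 = 0 := by simpa [h2] using hxF
      have h0 : c 0 ≠ 0 := by
        intro h0
        have := hxs 1 0 fun v => by
          obtain ⟨d, rfl⟩ := e.surjective v
          rw [← hc, polar_equiv e hF]
          simp [h0, h1, h2]
        exact one_ne_zero this.1
      have h3 : e (linePoint (c 3 / c 0)) = (c 0)⁻¹ • x := by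
        rw [← hc, ← map_smul]
        congr 1
        ext m; fin_cases m <;> simp [linePoint, h0, h1, h2]; field_simp
      obtain ⟨h4, h5, h6⟩ := hx' _ h0 _ h3
      obtain ⟨g, hg⟩ := hy₀ _ h5 h6
      refine ⟨g, ?_⟩
      rw [hk, hφ₀, hg]
      exact h4
    · have h2 : c 2 ≠ 0 := fun h2 => hk (hx2.1 h2)
      have h3 : e (conePoint (c 1 / c 2) (c 3 / c 2)) = (c 2)⁻¹ • x := by
        rw [← hc, ← map_smul]
        congr 1
        ext m
        fin_cases m <;> simp [conePoint, h2]
        · field_simp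
          linear_combination hxF
        · field_simp
        · field_simp
      obtain ⟨h4, h5, h6⟩ := hx' _ h2 _ h3
      obtain ⟨g, hg, hg'⟩ := huy k hk b _ _ (by
        rcases hx with rfl | rfl
        · exact Or.inl h4
        · exact Or.inr h4) h5 h6
      refine ⟨g, ?_⟩
      rw [hφk k g (Ne.symm hk), hg, hg']
      exact h4
  obtain ⟨γ, hγ⟩ : ∃ γ : Fin 4 → U → A, ∀ k b x, (x = O k b ∨ x = O' k b) →
      e (φ k (γ k x)) ∈ span ℝ {x} := by
    refine ⟨fun k x => if hx : ∃ g, e (φ k g) ∈ span ℝ {x} then hx.choose else κ,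
      fun k b x hx => ?_⟩
    have := hsurj k b x hx
    simp only [this, dite_true]
    exact this.choose_spec
  obtain ⟨a, b, c, ha, hb, hc, hab, hac, hbc, -⟩ := exists_enum k₀
  have hcirc : ∀ x : Fin 4 → U, IsCircuit x → (∀ k, e (φ k (γ k (x k))) ∈ span ℝ {x k}) →
      ∑ k, γ k (x k) = κ := by
    intro x hx hmem
    have hne : ∀ k g, e (φ k g) ≠ 0 := by
      intro k g h0
      obtain ⟨v, hv⟩ := (hφF k g).2
      rw [h0] at hv
      simp at hv
    choose r hr hy using fun k => exists_smul_of_mem_span (hne k _) (hmem k)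
    have h1 : IsCircuit fun k => φ k (γ k (x k)) :=
      IsCircuit.of_map e.toLinearMap e.injective (hx.smul hr hy)
    obtain ⟨h2, h3, h4, h5⟩ := h1.dividedDifference ha.symm hb.symm hc.symm hab hac hbc (hφ₀ _)
      (hφk _ _ ha.symm) (hφk _ _ hb.symm) (hφk _ _ hc.symm)
    rw [sum_four ha.symm hb.symm hc.symm hab hac hbc]
    exact hrel _ _ _ ha.symm hb.symm hc.symm hab hac hbc _ _ _ _ h2 h3 h4 h5
  obtain ⟨j, hji, hjl⟩ := exists_ne_ne i l
  refine hasGrid_of_group h.ne h.eq_i h.eq_l h.eq_of_ne (fun k _ g => e (φ k g)) (fun _ => False) κ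
    γ (fun k _ g => ⟨?_, ?_⟩) (fun _ _ g hg => ?_) (fun k b => hγ k b _ (Or.inl rfl))
    (fun k s => hγ k (s k) _ (Or.inr rfl))
    (fun s hs _ => hcirc _ (h.left.circuit s hs) fun k => hγ k (s k) _ (Or.inl rfl))
    (fun s hs _ => hcirc _ (h.right.circuit s hs) fun k => hγ k (s k) _ (Or.inr rfl))
    ⟨j, hji, hjl, id⟩
  · rw [hQF, _root_.smul_apply, (hφF k g).1, smul_zero]
  · obtain ⟨v, hv⟩ := (hφF k g).2
    refine ⟨v, ?_⟩
    rw [hQF]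
    have : polar (q • F) (e (φ k g)) v = q * polar F (e (φ k g)) v := by
      simp only [polar, _root_.smul_apply, smul_eq_mul]; ring
    have h0 := mul_ne_zero hq hv
    rwa [← this] at h0
  · intro hli
    have hsum := hg id
    rw [sum_four ha.symm hb.symm hc.symm hab hac hbc] at hsum
    refine not_linearIndependent_of_dividedDifference (x := fun k => φ k (g k)) ha.symm hb.symm
      hc.symm hab hac hbc (hφ₀ _) (hφk _ _ ha.symm) (hφk _ _ hb.symm) (hφk _ _ hc.symm)
      (hcop _ _ _ ha.symm hb.symm hc.symm hab hac hbc _ _ _ _ hsum) ?_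
    exact (LinearMap.linearIndependent_iff_of_injOn (f := e.toLinearMap) e.injective.injOn).1 hli

theorem units_sum_eq_iff {g₀ g₁ g₂ g₃ κ : Additive ℝˣ} : g₀ + (g₁ + (g₂ + g₃)) = κ ↔
    (g₀.toMul : ℝ) * (g₁.toMul * (g₂.toMul * g₃.toMul)) = κ.toMul := by
  rw [← Additive.toMul.injective.eq_iff, Units.ext_iff]
  simp

theorem PencilSmooth.linePoint_ne_zero (e : (Fin 4 → ℝ) ≃ₗ[ℝ] U) {s t : ℝ}
    (hG : ∀ c, G (e c) = c 3 * c 1 - s * c 2 ^ 2) (h : PencilSmooth F G (e (linePoint t))) :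
    t ≠ 0 := by
  rintro rfl
  have := h 0 1 fun u => by
    obtain ⟨d, rfl⟩ := e.surjective u
    rw [polar_equiv e hG]
    simp [linePoint]
  exact one_ne_zero this.2

/-- Grids on a curve which consists of a twisted cubic `y = s / u` and one of its secants. The
product of the parameters of coplanar points is `s`. -/
theorem CubePair.hasGrid_of_secant (h : CubePair F G O O' i l) {q : ℝ} (hq : q ≠ 0)
    (hQF : Q = q • F) (e : (Fin 4 → ℝ) ≃ₗ[ℝ] U) (hF : ∀ c, F (e c) = c 1 ^ 2 - c 0 * c 2)
    {s : ℝ} (hs : s ≠ 0) (hG : ∀ c, G (e c) = c 3 * c 1 - s * c 2 ^ 2)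
    {k₀ : Fin 4}
    (hk₀ : ∀ k b, (e.symm (O k b) 2 = 0 ↔ k = k₀) ∧ (e.symm (O' k b) 2 = 0 ↔ k = k₀)) :
    HasGrid Q O O' i l := by
  have hdd : ∀ a b c : ℝ, a ≠ 0 → b ≠ 0 → c ≠ 0 →
      (s * a⁻¹ * (b - c) + s * b⁻¹ * (c - a) + s * c⁻¹ * (a - b)) * (a * (b * c)) =
        s * ((a - b) * (a - c) * (b - c)) := by
    intro a b c ha hb hc
    field_simp
    ring
  refine h.hasGrid_of_mem_line hq hQF e hF hk₀ (A := Additive ℝˣ)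
    (Additive.ofMul (Units.mk0 s hs)) (fun g => g.toMul) (fun _ g => g.toMul)
    (fun _ g => s * (g.toMul : ℝ)⁻¹) ?_ ?_ ?_ ?_
  · intro t _ ht
    exact ⟨Additive.ofMul (Units.mk0 t (ht.linePoint_ne_zero e hG)), rfl⟩
  · intro k _ b a t _ hat _
    rw [hG] at hat
    simp [conePoint] at hat
    have ha : a ≠ 0 := by
      rintro rfl
      apply hs
      linear_combination -hat
    refine ⟨Additive.ofMul (Units.mk0 a ha), rfl, ?_⟩
    change s * a⁻¹ = t
    field_simp
    linear_combination -hat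
  · intro a b c _ _ _ _ _ _ g₀ g₁ g₂ g₃ h12 h13 h23 heq
    rw [units_sum_eq_iff]
    have h1 := hdd g₁.toMul g₂.toMul g₃.toMul g₁.toMul.ne_zero g₂.toMul.ne_zero g₃.toMul.ne_zero
    rw [heq] at h1
    refine mul_right_cancel₀ (mul_ne_zero (mul_ne_zero (sub_ne_zero.2 h12) (sub_ne_zero.2 h13))
      (sub_ne_zero.2 h23)) ?_
    refine Eq.trans ?_ h1
    ring
  · intro a b c _ _ _ _ _ _ g₀ g₁ g₂ g₃ heq
    rw [units_sum_eq_iff] at heq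
    have h1 := hdd g₁.toMul g₂.toMul g₃.toMul g₁.toMul.ne_zero g₂.toMul.ne_zero g₃.toMul.ne_zero
    refine mul_right_cancel₀ (mul_ne_zero g₁.toMul.ne_zero
      (mul_ne_zero g₂.toMul.ne_zero g₃.toMul.ne_zero)) ?_
    rw [h1]
    have heq' : (g₀.toMul : ℝ) * (g₁.toMul * (g₂.toMul * g₃.toMul)) = s := heq
    rw [← heq']
    ring

/-- Grids on a curve which consists of two generators of the cone and a conic. The points on the
second generator form another family; the parameters are multiplied. -/
theorem CubePair.hasGrid_of_two_lines (h : CubePair F G O O' i l) {q : ℝ} (hq : q ≠ 0)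
    (hQF : Q = q • F) (e : (Fin 4 → ℝ) ≃ₗ[ℝ] U) (hF : ∀ c, F (e c) = c 1 ^ 2 - c 0 * c 2)
    (hG : ∀ c, G (e c) = c 3 * c 1)
    {k₀ k₁ : Fin 4}
    (hk₀ : ∀ k b, (e.symm (O k b) 2 = 0 ↔ k = k₀) ∧ (e.symm (O' k b) 2 = 0 ↔ k = k₀))
    (hk₁ : ∀ k b, (e.symm (O k b) 0 = 0 ↔ k = k₁) ∧ (e.symm (O' k b) 0 = 0 ↔ k = k₁)) :
    HasGrid Q O O' i l := by
  have h01 : k₀ ≠ k₁ := by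
    intro h01
    have h2 := (hk₀ k₀ true).1.2 rfl
    have h0 := (hk₁ k₀ true).1.2 h01
    have h1 := h.Q_left k₀ true
    have := h.smooth_left k₀ true 1 0 fun v => by
      obtain ⟨c, hc⟩ := e.surjective (O k₀ true)
      obtain ⟨d, rfl⟩ := e.surjective v
      rw [← hc, e.symm_apply_apply] at h0 h2
      rw [← hc, hF, h0] at h1
      have h1 : c 1 = 0 := by simpa using h1
      rw [← hc, polar_equiv e hF]
      simp [h0, h1, h2]
    exact one_ne_zero this.1
  have hmem : ∀ a b c, k₀ ≠ a → k₀ ≠ b → k₀ ≠ c → a ≠ b → a ≠ c → b ≠ c →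
      a = k₁ ∧ b ≠ k₁ ∧ c ≠ k₁ ∨ a ≠ k₁ ∧ b = k₁ ∧ c ≠ k₁ ∨ a ≠ k₁ ∧ b ≠ k₁ ∧ c = k₁ := by
    clear * - h01
    revert k₀ k₁
    decide
  refine h.hasGrid_of_mem_line hq hQF e hF hk₀ (A := Additive ℝˣ) 0 (fun g => g.toMul)
    (fun k g => if k = k₁ then 0 else g.toMul) (fun k g => if k = k₁ then (g.toMul : ℝ)⁻¹ else 0)
    ?_ ?_ ?_ ?_
  · intro t _ ht
    exact ⟨Additive.ofMul (Units.mk0 t (ht.linePoint_ne_zero (s := 0) e (by simp [hG]))), rfl⟩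
  · intro k _ b a t hmem hat hsm
    rw [hG] at hat
    have ha : a = 0 ↔ k = k₁ := by
      have h1 : ∀ x, (e.symm x 0 = 0 ↔ k = k₁) → e (conePoint a t) ∈ span ℝ {x} →
          (a = 0 ↔ k = k₁) := by
        intro x hx hm
        obtain ⟨r, hr, hrx⟩ := exists_smul_of_mem_span hsm.ne_zero hm
        have h2 := congrArg (fun x => e.symm x 0) hrx
        simp [conePoint] at h2
        rw [← hx, ← pow_eq_zero_iff two_ne_zero, h2]
        simp [hr]
      rcases hmem with hm | hm
      · exact h1 _ (hk₁ k b).1 hm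
      · exact h1 _ (hk₁ k b).2 hm
    by_cases hk : k = k₁
    · have ha0 := ha.2 hk
      have ht : t ≠ 0 := by
        rintro rfl
        have := hsm 0 1 fun u => by
          obtain ⟨d, rfl⟩ := e.surjective u
          rw [polar_equiv e hG]
          simp [conePoint, ha0]
        exact one_ne_zero this.2
      refine ⟨Additive.ofMul (Units.mk0 t⁻¹ (inv_ne_zero ht)), ?_, ?_⟩
      · rw [if_pos hk, ha0]
      · rw [if_pos hk]
        exact inv_inv t
    · have ha0 : a ≠ 0 := fun h0 => hk (ha.1 h0)
      have ht : t = 0 := by simpa [conePoint, ha0] using hat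
      refine ⟨Additive.ofMul (Units.mk0 a ha0), ?_, ?_⟩
      · rw [if_neg hk]
        rfl
      · rw [if_neg hk, ht]
  · intro a b c ha hb hc hab hac hbc g₀ g₁ g₂ g₃ h12 h13 h23 heq
    rw [units_sum_eq_iff]
    change _ = (1 : ℝ)
    have hg₁ := g₁.toMul.ne_zero
    have hg₂ := g₂.toMul.ne_zero
    have hg₃ := g₃.toMul.ne_zero
    rcases hmem a b c ha hb hc hab hac hbc with ⟨h1, h2, h3⟩ | ⟨h1, h2, h3⟩ | ⟨h1, h2, h3⟩ <;>
    simp only [h1, h2, h3, if_true, if_false] at h12 h13 h23 heq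
    · refine mul_right_cancel₀ (sub_ne_zero.2 h23) ?_
      field_simp at heq
      linear_combination -heq
    · refine mul_right_cancel₀ (sub_ne_zero.2 h13) ?_
      field_simp at heq
      linear_combination heq
    · refine mul_right_cancel₀ (sub_ne_zero.2 h12) ?_
      field_simp at heq
      linear_combination -heq
  · intro a b c ha hb hc hab hac hbc g₀ g₁ g₂ g₃ heq
    rw [units_sum_eq_iff] at heq
    change _ = (1 : ℝ) at heq
    have hg₁ := g₁.toMul.ne_zero
    have hg₂ := g₂.toMul.ne_zero
    have hg₃ := g₃.toMul.ne_zero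
    rcases hmem a b c ha hb hc hab hac hbc with ⟨h1, h2, h3⟩ | ⟨h1, h2, h3⟩ | ⟨h1, h2, h3⟩ <;>
    simp only [h1, h2, h3, if_true, if_false]
    · field_simp
      linear_combination -(g₂.toMul - g₃.toMul : ℝ) * heq
    · field_simp
      linear_combination (g₁.toMul - g₃.toMul : ℝ) * heq
    · field_simp
      linear_combination -(g₁.toMul - g₂.toMul : ℝ) * heq

/-- Grids on a curve which consists of a twisted cubic `y = r u³` and one of its tangents. The
second divided difference of `u³` is the sum of the nodes. -/
theorem CubePair.hasGrid_of_tangent (h : CubePair F G O O' i l) {q : ℝ} (hq : q ≠ 0)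
    (hQF : Q = q • F) (e : (Fin 4 → ℝ) ≃ₗ[ℝ] U) (hF : ∀ c, F (e c) = c 1 ^ 2 - c 0 * c 2)
    {r : ℝ} (hG : ∀ c, G (e c) = c 3 * c 2 - r * c 0 * c 1)
    {k₀ : Fin 4}
    (hk₀ : ∀ k b, (e.symm (O k b) 2 = 0 ↔ k = k₀) ∧ (e.symm (O' k b) 2 = 0 ↔ k = k₀)) :
    HasGrid Q O O' i l := by
  have hr : r ≠ 0 := by
    rintro rfl
    have h2 := (hk₀ k₀ true).1.2 rfl
    have h1 := h.Q_left k₀ true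
    have hsm := h.smooth_left k₀ true
    obtain ⟨c, hc⟩ := e.surjective (O k₀ true)
    rw [← hc, e.symm_apply_apply] at h2
    rw [← hc, hF, h2] at h1
    have h1 : c 1 = 0 := by simpa using h1
    rw [← hc] at hsm
    have h3 := hsm (c 3) (c 0) fun u => by
      obtain ⟨d, rfl⟩ := e.surjective u
      rw [polar_equiv e hF, polar_equiv e hG]
      simp [h1, h2]
      ring
    have := hsm 1 0 fun u => by
      obtain ⟨d, rfl⟩ := e.surjective u
      rw [polar_equiv e hF]
      simp [h1, h2, h3.2]
    exact one_ne_zero this.1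
  refine h.hasGrid_of_mem_line hq hQF e hF hk₀ (A := ℝ) 0 (fun g => -r * g) (fun _ g => g)
    (fun _ g => r * g ^ 3) ?_ ?_ ?_ ?_
  · intro t _ _
    refine ⟨-t / r, ?_⟩
    field_simp
  · intro k _ b a t _ hat _
    refine ⟨a, rfl, ?_⟩
    rw [hG] at hat
    simp [conePoint] at hat
    linear_combination -hat
  · intro a b c _ _ _ _ _ _ g₀ g₁ g₂ g₃ h12 h13 h23 heq
    refine (mul_eq_zero.1 (?_ : (r * ((g₁ - g₂) * (g₁ - g₃) * (g₂ - g₃))) * _ = 0)).resolve_left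
      (mul_ne_zero hr (mul_ne_zero (mul_ne_zero (sub_ne_zero.2 h12) (sub_ne_zero.2 h13))
        (sub_ne_zero.2 h23)))
    linear_combination heq
  · intro a b c _ _ _ _ _ _ g₀ g₁ g₂ g₃ heq
    linear_combination r * ((g₁ - g₂) * (g₁ - g₃) * (g₂ - g₃)) * heq

/-- If all quadrics of the pencil are cones with the same vertex, then apart from the points on one
generator the points of each family of a cube lie on one generator. -/
theorem IsCube.slope_eq (hO : IsCube O) (e : (Fin 4 → ℝ) ≃ₗ[ℝ] U)
    (hF : ∀ c, F (e c) = c 1 ^ 2 - c 0 * c 2) {α β γ δ : ℝ}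
    (hG : ∀ c, G (e c) = α * c 0 * c 1 + β * c 0 * c 2 + γ * c 1 * c 2 + δ * c 2 ^ 2)
    (hFO : ∀ k b, F (O k b) = 0) (hGO : ∀ k b, G (O k b) = 0)
    (hs : ∀ k b, PencilSmooth F G (O k b))
    (hN : ∀ s, IsVertexLabel s → e ![0, 0, 0, 1] ∉ span ℝ (Set.range fun k => O k (s k)))
    {k₀ : Fin 4} (hk₀ : ∀ k b, e.symm (O k b) 2 = 0 ↔ k = k₀) :
    (∀ j k b c, j ≠ k → j ≠ k₀ → k ≠ k₀ →
      e.symm (O j b) 1 / e.symm (O j b) 2 ≠ e.symm (O k c) 1 / e.symm (O k c) 2) ∧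
    ∀ k b c, k ≠ k₀ →
      e.symm (O k b) 1 / e.symm (O k b) 2 = e.symm (O k c) 1 / e.symm (O k c) 2 := by
  have hne : ∀ j k b c, j ≠ k → j ≠ k₀ → k ≠ k₀ →
      e.symm (O j b) 1 / e.symm (O j b) 2 ≠ e.symm (O k c) 1 / e.symm (O k c) 2 := by
    intro j k b c hjk hj hk heq
    obtain ⟨s, hsv, rfl, rfl⟩ : ∃ s, IsVertexLabel s ∧ s j = b ∧ s k = c := by
      clear * - hjk
      revert j k b c; decide
    exact hjk ((hO.circuit s hsv).eq_of_slope_eq e hF (fun k => hFO k _) (hN s hsv)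
      (fun h0 => hj ((hk₀ _ _).1 h0)) (fun h0 => hk ((hk₀ _ _).1 h0)) heq)
  refine ⟨hne, fun k b c hk => ?_⟩
  by_contra hbc
  obtain ⟨m, hmk, hm⟩ := exists_ne_ne k k₀
  obtain ⟨n, hnk, hn, hnm⟩ := exists_ne_ne_ne k k₀ m
  have hroot : ∀ k b, k ≠ k₀ → δ + γ * (e.symm (O k b) 1 / e.symm (O k b) 2) +
      β * (e.symm (O k b) 1 / e.symm (O k b) 2) ^ 2 +
      α * (e.symm (O k b) 1 / e.symm (O k b) 2) ^ 3 = 0 := by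
    intro k b hk
    have h1 := hFO k b
    have h2 := hGO k b
    have h4 : e.symm (O k b) 2 ≠ 0 := fun h0 => hk ((hk₀ k b).1 h0)
    obtain ⟨c, hc⟩ := e.surjective (O k b)
    rw [← hc] at h1 h2 h4 ⊢
    rw [hF] at h1
    rw [hG] at h2
    simp only [e.symm_apply_apply] at h4 ⊢
    obtain ⟨u, hu⟩ : ∃ u, u = c 1 / c 2 := ⟨_, rfl⟩
    have h5 : c 1 = u * c 2 := by rw [hu]; field_simp
    have h6 : c 0 = u ^ 2 * c 2 := by
      refine mul_right_cancel₀ h4 ?_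
      rw [h5] at h1
      linear_combination -h1
    rw [← hu]
    refine mul_left_cancel₀ (pow_ne_zero 2 h4) ?_
    rw [h5, h6] at h2
    linear_combination h2
  obtain ⟨x, hx⟩ : ∃ x : Fin 4 → ℝ, x = ![e.symm (O k b) 1 / e.symm (O k b) 2,
    e.symm (O k c) 1 / e.symm (O k c) 2, e.symm (O m true) 1 / e.symm (O m true) 2,
    e.symm (O n true) 1 / e.symm (O n true) 2] := ⟨_, rfl⟩
  have hinj : Function.Injective x := by
    have h1 := hne k m b true hmk.symm hk hm
    have h2 := hne k n b true hnk.symm hk hn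
    have h3 := hne k m c true hmk.symm hk hm
    have h4 := hne k n c true hnk.symm hk hn
    have h5 := hne m n true true hnm.symm hm hn
    intro p q hpq
    rw [hx] at hpq
    fin_cases p <;> fin_cases q <;>
      first
      | rfl
      | exact absurd hpq hbc
      | exact absurd hpq.symm hbc
      | exact absurd hpq h1
      | exact absurd hpq.symm h1
      | exact absurd hpq h2
      | exact absurd hpq.symm h2
      | exact absurd hpq h3
      | exact absurd hpq.symm h3
      | exact absurd hpq h4
      | exact absurd hpq.symm h4
      | exact absurd hpq h5
      | exact absurd hpq.symm h5
  have hzero : (![δ, γ, β, α] : Fin 4 → ℝ) = 0 := by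
    refine Matrix.eq_zero_of_forall_index_sum_pow_mul_eq_zero hinj fun p => ?_
    have hp : δ + γ * x p + β * x p ^ 2 + α * x p ^ 3 = 0 := by
      rw [hx]
      fin_cases p
      · exact hroot k b hk
      · exact hroot k c hk
      · exact hroot m true hm
      · exact hroot n true hn
    simp [Fin.sum_univ_four]
    linear_combination hp
  have v0 := congrFun hzero 0
  have v1 := congrFun hzero 1
  have v2 := congrFun hzero 2
  have v3 := congrFun hzero 3
  simp at v0 v1 v2 v3
  have := hs 0 true 0 1 fun u => by
    obtain ⟨d, rfl⟩ := e.surjective u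
    rw [← e.apply_symm_apply (O 0 true), polar_equiv e hG]
    simp [v0, v1, v2, v3]
  exact one_ne_zero this.2

/-- Grids on four generators of the cone, one for each family of points. By Lagrange interpolation,
the second divided difference is a linear combination of the coordinates `y`. -/
theorem CubePair.hasGrid_of_four_lines (h : CubePair F G O O' i l) {q : ℝ} (hq : q ≠ 0)
    (hQF : Q = q • F) (e : (Fin 4 → ℝ) ≃ₗ[ℝ] U) (hF : ∀ c, F (e c) = c 1 ^ 2 - c 0 * c 2)
    {α β γ δ : ℝ}
    (hG : ∀ c, G (e c) = α * c 0 * c 1 + β * c 0 * c 2 + γ * c 1 * c 2 + δ * c 2 ^ 2)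
    (hN : ∀ s, IsVertexLabel s → e ![0, 0, 0, 1] ∉ span ℝ (Set.range fun k => O k (s k)))
    (hN' : ∀ s, IsVertexLabel s → e ![0, 0, 0, 1] ∉ span ℝ (Set.range fun k => O' k (s k)))
    {k₀ : Fin 4}
    (hk₀ : ∀ k b, (e.symm (O k b) 2 = 0 ↔ k = k₀) ∧ (e.symm (O' k b) 2 = 0 ↔ k = k₀)) :
    HasGrid Q O O' i l := by
  obtain ⟨hne, heq⟩ := h.left.slope_eq e hF hG h.Q_left h.R_left h.smooth_left hN
    fun k b => (hk₀ k b).1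
  obtain ⟨-, heq'⟩ := h.right.slope_eq e hF hG h.Q_right h.R_right h.smooth_right hN'
    fun k b => (hk₀ k b).2
  obtain ⟨v, hv⟩ : ∃ v : Fin 4 → ℝ, v = fun k => e.symm (O k true) 1 / e.symm (O k true) 2 :=
    ⟨_, rfl⟩
  have hvk : ∀ k b, k ≠ k₀ → e.symm (O k b) 1 / e.symm (O k b) 2 = v k := by
    intro k b hk
    rw [hv]
    exact heq k b true hk
  have hvk' : ∀ k b, k ≠ k₀ → e.symm (O' k b) 1 / e.symm (O' k b) 2 = v k := by
    intro k b hk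
    by_cases hi : k = i
    · rw [heq' k b false hk, hi, h.eq_i, ← hi, hvk k true hk]
    by_cases hl : k = l
    · rw [heq' k b true hk, hl, h.eq_l, ← hl, hvk k false hk]
    · rw [h.eq_of_ne k hi hl, hvk k b hk]
  have hvne : ∀ j k, j ≠ k → j ≠ k₀ → k ≠ k₀ → v j ≠ v k := by
    intro j k hjk hj hk
    rw [hv]
    exact hne j k true true hjk hj hk
  -- the weights of Lagrange interpolation
  obtain ⟨w, hw⟩ : ∃ w : Fin 4 → ℝ, w = fun k =>
      ∏ j ∈ Finset.univ.filter (fun j => j ≠ k ∧ j ≠ k₀), (v k - v j) := ⟨_, rfl⟩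
  have hw0 : ∀ k, k ≠ k₀ → w k ≠ 0 := by
    intro k hk
    rw [hw]
    refine Finset.prod_ne_zero_iff.2 fun j hj => ?_
    have hj := (Finset.mem_filter.1 hj).2
    exact sub_ne_zero.2 (hvne k j hj.1.symm hk hj.2)
  have hwk : ∀ a b c, k₀ ≠ a → k₀ ≠ b → k₀ ≠ c → a ≠ b → a ≠ c → b ≠ c →
      w a = (v a - v b) * (v a - v c) := by
    intro a b c ha hb hc hab hac hbc
    have hfil : Finset.univ.filter (fun j => j ≠ a ∧ j ≠ k₀) = {b, c} := by
      clear * - ha hb hc hab hac hbc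
      revert a b c k₀; decide
    rw [hw]
    simp only [hfil]
    rw [Finset.prod_pair hbc]
  refine h.hasGrid_of_mem_line hq hQF e hF hk₀ (A := ℝ) 0 (fun g => g) (fun k _ => v k)
    (fun k g => -g * w k) ?_ ?_ ?_ ?_
  · exact fun t _ _ => ⟨t, rfl⟩
  · intro k hk b a t hmem _ hsm
    have ha : ∀ x, e (conePoint a t) ∈ span ℝ {x} → e.symm x 1 / e.symm x 2 = a := by
      intro x hm
      obtain ⟨r, hr, hrx⟩ := exists_smul_of_mem_span hsm.ne_zero hm
      have h1 := congrArg (fun x => e.symm x 1) hrx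
      have h2 := congrArg (fun x => e.symm x 2) hrx
      simp [conePoint] at h1 h2
      rw [h1, ← mul_div_mul_left _ _ hr, ← h2, div_one]
    refine ⟨-t / w k, ?_, ?_⟩
    · rcases hmem with hm | hm
      · rw [← ha _ hm, hvk k b hk]
      · rw [← ha _ hm, hvk' k b hk]
    · have := hw0 k hk
      field_simp
  · intro a b c ha hb hc hab hac hbc g₀ g₁ g₂ g₃ h12 h13 h23 h0
    rw [hwk a b c ha hb hc hab hac hbc, hwk b a c hb ha hc hab.symm hbc hac,
      hwk c a b hc ha hb hac.symm hbc.symm hab] at h0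
    refine (mul_eq_zero.1 (?_ : ((v a - v b) * (v a - v c) * (v b - v c)) * _ = 0)).resolve_left
      (mul_ne_zero (mul_ne_zero (sub_ne_zero.2 h12) (sub_ne_zero.2 h13)) (sub_ne_zero.2 h23))
    linear_combination -h0
  · intro a b c ha hb hc hab hac hbc g₀ g₁ g₂ g₃ h0
    rw [hwk a b c ha hb hc hab hac hbc, hwk b a c hb ha hc hab.symm hbc hac,
      hwk c a b hc ha hb hac.symm hbc.symm hab]
    linear_combination -((v a - v b) * (v a - v c) * (v b - v c)) * h0

/-- Coordinates for a cone and a second quadric through one of its generators. The vertex of the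
cone is the last unit vector, and the generator is `c₁ = c₂ = 0`. -/
theorem CubePair.exists_cone_coordinates (h : CubePair Q R O O' i l) {a N : U}
    (hrad : ∀ z, (∀ u, polar Q z u = 0) → z ∈ span ℝ {N}) (hN : ∀ u, polar Q N u = 0)
    (haN : a ∉ span ℝ {N}) (hNa : N ≠ 0) (hQa : Q a = 0) (hRa : R a = 0) (hRN : R N = 0)
    (hRaN : polar R a N = 0) :
    ∃ (F G : QuadraticForm ℝ U) (q : ℝ), CubePair F G O O' i l ∧ q ≠ 0 ∧ Q = q • F ∧
      ∃ (e : (Fin 4 → ℝ) ≃ₗ[ℝ] U) (l₁ l₂ α β γ δ : ℝ), e ![0, 0, 0, 1] = N ∧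
        (∀ c, F (e c) = c 1 ^ 2 - c 0 * c 2) ∧
        ∀ c, G (e c) = c 3 * (l₁ * c 1 + l₂ * c 2) + α * c 0 * c 1 + β * c 0 * c 2 +
          γ * c 1 * c 2 + δ * c 2 ^ 2 := by
  have hQN : Q N = 0 := by
    have := hN N
    rw [polar_self] at this
    exact (smul_eq_zero.1 this).resolve_left two_ne_zero
  have hN' : ∀ u, polar Q u N = 0 := fun u => by rw [polar_comm]; exact hN u
  obtain ⟨b₀, hb₀⟩ : ∃ b₀, polar Q a b₀ ≠ 0 := by
    by_contra! h0
    exact haN (hrad a h0)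
  obtain ⟨b, hQb, hab⟩ : ∃ b, Q b = 0 ∧ polar Q a b ≠ 0 := by
    refine ⟨b₀ - (Q b₀ / polar Q a b₀) • a, ?_, ?_⟩
    · rw [sub_eq_add_neg, ← neg_smul, QuadraticMap.map_add Q, QuadraticMap.map_smul, hQa,
        polar_smul_right, polar_comm Q b₀ a]
      simp
      field_simp
      ring
    · rw [polar_sub_right, polar_smul_right, polar_self, hQa]
      simpa using hb₀
  obtain ⟨p, hp⟩ : ∃ p, p = polar Q a b := ⟨_, rfl⟩
  rw [← hp] at hab
  have hba : polar Q b a = p := by rw [hp, polar_comm]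
  obtain ⟨c₀, hc₀⟩ : ∃ c₀, c₀ ∉ span ℝ (Set.range ![a, b, N]) := by
    by_contra! h0
    have h1 : span ℝ (Set.range ![a, b, N]) = ⊤ := eq_top_iff.2 fun x _ => h0 x
    have h2 := finrank_range_le_card (R := ℝ) ![a, b, N]
    rw [Set.finrank, h1, finrank_top, h.finrank_eq] at h2
    simp at h2
  have hmem : ∀ k, (![a, b, N] : Fin 3 → U) k ∈ span ℝ (Set.range ![a, b, N]) :=
    fun k => subset_span ⟨k, rfl⟩
  obtain ⟨c, hc, hca, hcb⟩ : ∃ c, c ∉ span ℝ (Set.range ![a, b, N]) ∧ polar Q c a = 0 ∧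
      polar Q c b = 0 := by
    refine ⟨c₀ - (polar Q c₀ b / p) • a - (polar Q c₀ a / p) • b, fun h0 => hc₀ ?_, ?_, ?_⟩
    · have := add_mem (add_mem h0 (smul_mem _ (polar Q c₀ a / p) (hmem 1)))
        (smul_mem _ (polar Q c₀ b / p) (hmem 0))
      simpa using this
    · rw [polar_sub_left, polar_sub_left, polar_smul_left, polar_smul_left, polar_self, hQa, hba]
      simp
      field_simp
      ring
    · rw [polar_sub_left, polar_sub_left, polar_smul_left, polar_smul_left, polar_self, hQb, ← hp]
      simp
      field_simp
      ring
  have hac : polar Q a c = 0 := by rw [polar_comm]; exact hca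
  have hbc : polar Q b c = 0 := by rw [polar_comm]; exact hcb
  have hli : LinearIndependent ℝ ![a, c, b, N] := by
    rw [Fintype.linearIndependent_iff]
    intro x hx
    rw [Fin.sum_univ_four] at hx
    simp only [Matrix.cons_val] at hx
    have h2 : x 2 = 0 := by
      have := congrArg (polarBilin Q a) hx
      simp only [map_add, map_smul, map_zero, polarBilin_apply_apply, polar_self, hQa, hac, hN',
        ← hp, smul_eq_mul] at this
      have h1 : x 2 * p = 0 := by linear_combination this
      exact (mul_eq_zero.1 h1).resolve_right hab
    have h0 : x 0 = 0 := by
      have := congrArg (polarBilin Q b) hx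
      simp only [map_add, map_smul, map_zero, polarBilin_apply_apply, polar_self, hQb, hbc, hN',
        hba, smul_eq_mul] at this
      have h1 : x 0 * p = 0 := by linear_combination this
      exact (mul_eq_zero.1 h1).resolve_right hab
    have h1 : x 1 = 0 := by
      by_contra h1
      apply hc
      have h3 : c = (-(x 1)⁻¹ * x 3) • N := by
        rw [h0, h2, zero_smul, zero_smul, zero_add, add_zero] at hx
        rw [mul_smul, eq_neg_of_add_eq_zero_right hx, smul_neg, neg_smul, neg_neg, smul_smul,
          inv_mul_cancel₀ h1, one_smul]
      rw [h3]
      exact smul_mem _ _ (hmem 2)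
    rw [h0, h1, h2, zero_smul, zero_smul, zero_smul, zero_add, zero_add, zero_add] at hx
    have h3 := (smul_eq_zero.1 hx).resolve_right hNa
    intro k
    fin_cases k
    · exact h0
    · exact h1
    · exact h2
    · exact h3
  have hQc : Q c ≠ 0 := by
    intro hQc
    have hcN : c ∈ span ℝ {N} := by
      refine hrad c fun u => ?_
      have h1 : polarBilin Q c = 0 := by
        refine (basisOfLinearIndependentOfCardEqFinrank hli (by simp [h.finrank_eq])).ext fun k => ?_
        rw [coe_basisOfLinearIndependentOfCardEqFinrank]
        fin_cases k
        · exact hca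
        · exact (polar_self Q c).trans (by rw [hQc, smul_zero]; rfl)
        · exact hcb
        · exact hN' c
      exact congrArg (fun f => f u) h1
    obtain ⟨r, rfl⟩ := mem_span_singleton.1 hcN
    exact hc (smul_mem _ _ (hmem 2))
  obtain ⟨t, ht⟩ : ∃ t, t = -(Q c) / p := ⟨_, rfl⟩
  have ht0 : t ≠ 0 := by rw [ht]; exact div_ne_zero (neg_ne_zero.2 hQc) hab
  have hli' : LinearIndependent ℝ ![a, c, t • b, N] := by
    have := hli.units_smul ![1, 1, Units.mk0 t ht0, 1]
    convert this using 1
    ext k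
    fin_cases k <;> simp [Units.smul_def]
  set w : Fin 4 → U := ![a, c, t • b, N] with hw
  set B := basisOfLinearIndependentOfCardEqFinrank hli' (by simp [h.finrank_eq]) with hB
  have hBe : ∀ x, B.equivFun.symm x = ∑ k, x k • w k := by
    intro x
    rw [Module.Basis.equivFun_symm_apply]
    simp [hB]
  have hpt : polar Q a (t • b) = -Q c := by
    rw [polar_smul_right, ← hp, ht, smul_eq_mul, div_mul_cancel₀ _ hab]
  have hF : ∀ x, ((Q c)⁻¹ • Q) (B.equivFun.symm x) = x 1 ^ 2 - x 0 * x 2 := by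
    intro x
    rw [hBe, _root_.smul_apply, quadraticForm_sum_four]
    simp only [hw, Matrix.cons_val]
    rw [hpt, hQa, hQN, hac, hN', hN', hN', QuadraticMap.map_smul, hQb, polar_smul_right, hcb]
    simp only [smul_eq_mul]
    field_simp
    ring
  have hdet : (Q c)⁻¹ * 1 - 0 * (-(R c) * (Q c)⁻¹) ≠ 0 := by simpa using hQc
  refine ⟨(Q c)⁻¹ • Q, (-(R c) * (Q c)⁻¹) • Q + (1 : ℝ) • R, Q c, h.change hdet (by simp) rfl, hQc,
    ?_,
    B.equivFun.symm, polar R c N, polar R (t • b) N, polar R a c, polar R a (t • b) + R c,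
    polar R c (t • b), R (t • b), ?_, hF, fun x => ?_⟩
  · rw [smul_smul, mul_inv_cancel₀ hQc, one_smul]
  · rw [hBe, Fin.sum_univ_four]
    simp [hw]
  · have h1 := hF x
    rw [_root_.smul_apply, smul_eq_mul] at h1
    rw [_root_.add_apply, _root_.smul_apply, _root_.smul_apply, smul_eq_mul, smul_eq_mul,
      mul_assoc, h1,
      hBe, quadraticForm_sum_four]
    simp only [hw, Matrix.cons_val]
    rw [hRa, hRN, hRaN]
    ring

/-- If the curve contains a line through the vertex of a cone, then the points `(u², u, 1, y)` of
the curve satisfy `y (l₁ u + l₂) = p u` for a polynomial `p` of degree at most three. Adding a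
quadratic polynomial in `u` to `y` is a linear change of coordinates, so if `l₁` and `l₂` do not
both vanish, the equation can be reduced to `y = r u³` for `l₁ = 0` and to `y u = s` for `l₁ ≠ 0`.
For `l₁ = l₂ = 0` the curve consists of generators. -/
theorem CubePair.hasGrid_of_cone (h : CubePair F G O O' i l) {q : ℝ} (hq : q ≠ 0)
    (hQF : Q = q • F) (e : (Fin 4 → ℝ) ≃ₗ[ℝ] U) (hF : ∀ c, F (e c) = c 1 ^ 2 - c 0 * c 2)
    {l₁ l₂ α β γ δ : ℝ} (hG : ∀ c, G (e c) = c 3 * (l₁ * c 1 + l₂ * c 2) + α * c 0 * c 1 +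
      β * c 0 * c 2 + γ * c 1 * c 2 + δ * c 2 ^ 2)
    (hN : ∀ s, IsVertexLabel s → e ![0, 0, 0, 1] ∉ span ℝ (Set.range fun k => O k (s k)))
    (hN' : ∀ s, IsVertexLabel s → e ![0, 0, 0, 1] ∉ span ℝ (Set.range fun k => O' k (s k))) :
    HasGrid Q O O' i l := by
  by_cases hl : l₁ = 0
  · by_cases hl' : l₂ = 0
    · obtain ⟨k₀, hk₀⟩ := h.exists_mem_line_iff e hF hG hN hN'
      exact h.hasGrid_of_four_lines hq hQF e hF (α := α) (β := β) (γ := γ) (δ := δ)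
        (fun c => by rw [hG, hl, hl']; ring) hN hN' hk₀
    · obtain ⟨T, hT⟩ := exists_equiv_mulVec
        !![1, 0, 0, 0; 0, 1, 0, 0; 0, 0, 1, 0; -β / l₂, -γ / l₂, -δ / l₂, 1]
        !![1, 0, 0, 0; 0, 1, 0, 0; 0, 0, 1, 0; β / l₂, γ / l₂, δ / l₂, 1] (by
          ext i j; fin_cases i <;> fin_cases j <;> simp [Matrix.mul_apply,
            Fin.sum_univ_four] <;> ring)
      have hTN : (T.trans e) ![0, 0, 0, 1] = e ![0, 0, 0, 1] := by
        rw [LinearEquiv.trans_apply, hT]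
        congr 1
        ext k; fin_cases k <;> simp [Matrix.mulVec, dotProduct, Fin.sum_univ_four]
      have hdet : (1 : ℝ) * l₂⁻¹ - 0 * 0 ≠ 0 := by simpa using hl'
      have h' := h.change hdet (F := F) (by simp) rfl
      have hF' : ∀ c, F ((T.trans e) c) = c 1 ^ 2 - c 0 * c 2 := by
        intro c
        rw [LinearEquiv.trans_apply, hF, hT]
        simp [Matrix.mulVec, dotProduct, Fin.sum_univ_four]
      have hG' : ∀ c, ((0 : ℝ) • F + l₂⁻¹ • G) ((T.trans e) c) =
          c 3 * c 2 - (-α / l₂) * c 0 * c 1 := by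
        intro c
        rw [LinearEquiv.trans_apply, _root_.add_apply, _root_.smul_apply, _root_.smul_apply, hG, hT]
        simp [Matrix.mulVec, dotProduct, Fin.sum_univ_four, hl]
        field_simp
        ring
      rw [← hTN] at hN hN'
      obtain ⟨k₀, hk₀⟩ := h'.exists_mem_line_iff (T.trans e) hF' (l₁ := 0) (l₂ := 1) (α := α / l₂)
        (β := 0) (γ := 0) (δ := 0) (fun c => by rw [hG']; ring) hN hN'
      exact h'.hasGrid_of_tangent hq hQF (T.trans e) hF' hG' hk₀
  -- the translation of `u` by `m` moves the pole to zero
  · obtain ⟨m, hm⟩ : ∃ m, m = -l₂ / l₁ := ⟨_, rfl⟩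
    have hml : l₂ = -m * l₁ := by rw [hm]; field_simp
    obtain ⟨r, hr⟩ : ∃ r, r = (3 * α * m + β) / l₁ := ⟨_, rfl⟩
    obtain ⟨r', hr'⟩ : ∃ r', r' = (3 * α * m ^ 2 + 2 * β * m + γ) / l₁ := ⟨_, rfl⟩
    obtain ⟨s, hs⟩ : ∃ s, s = -(α * m ^ 3 + β * m ^ 2 + γ * m + δ) / l₁ := ⟨_, rfl⟩
    obtain ⟨T, hT⟩ := exists_equiv_mulVec
      !![1, 2 * m, m ^ 2, 0; 0, 1, m, 0; 0, 0, 1, 0; -α / l₁, -r, -r', 1]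
      !![1, -2 * m, m ^ 2, 0; 0, 1, -m, 0; 0, 0, 1, 0;
        α / l₁, -2 * m * α / l₁ + r, m ^ 2 * α / l₁ - m * r + r', 1] (by
        ext i j; fin_cases i <;> fin_cases j <;> simp [Matrix.mul_apply,
          Fin.sum_univ_four] <;> ring)
    have hTN : (T.trans e) ![0, 0, 0, 1] = e ![0, 0, 0, 1] := by
      rw [LinearEquiv.trans_apply, hT]
      congr 1
      ext k; fin_cases k <;> simp [Matrix.mulVec, dotProduct, Fin.sum_univ_four]
    have hdet : (1 : ℝ) * l₁⁻¹ - 0 * ((α * m + β) / l₁) ≠ 0 := by simpa using hl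
    have h' := h.change hdet (F := F) (by simp) rfl
    have hF' : ∀ c, F ((T.trans e) c) = c 1 ^ 2 - c 0 * c 2 := by
      intro c
      rw [LinearEquiv.trans_apply, hF, hT]
      simp [Matrix.mulVec, dotProduct, Fin.sum_univ_four]
      ring
    have hG' : ∀ c, (((α * m + β) / l₁) • F + l₁⁻¹ • G) ((T.trans e) c) =
        c 3 * c 1 - s * c 2 ^ 2 := by
      intro c
      rw [LinearEquiv.trans_apply, _root_.add_apply, _root_.smul_apply, _root_.smul_apply, hF, hG,
        hT]
      simp [Matrix.mulVec, dotProduct, Fin.sum_univ_four]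
      rw [hml, hs, hr, hr']
      field_simp
      ring
    rw [← hTN] at hN hN'
    obtain ⟨k₀, hk₀⟩ := h'.exists_mem_line_iff (T.trans e) hF' (l₁ := 1) (l₂ := 0) (α := 0)
      (β := 0) (γ := 0) (δ := -s) (fun c => by rw [hG']; ring) hN hN'
    by_cases hs0 : s = 0
    · -- the coordinates in which the two lines are interchanged
      have hG'' : ∀ c, (((α * m + β) / l₁) • F + l₁⁻¹ • G) ((T.trans e) c) = c 3 * c 1 := by
        intro c; rw [hG', hs0]; ring
      obtain ⟨S, hS⟩ := exists_equiv_mulVec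
        !![0, 0, 1, 0; 0, 1, 0, 0; 1, 0, 0, 0; 0, 0, 0, 1]
        !![0, 0, 1, 0; 0, 1, 0, 0; 1, 0, 0, 0; 0, 0, 0, 1] (by
          ext i j; fin_cases i <;> fin_cases j <;> simp [Matrix.mul_apply, Fin.sum_univ_four])
      have hSc : ∀ c, S c = ![c 2, c 1, c 0, c 3] := by
        intro c
        rw [hS]
        ext k; fin_cases k <;> simp [Matrix.mulVec, dotProduct, Fin.sum_univ_four]
      have hSN : (S.trans (T.trans e)) ![0, 0, 0, 1] = (T.trans e) ![0, 0, 0, 1] := by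
        rw [LinearEquiv.trans_apply, hSc]
        rfl
      have hSx : ∀ x, (S.trans (T.trans e)).symm x 2 = (T.trans e).symm x 0 := by
        intro x
        obtain ⟨c, rfl⟩ := (S.trans (T.trans e)).surjective x
        rw [LinearEquiv.symm_apply_apply, LinearEquiv.trans_apply, LinearEquiv.symm_apply_apply,
          hSc]
        rfl
      rw [← hSN] at hN hN'
      obtain ⟨k₁, hk₁⟩ := h'.exists_mem_line_iff (S.trans (T.trans e)) (l₁ := 1) (l₂ := 0) (α := 0)
        (β := 0) (γ := 0) (δ := 0)
        (fun c => by rw [LinearEquiv.trans_apply, hF', hSc]; simp; ring)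
        (fun c => by rw [LinearEquiv.trans_apply, hG'', hSc]; simp) hN hN'
      simp only [hSx] at hk₁
      exact h'.hasGrid_of_two_lines hq hQF (T.trans e) hF' hG'' hk₀ hk₁
    · exact h'.hasGrid_of_secant hq hQF (T.trans e) hF' hs0 hG' hk₀

/-- A radical that meets the plane of each circuit of a cube trivially is at most one-dimensional.
-/
theorem IsCube.mem_span_radical (hO : IsCube O) (hU : Module.finrank ℝ U = 4)
    (hN : ∀ N, (∀ u, polar Q N u = 0) → ∀ s, IsVertexLabel s →
      N ∈ span ℝ (Set.range fun k => O k (s k)) → N = 0)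
    {N z : U} (hNrad : ∀ u, polar Q N u = 0) (hN0 : N ≠ 0) (hz : ∀ u, polar Q z u = 0) :
    z ∈ span ℝ {N} := by
  have hmem : ∀ z, (hO.basis hU 0 true).coord 1 z = 0 → (∀ u, polar Q z u = 0) → z = 0 :=
    fun z h0 hz' => hN z hz' _ (isVertexLabel_edgeLabel (show (1 : Fin 4) ≠ 0 by decide) true)
      (hO.mem_span_of_coord_eq_zero hU true h0)
  generalize (hO.basis hU 0 true).coord 1 = f at hmem
  have hfN : f N ≠ 0 := fun h0 => hN0 (hmem N h0 hNrad)
  -- a combination of `N` and `z` which lies in the plane of a circuit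
  have h1 := hmem (f N • z - f z • N)
    (by rw [map_sub, map_smul, map_smul, smul_eq_mul, smul_eq_mul]; ring) fun u => by
      rw [polar_sub_left, polar_smul_left, polar_smul_left, hz, hNrad, smul_zero, smul_zero,
        sub_zero]
  refine mem_span_singleton.2 ⟨(f N)⁻¹ * f z, ?_⟩
  rw [mul_smul, ← sub_eq_zero.1 h1, smul_smul, inv_mul_cancel₀ hfN, one_smul]

/-- If the curve contains a line, and the quadric `Q` contains no other lines than those through its
singular points, then `Q` is a cone whose vertex lies on this line. -/
theorem CubePair.hasGrid_of_line (h : CubePair Q R O O' i l)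
    (hline : ∀ x y : U, LinearIndependent ℝ ![x, y] → Q x = 0 → Q y = 0 → polar Q x y = 0 →
      ∃ N ∈ span ℝ {x, y}, N ≠ 0 ∧ ∀ u, polar Q N u = 0)
    (hN : ∀ N, (∀ u, polar Q N u = 0) → ∀ s, IsVertexLabel s →
      (N ∈ span ℝ (Set.range fun k => O k (s k)) ∨ N ∈ span ℝ (Set.range fun k => O' k (s k))) →
      N = 0) (hnl : ¬ NoLine Q R) : HasGrid Q O O' i l := by
  unfold NoLine at hnl
  push Not at hnl
  obtain ⟨x, y, hxy, hQR⟩ := hnl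
  have hvals : ∀ S : QuadraticForm ℝ U, (∀ s t : ℝ, S (s • x + t • y) = 0) →
      S x = 0 ∧ S y = 0 ∧ polar S x y = 0 := by
    intro S hS
    have h1 := hS 1 0
    have h2 := hS 0 1
    have h3 := hS 1 1
    simp only [one_smul, zero_smul, add_zero, zero_add] at h1 h2 h3
    exact ⟨h1, h2, by rw [polar, h1, h2, h3]; ring⟩
  obtain ⟨hQx, hQy, hQxy⟩ := hvals Q fun s t => (hQR s t).1
  obtain ⟨N, hNL, hN0, hNrad⟩ := hline x y hxy hQx hQy hQxy
  obtain ⟨s, t, hst⟩ := mem_span_pair.1 hNL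
  obtain ⟨a, s', t', ha, haN⟩ : ∃ a, ∃ s' t' : ℝ, a = s' • x + t' • y ∧ a ∉ span ℝ {N} := by
    by_contra! hcon
    obtain ⟨u, hu⟩ := mem_span_singleton.1 (hcon x 1 0 (by simp))
    obtain ⟨v, hv⟩ := mem_span_singleton.1 (hcon y 0 1 (by simp))
    have h1 := LinearIndependent.pair_iff.1 hxy v (-u) (by
      rw [← hu, ← hv, smul_smul, smul_smul, ← add_smul]; ring_nf; simp)
    rw [h1.1, zero_smul] at hv
    exact hxy.ne_zero 1 hv.symm
  have hradN : ∀ z, (∀ u, polar Q z u = 0) → z ∈ span ℝ {N} := fun z hz =>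
    h.left.mem_span_radical h.finrank_eq
      (fun z hz' s hs hzs => hN z hz' s hs (Or.inl hzs)) hNrad hN0 hz
  have hRaN : polar R a N = 0 := by
    have h1 : R (a + N) = 0 := by
      rw [ha, ← hst]
      have := (hQR (s' + s) (t' + t)).2
      rw [← this]
      congr 1
      module
    rw [polar, h1, ha, ← hst, (hQR s' t').2, (hQR s t).2]; ring
  obtain ⟨F, G, q, h', hq, hQF, e, l₁, l₂, α, β, γ, δ, he, hF, hG⟩ :=
    h.exists_cone_coordinates hradN hNrad haN hN0 (by rw [ha]; exact (hQR s' t').1)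
      (by rw [ha]; exact (hQR s' t').2) (by rw [← hst]; exact (hQR s t).2) hRaN
  refine h'.hasGrid_of_cone hq hQF e hF hG ?_ ?_ <;> rw [he]
  · exact fun s hs h0 => hN0 (hN N hNrad s hs (Or.inl h0))
  · exact fun s hs h0 => hN0 (hN N hNrad s hs (Or.inr h0))

/-- Neighbouring cubes on the intersection of two quadrics are contained in a grid, provided that
each line on `Q` contains a singular point of `Q`, and that the planes of the circuits do not
contain singular points of `Q`. -/
theorem CubePair.hasGrid (h : CubePair Q R O O' i l)
    (hline : ∀ x y : U, LinearIndependent ℝ ![x, y] → Q x = 0 → Q y = 0 → polar Q x y = 0 →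
      ∃ N ∈ span ℝ {x, y}, N ≠ 0 ∧ ∀ u, polar Q N u = 0)
    (hN : ∀ N, (∀ u, polar Q N u = 0) → ∀ s, IsVertexLabel s →
      (N ∈ span ℝ (Set.range fun k => O k (s k)) ∨ N ∈ span ℝ (Set.range fun k => O' k (s k))) →
      N = 0) : HasGrid Q O O' i l := by
  by_cases hnl : NoLine Q R
  · exact h.hasGrid_of_noLine hnl
  · exact h.hasGrid_of_line hline hN hnl

end CurvesWithLine

/-! ### Existence of the grid -/

section Existence

/-- Two neighbouring conical octahedra are contained in a generalised conical grid. -/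
theorem exists_generalizedConicalGrid {O O' : FacePlanes} {i l : Fin 4}
    (hO : IsConicalOctahedron O) (hO' : IsConicalOctahedron O')
    (hcontact : InOrientedContactAlongEdge O O' i l) :
    ∃ P : PlaneFamily, ContainsPair P O O' i l ∧ IsGeneralizedConicalGrid P := by
  obtain ⟨hil, hi, hl, hk⟩ := hcontact
  have hc := hO.isCube
  have hc' := hO'.isCube
  -- the four-dimensional space which is spanned by the coordinate vectors of all given planes
  set S : Submodule ℝ (E3 × ℝ × ℝ) :=
    span ℝ (Set.range fun m => (O m (starLabel l false m)).lift) with hS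
  have hU : Module.finrank ℝ S = 4 := by
    rw [hS, finrank_span_eq_card (hc.linearIndependent l false)]; simp
  have hmem : ∀ m b, (O m b).lift ∈ S := hc.mem_span_star l false
  -- in the second octahedron the same four planes are the face `(i, false)` and its three
  -- neighbours
  have hstar : ∀ j, O j (starLabel l false j) = O' j (starLabel i false j) := by
    intro j
    by_cases hji : j = i
    · subst hji; simp [starLabel, hil, hi]
    by_cases hjl : j = l
    · subst hjl; simp [starLabel, hil.symm, hl]
    · rw [hk j hji hjl]; simp [starLabel, hji, hjl]
  have hmem' : ∀ m b, (O' m b).lift ∈ S := by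
    intro m b
    have h1 := hc'.mem_span_star i false m b
    have h2 : (fun j => (O j (starLabel l false j)).lift) =
        fun j => (O' j (starLabel i false j)).lift := by
      funext j
      congr 1
      exact hstar j
    rw [hS, h2]
    exact h1
  set X : Fin 4 → Bool → S := fun m b => ⟨(O m b).lift, hmem m b⟩
  set X' : Fin 4 → Bool → S := fun m b => ⟨(O' m b).lift, hmem' m b⟩
  have hX : IsCube X := IsCube.of_map S.subtype S.injective_subtype hc
  have hX' : IsCube X' := IsCube.of_map S.subtype S.injective_subtype hc'
  have hXi : X' i false = X i true := Subtype.ext (congrArg OrientedPlane.lift hi)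
  have hXl : X' l true = X l false := Subtype.ext (congrArg OrientedPlane.lift hl)
  have hXk : ∀ k, k ≠ i → k ≠ l → ∀ ε, X' k ε = X k ε := fun k h1 h2 ε =>
    Subtype.ext (congrArg OrientedPlane.lift (hk k h1 h2 ε))
  set Q : QuadraticForm ℝ S := blaschkeForm.comp S.subtype with hQdef
  have hQ : ∀ m b, Q (X m b) = 0 := fun m b => blaschkeForm_lift _
  have hQ' : ∀ m b, Q (X' m b) = 0 := fun m b => blaschkeForm_lift _
  have hpolar : ∀ x y : S, polar Q x y = 2 * (inner ℝ x.1.1 y.1.1 - x.1.2.2 * y.1.2.2) :=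
    fun x y => polar_blaschkeForm x.1 y.1
  have hnormal : ∀ v : E3, ‖v‖ = 1 → ∀ m b, inner ℝ v (O m b).normal = (1 : ℝ) →
      (O m b).normal = v := fun v hv m b h =>
    ((inner_eq_one_iff_of_norm_eq_one (𝕜 := ℝ) hv (O m b).norm_normal).1 h).symm
  -- a vector in the radical of the quadratic form is a multiple of `(0, 1, 0)`
  have hrad : ∀ N : S, (∀ u, polar Q N u = 0) → N.1.1 = 0 := by
    intro N hN
    have h0 : blaschkeForm N.1 = 0 := by
      have := hN N
      rw [polar_self] at this
      exact (smul_eq_zero.1 this).resolve_left two_ne_zero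
    by_cases hw : N.1.2.2 = 0
    · exact blaschkeForm_eq_zero h0 hw
    exfalso
    have hin : ∀ m b, inner ℝ (N.1.2.2⁻¹ • N.1.1) (O m b).normal = (1 : ℝ) := by
      intro m b
      have h1 := hN (X m b)
      rw [hpolar] at h1
      have h2 : inner ℝ N.1.1 (O m b).normal = N.1.2.2 := by
        have : inner ℝ N.1.1 (O m b).normal - N.1.2.2 * 1 = 0 := by
          simpa [X, OrientedPlane.lift] using h1
        linarith
      rw [inner_smul_left, h2]
      simp [hw]
    have hn : ‖N.1.2.2⁻¹ • N.1.1‖ = 1 := by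
      rw [blaschkeForm_apply, real_inner_self_eq_norm_sq, sub_eq_zero, ← _root_.sq,
        sq_eq_sq_iff_abs_eq_abs, abs_norm] at h0
      rw [norm_smul, norm_inv, Real.norm_eq_abs, h0, inv_mul_cancel₀ (abs_ne_zero.2 hw)]
    obtain ⟨V, hV, -⟩ := hO.1.2
    -- all planes would have the same normal
    have hs := isVertexLabel_pair (show (0 : Fin 4) ≠ 1 by decide)
    have h3 := (hX.circuit _ hs).not_mem_span_singleton (show (0 : Fin 4) ≠ 1 by decide)
    obtain ⟨a, c, -, hl'⟩ := (hO.2 _ hs).exists_lift_eq (hV _ hs)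
    refine h3 (mem_span_singleton.2 ⟨1, ?_⟩)
    rw [one_smul]
    refine Subtype.ext ?_
    change (O 1 _).lift = (O 0 _).lift
    have e1 := hl' 1
    have e0 := hl' 0
    rw [hnormal _ hn _ _ (hin _ _)] at e1 e0
    exact e1.trans e0.symm
  have hQ0 : Q ≠ 0 := by
    intro h0
    obtain ⟨a, ha⟩ : ∃ a : S, a.1.2.2 = 1 := ⟨X 0 true, rfl⟩
    have h1 := hrad a fun u => by rw [h0]; simp [polar]
    have h2 : Q a = 0 := by rw [h0]; rfl
    have h3 : blaschkeForm a.1 = 0 := h2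
    rw [blaschkeForm_apply, h1, ha] at h3
    simp at h3
  obtain ⟨R, hR, hR', hsm, hsm'⟩ := exists_pencil hX hX' hU hil hXi hXl hXk hQ0 hQ hQ'
  have hpair : CubePair Q R X X' i l := ⟨hU, hX, hX', hil, hXi, hXl, hXk, hQ, hQ', hR, hR', hsm,
    hsm'⟩
  -- an isotropic line contains a vector with the last coordinate zero, which belongs to the
  -- radical
  obtain ⟨Y, hY, hYdep, hY01, hYi, hYl⟩ := hpair.hasGrid (fun x y hxy hx hy hp => by
      have hfst : ∀ z : S, Q z = 0 → z.1.2.2 = 0 → ∀ u, polar Q z u = 0 := by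
        intro z hz hw u
        have h1 : z.1.1 = 0 := blaschkeForm_eq_zero hz hw
        rw [hpolar, h1, hw]; simp
      rw [LinearIndependent.pair_iff] at hxy
      by_cases hx0 : x.1.2.2 = 0
      · refine ⟨x, subset_span (by simp), ?_, hfst x hx hx0⟩
        rintro rfl
        simpa using (hxy 1 0 (by simp)).1
      · refine ⟨y.1.2.2 • x - x.1.2.2 • y, sub_mem (smul_mem _ _ (subset_span (by simp)))
          (smul_mem _ _ (subset_span (by simp))), ?_, hfst _ ?_ ?_⟩
        · intro h
          have := (hxy y.1.2.2 (-x.1.2.2) (by rw [neg_smul, ← sub_eq_add_neg, h])).2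
          exact hx0 (neg_eq_zero.1 this)
        · rw [sub_eq_add_neg, QuadraticMap.map_add Q, QuadraticMap.map_smul, QuadraticMap.map_neg,
            QuadraticMap.map_smul, hx, hy, polar_neg_right, polar_smul_left, polar_smul_right, hp]
          simp
        · change y.1.2.2 * x.1.2.2 - x.1.2.2 * y.1.2.2 = 0
          ring)
    (fun N hN s hs hmemN => by
      have h0 := hrad N hN
      refine Subtype.ext ?_
      rcases hmemN with h | h
      · refine hO.fst_ne_zero hs (y := N.1) ?_ h0
        have := mem_map_of_mem (f := S.subtype) h
        rwa [map_span, ← Set.range_comp] at this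
      · refine hO'.fst_ne_zero hs (y := N.1) ?_ h0
        have := mem_map_of_mem (f := S.subtype) h
        rwa [map_span, ← Set.range_comp] at this)
  have hreal : ∀ k n, ∃ (π : OrientedPlane) (c : ℝ), c ≠ 0 ∧ π.lift = c • (Y k n).1 := by
    intro k n
    obtain ⟨h1, u, hu⟩ := hY k n
    exact exists_orientedPlane h1 ⟨u.1, hu⟩
  choose P c hc0 hP using hreal
  have hspan : ∀ k n (π : OrientedPlane) (hπ : π.lift ∈ S), Y k n ∈ span ℝ {⟨π.lift, hπ⟩} →
      P k n = π := by
    intro k n π hπ h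
    obtain ⟨r, hr⟩ := mem_span_singleton.1 h
    refine OrientedPlane.eq_of_lift_mem_span (mem_span_singleton.2 ⟨c k n * r, ?_⟩)
    rw [hP, ← hr, mul_smul]; rfl
  refine ⟨P, ⟨?_, ?_⟩, fun n hn => ?_⟩
  · funext k b
    cases b
    · simpa [cell] using hspan k 0 _ (hmem k false) (hY01 k).1
    · simpa [cell] using hspan k 1 _ (hmem k true) (hY01 k).2
  · funext k b
    by_cases hki : k = i
    · subst hki
      rw [(cell_single_sub_single hil b).1]
      cases b
      · simpa [hi] using hspan k 1 _ (hmem k true) (hY01 k).2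
      · simpa using hspan k 2 _ (hmem' k true) hYi
    by_cases hkl : k = l
    · subst hkl
      rw [(cell_single_sub_single hil b).2.1]
      cases b
      · simpa using hspan k (-1) _ (hmem' k false) hYl
      · simpa [hl] using hspan k 0 _ (hmem k false) (hY01 k).1
    rw [(cell_single_sub_single hil b).2.2 k hki hkl, hk k hki hkl]
    cases b
    · simpa using hspan k 0 _ (hmem k false) (hY01 k).1
    · simpa using hspan k 1 _ (hmem k true) (hY01 k).2
  · rw [inContactWithGeneralizedCone_iff]
    intro hind
    refine hYdep n hn ?_
    have h1 : LinearIndependent ℝ fun k => (Y k (n k)).1 := by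
      have h2 := hind.units_smul fun k => (Units.mk0 _ (hc0 k (n k)))⁻¹
      convert h2 using 2 with k
      simp only [Pi.smul_apply', hP]
      rw [Units.smul_def, smul_smul]
      simp [hc0]
    exact LinearIndependent.of_comp S.subtype h1

end Existence

/-! ### Existence and uniqueness -/

theorem mainTheorem10 (O O' : FacePlanes) (i l : Fin 4)
    (hO : IsConicalOctahedron O) (hO' : IsConicalOctahedron O')
    (hcontact : InOrientedContactAlongEdge O O' i l) :
    (∃ P : PlaneFamily, ContainsPair P O O' i l ∧ IsGeneralizedConicalGrid P) ∧
    (∀ (N : ℕ) (P Q : PlaneFamily),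
      ContainsPair P O O' i l → IsConicalOctahedralGridUpTo N P →
      ContainsPair Q O O' i l → IsGeneralizedConicalGridUpTo N Q →
      ∀ (k : Fin 4) (m : ℤ), -(N : ℤ) ≤ m → m ≤ N + 1 → P k m = Q k m) ∧
    ((∀ (N : ℕ) (P : PlaneFamily),
        ContainsPair P O O' i l → IsGeneralizedConicalGridUpTo N P →
        IsConicalOctahedralGridUpTo N P) →
      ∃! P : PlaneFamily, ContainsPair P O O' i l ∧ IsConicalOctahedralGrid P) ∧
    (∀ P Q : PlaneFamily,
      ContainsPair P O O' i l → IsConicalOctahedralGrid P →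
      ContainsPair Q O O' i l → IsConicalOctahedralGrid Q → P = Q) := by
  have huniq : ∀ P Q : PlaneFamily,
      ContainsPair P O O' i l → IsConicalOctahedralGrid P →
      ContainsPair Q O O' i l → IsConicalOctahedralGrid Q → P = Q := by
    intro P Q hPO hP hQO hQ
    funext k m
    refine eq_of_containsPair hcontact.1 m.natAbs P Q hPO (fun x _ hx => hP x hx) hQO
      (fun n _ hn => hQ.isGeneralizedConicalGrid n hn) k m ?_ ?_ <;> omega
  refine ⟨exists_generalizedConicalGrid hO hO' hcontact, fun N P Q hPO hP hQO hQ =>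
    eq_of_containsPair hcontact.1 N P Q hPO hP hQO hQ, fun h => ?_, huniq⟩
  obtain ⟨P, hPO, hP⟩ := exists_generalizedConicalGrid hO hO' hcontact
  refine ⟨P, ⟨hPO, fun x hx => ?_⟩, fun Q hQ => huniq Q P hQ.1 hQ.2 hPO fun x hx => ?_⟩
  all_goals
    refine h (∑ k, (x k).natAbs) P hPO (fun n _ hn => hP n hn) x (fun k => ?_) hx
    have h1 : (x k).natAbs ≤ ∑ k, (x k).natAbs :=
      Finset.single_le_sum (f := fun k => (x k).natAbs) (fun _ _ => Nat.zero_le _)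
        (Finset.mem_univ k)
    obtain ⟨M, hM⟩ : ∃ M, M = ∑ k, (x k).natAbs := ⟨_, rfl⟩
    rw [← hM] at h1 ⊢
    omega
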